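/- **Setting.** Let $N\in\mathbb N$, $T>0$, $Q_T=(0,T)\times\mathbb R$, $\eta\in(0,\infty]$ and, for $k=1,\dots,N$, let $f^k(u)=u\,g^k(u)$, where $g^k:\mathbb R\to\mathbb R$ is Lipschitz and non-increasing with $g^k(1)=0$. Let $\nu^k:\mathbb R\times\mathbb R\to\mathbb R$ be bounded on $\mathbb R\times[0,1]$ with $\nu^k(\cdot,u)\in C^2(\mathbb R)$ for every $u\in\mathbb R$ and $\nu^k(x,\cdot)\in C^2(\mathbb R)\cap W^{2,\infty}(\mathbb R)$ for every $x\in\mathbb R$; the mixed second derivatives exist on $\mathbb R\times[0,1]$, and all first and second derivatives of $\nu^k$ are bounded on $\mathbb R\times[0,1]$; there are a constant $\mathcal C_0$ and a function $a_0:\mathbb R\to\mathbb R$ of bounded variation with $|\nu^k(x,u)-\nu^k(y,u)|\le \mathcal C_0|a_0(x)-a_0(y)|$ for all $x,y,u\in\mathbb R$ and all $k$. Let $\omega_\eta\in (C^2\cap BV\cap W^{2,\infty})([0,\eta])$ (on $[0,\infty)$ if $\eta=\infty$) be non-negative and non-increasing with $\int_0^\eta\omega_\eta=1$, and put $(w*\omega_\eta)(x)=\int_x^{x+\eta}\omega_\eta(y-x)w(y)\,dy$.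 Consider the system $$\partial_t u^k+\partial_x\big(f^k(u^k)\,\nu^k(x,u^k*\omega_\eta)\big)=\mathcal R^k_{\boldsymbol u},\qquad k=1,\dots,N,$$ where $\mathcal R^k_{\boldsymbol u}=S^{k-1}(x,u^{k-1},u^k,u^{k-1}*\omega_\eta,u^k*\omega_\eta)-S^k(x,u^k,u^{k+1},u^k*\omega_\eta,u^{k+1}*\omega_\eta)$, $S^0=S^N=0$, and for $1\le k<N$ $$S^k(x,a,b,A,B)=\big(g^{k+1}(b)\nu^{k+1}(x,B)-g^k(a)\nu^k(x,A)\big)^+a-\big(g^{k+1}(b)\nu^{k+1}(x,B)-g^k(a)\nu^k(x,A)\big)^-b .$$ An *entropy solution* on $[0,T]$ with initial datum $\boldsymbol u_0\in((L^1\cap BV)(\mathbb R;[0,1]))^N$ is a function $\boldsymbol u\in(\mathrm{Lip}([0,T];L^1(\mathbb R;[0,1]))\cap L^\infty([0,T];BV(\mathbb R)))^N$ with $\boldsymbol u(0,\cdot)=\boldsymbol u_0$ a.e. such that for all $k$, all $\alpha\in\mathbb R$ and all $0\le\phi\in C_c^\infty([0,T)\times\mathbb R)$, with $\mathcal U^k(t,x)=\nu^k(x,(u^k*\omega_\eta)(t,x))$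 and $\mathcal G^k(a,b)=\operatorname{sgn}(a-b)(f^k(a)-f^k(b))$, $$\int_{Q_T}|u^k-\alpha|\phi_t+\int_{Q_T}\mathcal G^k(u^k,\alpha)\,\mathcal U^k\phi_x-\int_{Q_T}\operatorname{sgn}(u^k-\alpha)f^k(\alpha)\,\mathcal U^k_x\phi+\int_{\mathbb R}|u^k(0,x)-\alpha|\phi(0,x)\,dx\ \ge\ -\int_{Q_T}\operatorname{sgn}(u^k-\alpha)\,\mathcal R^k_{\boldsymbol u}\,\phi .$$ **Theorem (stability and uniqueness).** Let $\boldsymbol u,\boldsymbol v$ be entropy solutions with initial data $\boldsymbol u_0,\boldsymbol v_0\in((L^1\cap BV)(\mathbb R;[0,1]))^N$. Then $$\sum_{k=1}^N\|u^k(T,\cdot)-v^k(T,\cdot)\|_{L^1(\mathbb R)}\le \mathcal C_T\sum_{k=1}^N\|u_0^k-v_0^k\|_{L^1(\mathbb R)},$$ where $\mathcal C_T$ depends only on $N$, $T$ and an upper bound for the following quantities: $\|\omega_\eta\|_{L^\infty}$; $|\omega_\eta|_{\mathrm{Lip}([0,\eta])}$; the $L^\infty(\mathbb R\times[0,1])$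 norms of all first and second partial derivatives of the $\nu^k$; $|f^k|_{\mathrm{Lip}([0,1])}$; the Lipschitz constants of $S^k(x,\cdot)$ on $[0,1]^4$, uniformly in $x\in\mathbb R$; $\mathcal C_0$; $|a_0|_{BV}$; $\sum_k\|u_0^k\|_{L^1}$; $\sup_{t\in[0,T]}\sum_k\|v^k(t,\cdot)\|_{L^1}$; $\sup_{t\in[0,T]}TV(u^k(t,\cdot))$ and $\sup_{t\in[0,T]}TV(v^k(t,\cdot))$; and the Lipschitz constants of $t\mapsto u^k(t,\cdot)\in L^1(\mathbb R)$ on $[0,T]$. In particular, if $\boldsymbol u_0=\boldsymbol v_0$ a.e., then $\boldsymbol u=\boldsymbol v$ a.e. in $[0,T]\times\mathbb R$. -/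

import Mathlib

open MeasureTheory Set
open scoped NNReal ENNReal

noncomputable section

namespace Multilane

/-- Partial derivative of `h = h(x, u)` in the first variable. -/
def D1 (h : ℝ → ℝ → ℝ) (x u : ℝ) : ℝ := deriv (fun y => h y u) x

/-- Partial derivative of `h = h(x, u)` in the second variable. -/
def D2 (h : ℝ → ℝ → ℝ) (x u : ℝ) : ℝ := deriv (fun w => h x w) u

/-- Total variation of (the a.e. class of) a real function on the line: the least pointwise
variation among all functions that agree with it almost everywhere. -/
def essVar (w : ℝ → ℝ) : ℝ≥0∞ :=
  ⨅ (w' : ℝ → ℝ) (_ : w' =ᵐ[volume] w), eVariationOn w' univ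

/-- The data of the system. Lanes are numbered `1, …, N`; values of `g k` and `ν k`
for other `k` play no role. `C₀` and `a₀` are the constant and the function that control the
dependence of the velocities on the position. -/
structure Model where
  /-- the look-ahead distance, in `(0, ∞]` -/
  η : EReal
  /-- the kernel; only its values on `[0, η]` matter -/
  ω : ℝ → ℝ
  /-- the factor `g k` of the flux `u ↦ u * g k u` -/
  g : ℕ → ℝ → ℝ
  /-- the velocity `ν k x u` -/
  ν : ℕ → ℝ → ℝ → ℝ
  C₀ : ℝ
  a₀ : ℝ → ℝ

namespace Model

variable (m : Model)

/-- The interval `[0, η]`, which is `[0, ∞)` for `η = ∞`. -/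
def supp : Set ℝ := {z | 0 ≤ z ∧ (z : EReal) ≤ m.η}

/-- The flux factor `f^k(u) = u g^k(u)`. -/
def f (k : ℕ) (a : ℝ) : ℝ := a * m.g k a

/-- `(w * ω)(x) = ∫_x^{x+η} ω(y - x) w(y) dy`. -/
def conv (w : ℝ → ℝ) (x : ℝ) : ℝ := ∫ y in {y | y - x ∈ m.supp}, m.ω (y - x) * w y

/-- `𝒰^k(t, x) = ν^k(x, (u^k * ω)(t, x))`. -/
def velocity (u : ℕ → ℝ → ℝ → ℝ) (k : ℕ) (t x : ℝ) : ℝ := m.ν k x (m.conv (u k t) x)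

/-- The rate `S^k(x, a, b, A, B)` at which vehicles leave lane `k` for lane `k + 1`, with
`S^0 = S^N = 0`. -/
def S (N k : ℕ) (x a b A B : ℝ) : ℝ :=
  if 1 ≤ k ∧ k < N then
    max (m.g (k + 1) b * m.ν (k + 1) x B - m.g k a * m.ν k x A) 0 * a
      - (-min (m.g (k + 1) b * m.ν (k + 1) x B - m.g k a * m.ν k x A) 0) * b
  else 0

/-- `ℛ^k_u(t, x)`, the net flow into lane `k ≥ 1`. -/
def source (N : ℕ) (u : ℕ → ℝ → ℝ → ℝ) (k : ℕ) (t x : ℝ) : ℝ :=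
  m.S N (k - 1) x (u (k - 1) t x) (u k t x) (m.conv (u (k - 1) t) x) (m.conv (u k t) x)
    - m.S N k x (u k t x) (u (k + 1) t x) (m.conv (u k t) x) (m.conv (u (k + 1) t) x)

/-- `𝒢^k(a, b) = sgn(a - b) (f^k(a) - f^k(b))`. -/
def G (k : ℕ) (a b : ℝ) : ℝ := Real.sign (a - b) * (m.f k a - m.f k b)

/-- The standing assumptions on the data for `N` lanes. -/
structure Admissible (N : ℕ) : Prop where
  /-- `g^k` is Lipschitz, non-increasing, and vanishes at the maximal density. -/
  g_lip : ∀ k ∈ Finset.Icc 1 N, ∃ L : ℝ≥0, LipschitzWith L (m.g k)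
  g_one : ∀ k ∈ Finset.Icc 1 N, m.g k 1 = 0
  g_anti : ∀ k ∈ Finset.Icc 1 N, Antitone (m.g k)
  /-- `ν^k` is bounded on `ℝ × [0, 1]`. -/
  ν_bdd : ∀ k ∈ Finset.Icc 1 N, ∃ B : ℝ, ∀ x, ∀ u ∈ Icc (0 : ℝ) 1, |m.ν k x u| ≤ B
  /-- `ν^k(·, u) ∈ C²(ℝ)`. -/
  ν_C2_left : ∀ k ∈ Finset.Icc 1 N, ∀ u, ContDiff ℝ 2 (fun x => m.ν k x u)
  /-- `ν^k(x, ·) ∈ C²(ℝ) ∩ W^{2,∞}(ℝ)`. -/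
  ν_C2_right : ∀ k ∈ Finset.Icc 1 N, ∀ x, ContDiff ℝ 2 (fun u => m.ν k x u)
  ν_W2 : ∀ k ∈ Finset.Icc 1 N, ∀ x, ∃ B : ℝ, ∀ u,
    |m.ν k x u| ≤ B ∧ |D2 (m.ν k) x u| ≤ B ∧ |D2 (D2 (m.ν k)) x u| ≤ B
  /-- The mixed second derivatives exist on `ℝ × [0, 1]`. -/
  ν_mixed : ∀ k ∈ Finset.Icc 1 N, ∀ x, ∀ u ∈ Icc (0 : ℝ) 1,
    DifferentiableAt ℝ (fun w => D1 (m.ν k) x w) u ∧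
      DifferentiableAt ℝ (fun y => D2 (m.ν k) y u) x
  /-- All first and second derivatives are bounded on `ℝ × [0, 1]`. -/
  ν_deriv_bdd : ∀ k ∈ Finset.Icc 1 N, ∃ B : ℝ, ∀ x, ∀ u ∈ Icc (0 : ℝ) 1,
    |D1 (m.ν k) x u| ≤ B ∧ |D2 (m.ν k) x u| ≤ B ∧
      |D1 (D1 (m.ν k)) x u| ≤ B ∧ |D2 (D1 (m.ν k)) x u| ≤ B ∧
      |D1 (D2 (m.ν k)) x u| ≤ B ∧ |D2 (D2 (m.ν k)) x u| ≤ B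
  /-- `a₀` has bounded variation and controls the dependence of `ν^k` on `x`. -/
  a₀_bv : BoundedVariationOn m.a₀ univ
  ν_space : ∀ k ∈ Finset.Icc 1 N, ∀ u x y,
    |m.ν k x u - m.ν k y u| ≤ m.C₀ * |m.a₀ x - m.a₀ y|
  η_pos : 0 < m.η
  /-- `ω ∈ (C² ∩ BV ∩ W^{2,∞})([0, η])`. -/
  ω_C2 : ContDiffOn ℝ 2 m.ω m.supp
  ω_bv : BoundedVariationOn m.ω m.supp
  ω_W2 : ∃ B : ℝ, ∀ z ∈ m.supp, |m.ω z| ≤ B ∧ |iteratedDerivWithin 1 m.ω m.supp z| ≤ B ∧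
    |iteratedDerivWithin 2 m.ω m.supp z| ≤ B
  ω_nonneg : ∀ z ∈ m.supp, 0 ≤ m.ω z
  ω_anti : AntitoneOn m.ω m.supp
  /-- The kernel has unit mass. -/
  ω_mass : ∫ z in m.supp, m.ω z = 1

end Model

/-- `u₀ ∈ ((L¹ ∩ BV)(ℝ; [0, 1]))^N`. -/
def IsInitialDatum (N : ℕ) (u₀ : ℕ → ℝ → ℝ) : Prop :=
  ∀ k ∈ Finset.Icc 1 N,
    Integrable (u₀ k) ∧ (∀ᵐ x, u₀ k x ∈ Icc (0 : ℝ) 1) ∧ essVar (u₀ k) ≠ ∞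

/-- `u ∈ (Lip([0, T]; L¹(ℝ; [0, 1])) ∩ L^∞([0, T]; BV(ℝ)))^N`, for a function `u k t x`
of `(t, x)` that represents such an `L¹`-valued curve and is measurable in `(t, x)`. -/
structure InSolutionSpace (N : ℕ) (T : ℝ) (u : ℕ → ℝ → ℝ → ℝ) : Prop where
  meas : ∀ k ∈ Finset.Icc 1 N, AEStronglyMeasurable (fun p : ℝ × ℝ => u k p.1 p.2)
    (volume.restrict (Icc 0 T ×ˢ univ))
  integrable : ∀ k ∈ Finset.Icc 1 N, ∀ t ∈ Icc 0 T, Integrable (u k t)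
  range : ∀ k ∈ Finset.Icc 1 N, ∀ t ∈ Icc 0 T, ∀ᵐ x, u k t x ∈ Icc (0 : ℝ) 1
  lip : ∀ k ∈ Finset.Icc 1 N, ∃ L : ℝ, ∀ s ∈ Icc 0 T, ∀ t ∈ Icc 0 T,
    ∫ x, |u k s x - u k t x| ≤ L * |s - t|
  bv : ∀ k ∈ Finset.Icc 1 N, ∃ V : ℝ≥0, ∀ t ∈ Icc 0 T, essVar (u k t) ≤ V

/-- `0 ≤ φ ∈ C_c^∞([0, T) × ℝ)`, as the restriction to `t ≥ 0` of a smooth function on the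
plane with compact support in `(-∞, T) × ℝ`. -/
structure IsTestFunction (T : ℝ) (φ : ℝ → ℝ → ℝ) : Prop where
  smooth : ContDiff ℝ (⊤ : ℕ∞) (fun p : ℝ × ℝ => φ p.1 p.2)
  compact : HasCompactSupport (fun p : ℝ × ℝ => φ p.1 p.2)
  supp : tsupport (fun p : ℝ × ℝ => φ p.1 p.2) ⊆ Iio T ×ˢ univ
  nonneg : ∀ t ∈ Ico 0 T, ∀ x, 0 ≤ φ t x

/-- The Kruzhkov entropy inequality for lane `k`, the constant `α` and the test function `φ`;
here `Q_T = (0, T) × ℝ`. -/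
def EntropyInequality (m : Model) (N : ℕ) (T : ℝ) (u : ℕ → ℝ → ℝ → ℝ) (k : ℕ) (α : ℝ)
    (φ : ℝ → ℝ → ℝ) : Prop :=
  (∫ p in Ioo 0 T ×ˢ univ, |u k p.1 p.2 - α| * deriv (fun s => φ s p.2) p.1)
    + (∫ p in Ioo 0 T ×ˢ univ,
        m.G k (u k p.1 p.2) α * m.velocity u k p.1 p.2 * deriv (fun y => φ p.1 y) p.2)
    - (∫ p in Ioo 0 T ×ˢ univ, Real.sign (u k p.1 p.2 - α) * m.f k α
        * deriv (fun y => m.velocity u k p.1 y) p.2 * φ p.1 p.2)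
    + (∫ x, |u k 0 x - α| * φ 0 x)
  ≥ -∫ p in Ioo 0 T ×ˢ univ,
      Real.sign (u k p.1 p.2 - α) * m.source N u k p.1 p.2 * φ p.1 p.2

/-- `u` is an entropy solution on `[0, T]` with initial datum `u₀`. -/
structure IsEntropySolution (m : Model) (N : ℕ) (T : ℝ) (u₀ : ℕ → ℝ → ℝ)
    (u : ℕ → ℝ → ℝ → ℝ) : Prop where
  space : InSolutionSpace N T u
  initial : ∀ k ∈ Finset.Icc 1 N, u k 0 =ᵐ[volume] u₀ k
  entropy : ∀ k ∈ Finset.Icc 1 N, ∀ α : ℝ, ∀ φ : ℝ → ℝ → ℝ, IsTestFunction T φ →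
    EntropyInequality m N T u k α φ

/-- The norms and seminorms that the stability constant may depend on, besides `N` and `T`,
are at most `M`. -/
structure NormsLE (m : Model) (N : ℕ) (T M : ℝ) (u₀ : ℕ → ℝ → ℝ)
    (u v : ℕ → ℝ → ℝ → ℝ) : Prop where
  /-- `‖ω‖_∞` -/
  ω_sup : ∀ z ∈ m.supp, |m.ω z| ≤ M
  /-- `|ω|_{Lip([0, η])}` -/
  ω_lip : ∀ z ∈ m.supp, ∀ z' ∈ m.supp, |m.ω z - m.ω z'| ≤ M * |z - z'|
  /-- `|f^k|_{Lip([0, 1])}` -/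
  f_lip : ∀ k ∈ Finset.Icc 1 N, ∀ a ∈ Icc (0 : ℝ) 1, ∀ b ∈ Icc (0 : ℝ) 1,
    |m.f k a - m.f k b| ≤ M * |a - b|
  /-- the first and second derivatives of `ν^k` in `L^∞(ℝ × [0, 1])` -/
  ν_deriv : ∀ k ∈ Finset.Icc 1 N, ∀ x, ∀ w ∈ Icc (0 : ℝ) 1,
    |D1 (m.ν k) x w| ≤ M ∧ |D2 (m.ν k) x w| ≤ M ∧
      |D1 (D1 (m.ν k)) x w| ≤ M ∧ |D2 (D1 (m.ν k)) x w| ≤ M ∧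
      |D1 (D2 (m.ν k)) x w| ≤ M ∧ |D2 (D2 (m.ν k)) x w| ≤ M
  /-- `|S^k|` in `L^∞(ℝ; Lip([0, 1]^4))` -/
  S_lip : ∀ k ∈ Finset.Icc 1 N, ∀ x,
    ∀ a ∈ Icc (0 : ℝ) 1, ∀ b ∈ Icc (0 : ℝ) 1, ∀ A ∈ Icc (0 : ℝ) 1, ∀ B ∈ Icc (0 : ℝ) 1,
    ∀ a' ∈ Icc (0 : ℝ) 1, ∀ b' ∈ Icc (0 : ℝ) 1, ∀ A' ∈ Icc (0 : ℝ) 1, ∀ B' ∈ Icc (0 : ℝ) 1,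
    |m.S N k x a b A B - m.S N k x a' b' A' B'|
      ≤ M * (|a - a'| + |b - b'| + |A - A'| + |B - B'|)
  C₀_le : m.C₀ ≤ M
  /-- `|a₀|_{BV}` -/
  a₀_var : eVariationOn m.a₀ univ ≤ ENNReal.ofReal M
  /-- `‖u₀‖_{L¹}` -/
  u₀_L1 : ∑ k ∈ Finset.Icc 1 N, ∫ x, |u₀ k x| ≤ M
  /-- `‖v(t)‖_{L¹}` -/
  v_L1 : ∀ t ∈ Icc 0 T, ∑ k ∈ Finset.Icc 1 N, ∫ x, |v k t x| ≤ M
  /-- `sup_t TV(u^k(t))` and `sup_t TV(v^k(t))` -/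
  u_var : ∀ k ∈ Finset.Icc 1 N, ∀ t ∈ Icc 0 T, essVar (u k t) ≤ ENNReal.ofReal M
  v_var : ∀ k ∈ Finset.Icc 1 N, ∀ t ∈ Icc 0 T, essVar (v k t) ≤ ENNReal.ofReal M
  /-- the Lipschitz seminorm of `t ↦ u^k(t) ∈ L¹` -/
  u_lip : ∀ k ∈ Finset.Icc 1 N, ∀ s ∈ Icc 0 T, ∀ t ∈ Icc 0 T,
    ∫ x, |u k s x - u k t x| ≤ M * |s - t|

end Multilane

end

noncomputable section

/-! ### Translation moduli and measurable representatives -/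

namespace Multilane

open Filter Topology

/-! The proof is Kruzhkov's doubling of variables followed by Grönwall's inequality for the `L¹`
distance summed over the lanes, adapted to fluxes whose velocity depends nonlocally on the solution.

Time is doubled but not mollified. Testing the entropy inequality with products χ(t)ψ(x) shows that
∫|u(t,x) - α|ψ(x) dx grows at most like the time integral of an `entropyDensity`
(`integrated_of_distributional`). Inserting α = v(s,y) and ψ(x - y) and integrating in y
(`KruzhkovCurve.doubled`) gives one-sided bounds for the increments of F(t,s) = ∬|u(t,x) -
v(s,y)|ψ(x - y), separately in t and in s. Since F is Lipschitz, Rademacher's theorem applies: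
almost everywhere the derivative in the direction (1,1) is the sum of the two partial derivatives,
and restriction to almost every line s = t + c, then c → 0, bounds the growth on the diagonal
(`diagonal_sub_le_integral`). What remains is an estimate at frozen times.

That estimate is `integral_entropyDensity_add_le`. The dangerous term is the Kruzhkov flux at
(u(x),v(y)) times U(x) - V(y) times ψ'(x - y), because ∫|ψ'| blows up as the support of size δ
shrinks. Freezing it at (u(x),v(x)) and U(x) - V(x) leaves a constant times ∫ψ' = 0. The errors
contain v(x) - v(y) or V(x) - V(y), which gain a factor |x - y|, and ∫|z||ψ'(z)| dz does not depend
on δ. The bounded variation of v and the Lipschitz continuity of V are used here. The other terms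
compare velocity gradients and sources.

The velocities of two solutions must therefore be close uniformly, and their gradients close in `L¹`
with weight |v|, both in terms of the `L¹` distance of the solutions. Gradients of the nonlocal term
are placed on the kernel, which after extension by zero is unimodal and so has `L¹` translation
modulus at most 2‖ω‖_∞|t| (`integral_abs_ker_translate_le`, `integral_abs_deriv_conv_le`). The
sources are Lipschitz in the densities and the nonlocal terms, so they obey the same kind of bound.

Two sorts of constants occur. Those multiplying the distance are built from `M` alone and enter the
exponential. Those multiplying δ may depend on the individual model and solutions, because δ tends
to zero before Grönwall's inequality is used. Uniqueness takes as `M` whatever bounds the given data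
and solutions happen to have. -/

/-- A function of finite variation has `L¹` translation modulus at most its variation. -/
theorem lintegral_edist_translate_le {w : ℝ → ℝ} {V h : ℝ} (hV0 : 0 ≤ V)
    (hV : eVariationOn w univ ≤ ENNReal.ofReal V) (hh : 0 ≤ h) :
    ∫⁻ x, edist (w (x + h)) (w x) ≤ ENNReal.ofReal (V * h) := by
  have hle : ∀ x, eVariationOn w (Iic x) ≤ ENNReal.ofReal V := fun x =>
    (eVariationOn.mono w (subset_univ _)).trans hV
  have hfin : ∀ x, eVariationOn w (Iic x) ≠ ∞ := fun x =>
    ((hle x).trans_lt ENNReal.ofReal_lt_top).ne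
  -- The running variation is monotone with values in [0, V] and dominates the increments of `w`, so
  -- the integral of its translated differences telescopes.
  set v : ℝ → ℝ := fun x => (eVariationOn w (Iic x)).toReal with hv
  have hv0 : ∀ x, 0 ≤ v x := fun x => ENNReal.toReal_nonneg
  have hvV : ∀ x, v x ≤ V := fun x => ENNReal.toReal_le_of_le_ofReal hV0 (hle x)
  have hmono : Monotone v := fun x y hxy =>
    ENNReal.toReal_mono (hfin y) (eVariationOn.mono w (Iic_subset_Iic.2 hxy))
  have hpt : ∀ x, edist (w (x + h)) (w x) ≤ ENNReal.ofReal (v (x + h) - v x) := by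
    intro x
    have h1 : eVariationOn w (Iic x) + eVariationOn w (Icc x (x + h))
        = eVariationOn w (Iic (x + h)) := by
      rw [← eVariationOn.union w (x := x) isGreatest_Iic (isLeast_Icc (by linarith)),
        Iic_union_Icc_eq_Iic (by linarith)]
    have h2 : edist (w (x + h)) (w x) ≤ eVariationOn w (Icc x (x + h)) :=
      eVariationOn.edist_le w (right_mem_Icc.2 (by linarith)) (left_mem_Icc.2 (by linarith))
    refine h2.trans ?_
    have h3 : eVariationOn w (Icc x (x + h)) ≠ ∞ :=
      ((eVariationOn.mono w (subset_univ _)).trans hV |>.trans_lt ENNReal.ofReal_lt_top).ne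
    have h4 : v (x + h) = v x + (eVariationOn w (Icc x (x + h))).toReal := by
      simp only [hv]
      rw [← h1, ENNReal.toReal_add (hfin x) h3]
    rw [h4, add_sub_cancel_left, ENNReal.ofReal_toReal h3]
  refine (lintegral_mono hpt).trans ?_
  have hvm : Measurable v := hmono.measurable
  have hcov := aecover_Ioc (μ := volume) (a := fun n : ℕ => -(n : ℝ)) (b := fun n : ℕ => (n : ℝ))
    (l := atTop) (tendsto_neg_atTop_atBot.comp tendsto_natCast_atTop_atTop)
    tendsto_natCast_atTop_atTop
  have hlim := hcov.lintegral_tendsto_of_countably_generated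
    (f := fun x => ENNReal.ofReal (v (x + h) - v x)) (by fun_prop)
  refine le_of_tendsto' hlim fun n => ?_
  have hn : -(n : ℝ) ≤ n := by linarith [(Nat.cast_nonneg n : (0 : ℝ) ≤ n)]
  have hint : ∀ a b, IntervalIntegrable v volume a b := fun a b =>
    hmono.intervalIntegrable
  have hint' : ∀ a b, IntervalIntegrable (fun x => v (x + h)) volume a b := fun a b =>
    (hmono.comp (fun x y hxy => by simpa using hxy : Monotone (fun x : ℝ => x + h))).intervalIntegrable
  have hI : IntervalIntegrable (fun x => v (x + h) - v x) volume (-(n : ℝ)) n :=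
    (hint' _ _).sub (hint _ _)
  rw [← ofReal_integral_eq_lintegral_ofReal ((intervalIntegrable_iff_integrableOn_Ioc_of_le hn).1 hI)
    (Eventually.of_forall fun x => sub_nonneg.2 (hmono (by linarith))),
    ← intervalIntegral.integral_of_le hn]
  apply ENNReal.ofReal_le_ofReal
  rw [intervalIntegral.integral_sub (hint' _ _) (hint _ _),
    intervalIntegral.integral_comp_add_right (fun x => v x) h]
  -- After cancellation only the end pieces of length `h` at `n` and at `-n` survive, the second
  -- with a favourable sign.
  have e1 := intervalIntegral.integral_add_adjacent_intervals (hint (-(n : ℝ)) (-n + h))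
    (hint (-(n : ℝ) + h) (n + h))
  have e2 := intervalIntegral.integral_add_adjacent_intervals (hint (-(n : ℝ)) n)
    (hint (n : ℝ) (n + h))
  have b1 : ∫ x in (n : ℝ)..(n + h), v x ≤ V * h := by
    have := intervalIntegral.integral_mono_on (μ := volume) (by linarith) (hint (n : ℝ) (n + h))
      intervalIntegrable_const (fun x _ => hvV x)
    simpa [mul_comm] using this
  have b2 : 0 ≤ ∫ x in (-(n : ℝ))..(-n + h), v x :=
    intervalIntegral.integral_nonneg (by linarith) fun x _ => hv0 x
  linarith

/-- The infimum in `essVar` is not known to be attained, so a representative of variation below V +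
ε is used and ε → 0. Negative shifts reduce to positive ones by invariance of Lebesgue measure. -/
theorem lintegral_enorm_translate_le_of_essVar {w : ℝ → ℝ} {V : ℝ} (hV0 : 0 ≤ V)
    (hV : essVar w ≤ ENNReal.ofReal V) (h : ℝ) :
    ∫⁻ x, ‖w (x + h) - w x‖ₑ ≤ ENNReal.ofReal (V * |h|) := by
  have key : ∀ h : ℝ, 0 ≤ h → ∫⁻ x, ‖w (x + h) - w x‖ₑ ≤ ENNReal.ofReal (V * h) := by
    intro h hh
    have step : ∀ ε : ℝ, 0 < ε → ∫⁻ x, ‖w (x + h) - w x‖ₑ ≤ ENNReal.ofReal ((V + ε) * h) := by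
      intro ε hε
      have hlt : essVar w < ENNReal.ofReal (V + ε) :=
        hV.trans_lt (by rw [ENNReal.ofReal_lt_ofReal_iff] <;> linarith)
      rw [essVar, iInf_lt_iff] at hlt
      obtain ⟨w', hw'⟩ := hlt
      rw [iInf_lt_iff] at hw'
      obtain ⟨hae, hw'⟩ := hw'
      refine le_trans (le_of_eq ?_)
        (lintegral_edist_translate_le (by linarith : 0 ≤ V + ε) hw'.le hh)
      have hae2 : ∀ᵐ x, w' (x + h) = w (x + h) :=
        (measurePreserving_add_right volume h).quasiMeasurePreserving.ae hae
      refine lintegral_congr_ae ?_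
      filter_upwards [hae, hae2] with x h1 h2
      rw [h1, h2, edist_eq_enorm_sub]
    have hlim : Tendsto (fun ε : ℝ => ENNReal.ofReal ((V + ε) * h)) (𝓝[>] 0)
        (𝓝 (ENNReal.ofReal ((V + 0) * h))) := by
      refine ((ENNReal.continuous_ofReal.comp (by fun_prop)).tendsto 0).mono_left
        nhdsWithin_le_nhds
    rw [add_zero] at hlim
    exact ge_of_tendsto hlim (eventually_mem_nhdsWithin.mono fun ε hε => step ε hε)
  rcases le_total 0 h with hh | hh
  · rw [abs_of_nonneg hh]; exact key h hh
  · rw [abs_of_nonpos hh]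
    refine le_trans (le_of_eq ?_) (key (-h) (by linarith))
    rw [← lintegral_add_right_eq_self (fun x => ‖w (x + -h) - w x‖ₑ) h]
    refine lintegral_congr fun x => ?_
    rw [enorm_sub_rev]; simp

theorem integral_abs_eq_toReal {w : ℝ → ℝ} (hw : AEStronglyMeasurable w) :
    ∫ x, |w x| = (∫⁻ x, ‖w x‖ₑ).toReal := by
  have := integral_norm_eq_lintegral_enorm hw
  simpa using this

theorem integral_abs_translate_le_of_essVar {w : ℝ → ℝ} {V : ℝ} (hw : Integrable w) (hV0 : 0 ≤ V)
    (hV : essVar w ≤ ENNReal.ofReal V) (h : ℝ) :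
    ∫ x, |w (x + h) - w x| ≤ V * |h| := by
  rw [integral_abs_eq_toReal (w := fun x => w (x + h) - w x) ((hw.comp_add_right h).sub hw).aestronglyMeasurable]
  exact ENNReal.toReal_le_of_le_ofReal (by positivity)
    (lintegral_enorm_translate_le_of_essVar hV0 hV h)

/-- Projection of the real line to `[0, T]`. -/
def clamp (T t : ℝ) : ℝ := max 0 (min t T)

theorem clamp_mem {T : ℝ} (hT : 0 ≤ T) (t : ℝ) : clamp T t ∈ Icc 0 T :=
  ⟨le_max_left _ _, max_le hT (min_le_right _ _)⟩

theorem clamp_of_mem {T t : ℝ} (ht : t ∈ Icc 0 T) : clamp T t = t := by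
  rw [clamp, min_eq_left ht.2, max_eq_right ht.1]

theorem abs_clamp_sub_le (T s t : ℝ) : |clamp T s - clamp T t| ≤ |s - t| := by
  refine (abs_max_sub_max_le_max _ _ _ _).trans ?_
  refine max_le (by simp) ?_
  refine (abs_min_sub_min_le_max _ _ _ _).trans ?_
  simp

theorem measurable_clamp (T : ℝ) : Measurable (clamp T) := by
  unfold clamp; fun_prop

theorem clamp_clamp {T : ℝ} (hT : 0 ≤ T) (t : ℝ) : clamp T (clamp T t) = clamp T t :=
  clamp_of_mem (clamp_mem hT t)

/-- A Lipschitz curve in `L¹(ℝ; [0, 1])` has a jointly Borel measurable representative that agrees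
with it at every time. -/
theorem exists_measurable_representative {T L : ℝ} (hT : 0 ≤ T) {w : ℝ → ℝ → ℝ}
    (hint : ∀ t ∈ Icc 0 T, Integrable (w t))
    (hrange : ∀ t ∈ Icc 0 T, ∀ᵐ x, w t x ∈ Icc (0 : ℝ) 1)
    (hlip : ∀ s ∈ Icc 0 T, ∀ t ∈ Icc 0 T, ∫ x, |w s x - w t x| ≤ L * |s - t|) :
    ∃ w' : ℝ → ℝ → ℝ, Measurable (fun p : ℝ × ℝ => w' p.1 p.2) ∧
      (∀ t x, w' t x ∈ Icc (0 : ℝ) 1) ∧ (∀ t, w' t = w' (clamp T t)) ∧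
      ∀ t ∈ Icc 0 T, w' t =ᵐ[volume] w t := by
  have hW : ∀ t : ℝ, ∃ W : ℝ → ℝ, Measurable W ∧ (t ∈ Icc 0 T → W =ᵐ[volume] w t) := by
    intro t
    by_cases ht : t ∈ Icc 0 T
    · exact ⟨(hint t ht).1.mk, (hint t ht).1.stronglyMeasurable_mk.measurable,
        fun _ => (hint t ht).1.ae_eq_mk.symm⟩
    · exact ⟨0, measurable_const, fun h => absurd h ht⟩
  choose W hWm hWae using hW
  -- Dyadic times below the projected time. Each `d n` takes countably many values, so sampling
  -- Borel slices at `d n t` is jointly measurable; the values stay in [0, T], so the default slice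
  -- `0` is never sampled.
  set d : ℕ → ℝ → ℝ := fun n t => (⌊2 ^ n * clamp T t⌋₊ : ℝ) / 2 ^ n with hd
  have hdm : ∀ n, Measurable (fun p : ℝ × ℝ => W (d n p.1) p.2) := by
    intro n
    have h1 : Measurable (fun q : ℕ × ℝ => W ((q.1 : ℝ) / 2 ^ n) q.2) :=
      measurable_from_prod_countable_right fun i => hWm ((i : ℝ) / 2 ^ n)
    have h2 : Measurable (fun p : ℝ × ℝ => (⌊2 ^ n * clamp T p.1⌋₊, p.2)) := by
      have := measurable_clamp T
      fun_prop
    exact h1.comp h2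
  have hd0 : ∀ n t, 0 ≤ clamp T t - d n t ∧ clamp T t - d n t ≤ (1 / 2) ^ n ∧ 0 ≤ d n t := by
    intro n t
    have hp : (0 : ℝ) < 2 ^ n := by positivity
    have hc := (clamp_mem hT t).1
    have h1 := Nat.floor_le (a := 2 ^ n * clamp T t) (by positivity)
    have h2 := Nat.lt_floor_add_one (2 ^ n * clamp T t)
    have h3 : d n t * 2 ^ n = (⌊2 ^ n * clamp T t⌋₊ : ℝ) := by simp [hd]
    have h4 : ((1 : ℝ) / 2) ^ n * 2 ^ n = 1 := by rw [← mul_pow]; norm_num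
    refine ⟨?_, ?_, ?_⟩
    · nlinarith
    · nlinarith
    · simp only [hd]; positivity
  have hdmem : ∀ n t, d n t ∈ Icc 0 T := fun n t =>
    ⟨(hd0 n t).2.2, by linarith [(hd0 n t).1, (clamp_mem hT t).2]⟩
  have hL : 0 ≤ L * T := by
    have := hlip 0 ⟨le_rfl, hT⟩ T ⟨hT, le_rfl⟩
    simp only [zero_sub, abs_neg, abs_of_nonneg hT] at this
    exact le_trans (integral_nonneg fun x => abs_nonneg _) this
  have hconv : ∀ t ∈ Icc 0 T, ∀ᵐ x, Tendsto (fun n => W (d n t) x) atTop (𝓝 (w t x)) := by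
    intro t ht
    have hct : clamp T t = t := clamp_of_mem ht
    have hm : ∀ n, AEStronglyMeasurable (fun x => W (d n t) x - w t x) volume := fun n =>
      (hWm _).aestronglyMeasurable.sub (hint t ht).1
    have hb : ∀ n, ∫⁻ x, ‖W (d n t) x - w t x‖ₑ ≤ ENNReal.ofReal (|L| * (1 / 2) ^ n) := by
      intro n
      have h1 : ∫⁻ x, ‖W (d n t) x - w t x‖ₑ = ∫⁻ x, ‖w (d n t) x - w t x‖ₑ := by
        refine lintegral_congr_ae ?_
        filter_upwards [hWae _ (hdmem n t)] with x hx
        rw [hx]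
      have hi : Integrable (fun x => w (d n t) x - w t x) := (hint _ (hdmem n t)).sub (hint t ht)
      rw [h1, ← ofReal_integral_norm_eq_lintegral_enorm hi]
      apply ENNReal.ofReal_le_ofReal
      refine (hlip _ (hdmem n t) t ht).trans ?_
      have h2 : |d n t - t| ≤ (1 / 2) ^ n := by
        have := hd0 n t
        rw [hct] at this
        rw [abs_sub_comm, abs_of_nonneg this.1]; exact this.2.1
      calc L * |d n t - t| ≤ |L| * |d n t - t| := by gcongr; exact le_abs_self L
        _ ≤ _ := by gcongr
    -- The mesh 2⁻ⁿ is summable, so the `L¹`-Lipschitz bound upgrades to almost everywhere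
    -- convergence of the whole sequence, at every single time.
    have hsum : ∫⁻ x, ∑' n, ‖W (d n t) x - w t x‖ₑ ≠ ∞ := by
      rw [lintegral_tsum fun n => (hm n).enorm]
      refine ((ENNReal.tsum_le_tsum hb).trans_lt ?_).ne
      rw [← ENNReal.ofReal_tsum_of_nonneg (fun n => by positivity)
        ((summable_geometric_of_lt_one (by norm_num) (by norm_num)).mul_left _)]
      exact ENNReal.ofReal_lt_top
    have hae := ae_lt_top' (AEMeasurable.tsum fun n => (hm n).enorm) hsum
    filter_upwards [hae] with x hx
    have h0 := ENNReal.tendsto_atTop_zero_of_tsum_ne_top hx.ne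
    rw [← tendsto_sub_nhds_zero_iff]
    rw [tendsto_zero_iff_enorm_tendsto_zero]
    exact h0
  -- Truncation puts the values in [0, 1] even where the limit fails to exist, and changes nothing
  -- almost everywhere for times in [0, T].
  refine ⟨fun t x => max 0 (min (limUnder atTop fun n => W (d n t) x) 1), ?_, ?_, ?_, ?_⟩
  · have : Measurable (fun p : ℝ × ℝ => limUnder atTop fun n => W (d n p.1) p.2) :=
      (StronglyMeasurable.limUnder fun n => (hdm n).stronglyMeasurable).measurable
    fun_prop
  · intro t x
    exact ⟨le_max_left _ _, max_le zero_le_one (min_le_right _ _)⟩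
  · intro t
    funext x
    simp only [hd, clamp_clamp hT]
  · intro t ht
    filter_upwards [hconv t ht, hrange t ht] with x h1 h2
    rw [h1.limUnder_eq, min_eq_left h2.2, max_eq_right h2.1]

end Multilane

/-! ### Time-differential inequalities and mollifiers -/

namespace Multilane

open Filter Topology

theorem intervalIntegrable_of_bounded {q : ℝ → ℝ} {B : ℝ} (hq : Measurable q)
    (hB : ∀ t, |q t| ≤ B) (a b : ℝ) : IntervalIntegrable q volume a b :=
  (intervalIntegrable_const (c := B)).mono_fun hq.aestronglyMeasurable
    (Eventually.of_forall fun t => by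
      simpa using (hB t).trans (le_abs_self B))

/-- Approximate unit step at `c`: testing against it evaluates `p` at `c` and integrates `q` after
`c`, up to an error of order `ε`. -/
theorem abs_step_test_sub_le {p q : ℝ → ℝ} {K : ℝ≥0} {B T c ε : ℝ} (hp : LipschitzWith K p)
    (hq : Measurable q) (hB : ∀ t, |q t| ≤ B) (hc : 0 < c) (hε : 0 < ε) (hcT : c + ε < T) :
    |(∫ t in (0 : ℝ)..T, (p t * deriv (fun t => Real.smoothTransition ((t - c) / ε)) t
        + q t * Real.smoothTransition ((t - c) / ε))) - (p c + ∫ t in c..T, q t)|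
      ≤ (K + B) * ε := by
  set g : ℝ → ℝ := fun t => Real.smoothTransition ((t - c) / ε) with hg
  have hgC : ContDiff ℝ 1 g :=
    (Real.smoothTransition.contDiff (n := 1)).comp ((contDiff_id.sub contDiff_const).div_const ε)
  have hg' : Continuous (deriv g) := hgC.continuous_deriv le_rfl
  have hgm : Monotone g := fun s t hst =>
    Real.smoothTransition.monotone (div_le_div_of_nonneg_right (by linarith) hε.le)
  have hg0 : ∀ t, t ≤ c → g t = 0 := fun t ht =>
    Real.smoothTransition.zero_of_nonpos (div_nonpos_of_nonpos_of_nonneg (by linarith) hε.le)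
  have hg1 : ∀ t, c + ε ≤ t → g t = 1 := fun t ht =>
    Real.smoothTransition.one_of_one_le ((one_le_div hε).2 (by linarith))
  have hd0 : ∀ t, 0 ≤ deriv g t := fun t => hgm.deriv_nonneg
  have hdlt : ∀ t, t < c → deriv g t = 0 := fun t ht => by
    have : g =ᶠ[𝓝 t] fun _ => 0 := by
      filter_upwards [Iio_mem_nhds ht] with s hs using hg0 s (le_of_lt hs)
    rw [this.deriv_eq]; simp
  have hdgt : ∀ t, c + ε < t → deriv g t = 0 := fun t ht => by
    have : g =ᶠ[𝓝 t] fun _ => 1 := by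
      filter_upwards [Ioi_mem_nhds ht] with s hs using hg1 s (le_of_lt hs)
    rw [this.deriv_eq]; simp
  have hB0 : 0 ≤ B := (abs_nonneg _).trans (hB 0)
  have hpc := hp.continuous
  have hT : 0 < T := by linarith
  have hint1 : ∫ t in (0 : ℝ)..T, deriv g t = 1 := by
    rw [intervalIntegral.integral_deriv_eq_sub (fun x _ => hgC.differentiable one_ne_zero x)
      (hg'.intervalIntegrable _ _), hg0 0 hc.le, hg1 T hcT.le, sub_zero]
  have hI1 : IntervalIntegrable (fun t => p t * deriv g t) volume 0 T :=
    (hpc.mul hg').intervalIntegrable _ _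
  have hqg : ∀ a b, IntervalIntegrable (fun t => q t * g t) volume a b := fun a b =>
    (intervalIntegrable_of_bounded hq hB a b).mul_continuousOn hgC.continuous.continuousOn
  have hqi := intervalIntegrable_of_bounded hq hB
  -- The derivative of the step is a probability density carried by [c, c + ε], on which `p` moves
  -- by at most Kε.
  have hP : |(∫ t in (0 : ℝ)..T, p t * deriv g t) - p c| ≤ K * ε := by
    have e : (∫ t in (0 : ℝ)..T, p t * deriv g t) - p c
        = ∫ t in (0 : ℝ)..T, (p t - p c) * deriv g t := by
      simp_rw [sub_mul]
      rw [intervalIntegral.integral_sub hI1 ((hg'.const_mul _ |>.intervalIntegrable _ _)),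
        intervalIntegral.integral_const_mul, hint1, mul_one]
    rw [e]
    have := intervalIntegral.abs_integral_le_integral_abs (μ := volume)
      (f := fun t => (p t - p c) * deriv g t) hT.le
    refine this.trans ?_
    have h2 : ∫ t in (0 : ℝ)..T, |(p t - p c) * deriv g t|
        ≤ ∫ t in (0 : ℝ)..T, (K * ε) * deriv g t := by
      refine intervalIntegral.integral_mono_on hT.le ?_ ?_ fun t _ => ?_
      · exact (Continuous.intervalIntegrable (by fun_prop) _ _)
      · exact (Continuous.intervalIntegrable (by fun_prop) _ _)
      · rw [abs_mul, abs_of_nonneg (hd0 t)]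
        rcases lt_or_ge t c with h | h
        · simp [hdlt t h]
        rcases lt_or_ge (c + ε) t with h' | h'
        · simp [hdgt t h']
        refine mul_le_mul_of_nonneg_right ?_ (hd0 t)
        have := hp.dist_le_mul t c
        rw [Real.dist_eq, Real.dist_eq] at this
        refine this.trans ?_
        gcongr
        rw [abs_of_nonneg (by linarith)]; linarith
    rw [intervalIntegral.integral_const_mul, hint1, mul_one] at h2
    exact h2
  -- The smooth step differs from the sharp one only on [c, c + ε].
  have hQ : |(∫ t in (0 : ℝ)..T, q t * g t) - ∫ t in c..T, q t| ≤ B * ε := by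
    rw [← intervalIntegral.integral_add_adjacent_intervals (hqg 0 c) (hqg c T),
      ← intervalIntegral.integral_add_adjacent_intervals (hqg c (c + ε)) (hqg (c + ε) T),
      ← intervalIntegral.integral_add_adjacent_intervals (hqi c (c + ε)) (hqi (c + ε) T)]
    have e1 : ∫ t in (0 : ℝ)..c, q t * g t = 0 := by
      rw [intervalIntegral.integral_congr (g := fun _ => (0 : ℝ))]
      · simp
      · intro t ht
        rw [uIcc_of_le hc.le] at ht
        simp [hg0 t ht.2]
    have e2 : ∫ t in (c + ε)..T, q t * g t = ∫ t in (c + ε)..T, q t := by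
      refine intervalIntegral.integral_congr fun t ht => ?_
      rw [uIcc_of_le hcT.le] at ht
      simp [hg1 t ht.1]
    rw [e1, e2]
    have e3 : 0 + ((∫ t in c..c + ε, q t * g t) + ∫ t in (c + ε)..T, q t)
        - ((∫ t in c..c + ε, q t) + ∫ t in (c + ε)..T, q t)
        = ∫ t in c..c + ε, (q t * g t - q t) := by
      rw [intervalIntegral.integral_sub (hqg _ _) (hqi _ _)]; ring
    rw [e3]
    have := intervalIntegral.norm_integral_le_of_norm_le_const (a := c) (b := c + ε) (C := B)
      (f := fun t => q t * g t - q t) fun t _ => by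
        rw [Real.norm_eq_abs, show q t * g t - q t = -(q t * (1 - g t)) by ring, abs_neg, abs_mul]
        have h0 : 0 ≤ g t := Real.smoothTransition.nonneg _
        have h1 : g t ≤ 1 := Real.smoothTransition.le_one _
        have : |1 - g t| ≤ 1 := by rw [abs_of_nonneg] <;> linarith
        nlinarith [hB t, abs_nonneg (q t)]
    simpa [abs_of_pos hε] using this
  rw [intervalIntegral.integral_add hI1 (hqg _ _)]
  have := abs_add_le ((∫ t in (0 : ℝ)..T, p t * deriv g t) - p c)
    ((∫ t in (0 : ℝ)..T, q t * g t) - ∫ t in c..T, q t)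
  rw [show ∀ a b x y : ℝ, a + b - (x + y) = (a - x) + (b - y) by intros; ring, add_mul]
  linarith

/-- A differential inequality `p' ≤ q` in the sense of distributions, integrated in time. -/
theorem sub_le_integral_of_distributional {p q : ℝ → ℝ} {K : ℝ≥0} {B T : ℝ}
    (hp : LipschitzWith K p) (hq : Measurable q) (hB : ∀ t, |q t| ≤ B)
    (h : ∀ χ : ℝ → ℝ, ContDiff ℝ (⊤ : ℕ∞) χ → (∀ t, 0 ≤ χ t) → HasCompactSupport χ →
      tsupport χ ⊆ Ioo 0 T → 0 ≤ ∫ t in (0 : ℝ)..T, (p t * deriv χ t + q t * χ t))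
    {t₁ t₂ : ℝ} (h1 : 0 < t₁) (h12 : t₁ ≤ t₂) (h2 : t₂ < T) :
    p t₂ - p t₁ ≤ ∫ t in t₁..t₂, q t := by
  have hqi := intervalIntegrable_of_bounded hq hB
  have hB0 : 0 ≤ B := (abs_nonneg _).trans (hB 0)
  have key : ∀ ε : ℝ, 0 < ε → t₂ + ε < T →
      p t₂ - p t₁ ≤ (∫ t in t₁..t₂, q t) + 2 * (K + B) * ε := by
    intro ε hε hεT
    have s1 := abs_step_test_sub_le (c := t₁) (T := T) hp hq hB h1 hε (by linarith)
    have s2 := abs_step_test_sub_le (c := t₂) hp hq hB (by linarith) hε hεT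
    set g₁ : ℝ → ℝ := fun t => Real.smoothTransition ((t - t₁) / ε) with hg₁
    set g₂ : ℝ → ℝ := fun t => Real.smoothTransition ((t - t₂) / ε) with hg₂
    have hC : ∀ c : ℝ, ContDiff ℝ (⊤ : ℕ∞) (fun t : ℝ => Real.smoothTransition ((t - c) / ε)) :=
      fun c => (Real.smoothTransition.contDiff (n := ⊤)).comp
        ((contDiff_id.sub contDiff_const).div_const ε)
    have hC1 : ContDiff ℝ (⊤ : ℕ∞) g₁ := hC t₁
    have hC2 : ContDiff ℝ (⊤ : ℕ∞) g₂ := hC t₂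
    have hne : ((⊤ : ℕ∞) : WithTop ℕ∞) ≠ 0 := by simp
    have hsupp : tsupport (fun t => g₁ t - g₂ t) ⊆ Icc t₁ (t₂ + ε) := by
      refine closure_minimal (fun t ht => ?_) isClosed_Icc
      by_contra hn
      apply ht
      rw [mem_Icc, not_and_or, not_le, not_le] at hn
      show g₁ t - g₂ t = 0
      rcases hn with hn | hn
      · have e1 : g₁ t = 0 := Real.smoothTransition.zero_of_nonpos
          (div_nonpos_of_nonpos_of_nonneg (by linarith) hε.le)
        have e2 : g₂ t = 0 := Real.smoothTransition.zero_of_nonpos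
          (div_nonpos_of_nonpos_of_nonneg (by linarith) hε.le)
        rw [e1, e2, sub_zero]
      · have e1 : g₁ t = 1 := Real.smoothTransition.one_of_one_le
          ((one_le_div hε).2 (by linarith))
        have e2 : g₂ t = 1 := Real.smoothTransition.one_of_one_le
          ((one_le_div hε).2 (by linarith))
        rw [e1, e2, sub_self]
    -- The difference of two shifted steps is a smooth substitute for the indicator of [t₁, t₂]; it
    -- is nonnegative since the step is monotone, and its support stays in (0, T) because t₂ + ε <
    -- T.
    have h0 := h (fun t => g₁ t - g₂ t) (hC1.sub hC2)
      (fun t => sub_nonneg.2 (Real.smoothTransition.monotone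
        (div_le_div_of_nonneg_right (by linarith) hε.le)))
      (isCompact_Icc.of_isClosed_subset (isClosed_tsupport _) hsupp)
      (hsupp.trans fun t ht => ⟨by linarith [ht.1], by linarith [ht.2]⟩)
    have hI : ∀ g : ℝ → ℝ, ContDiff ℝ (⊤ : ℕ∞) g →
        IntervalIntegrable (fun t => p t * deriv g t + q t * g t) volume 0 T := fun g hg =>
      ((hp.continuous.mul (hg.continuous_deriv (by simp))).intervalIntegrable _ _).add
        ((hqi 0 T).mul_continuousOn hg.continuous.continuousOn)
    have e : ∫ t in (0 : ℝ)..T, (p t * deriv (fun t => g₁ t - g₂ t) t + q t * (g₁ t - g₂ t))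
        = (∫ t in (0 : ℝ)..T, (p t * deriv g₁ t + q t * g₁ t))
          - ∫ t in (0 : ℝ)..T, (p t * deriv g₂ t + q t * g₂ t) := by
      rw [← intervalIntegral.integral_sub (hI g₁ hC1) (hI g₂ hC2)]
      refine intervalIntegral.integral_congr fun t _ => ?_
      rw [deriv_fun_sub (hC1.differentiable hne t) (hC2.differentiable hne t)]
      ring
    rw [e] at h0
    have e2 := intervalIntegral.integral_add_adjacent_intervals (hqi t₁ t₂) (hqi t₂ T)
    have a1 := abs_le.1 s1
    have a2 := abs_le.1 s2
    linarith [a1.1, a1.2, a2.1, a2.2]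
  have hlim : Tendsto (fun ε : ℝ => (∫ t in t₁..t₂, q t) + 2 * (K + B) * ε) (𝓝[>] 0)
      (𝓝 ((∫ t in t₁..t₂, q t) + 2 * (K + B) * 0)) :=
    (Continuous.tendsto (by fun_prop) 0).mono_left nhdsWithin_le_nhds
  rw [mul_zero, add_zero] at hlim
  refine ge_of_tendsto hlim ?_
  filter_upwards [Ioo_mem_nhdsGT (show (0 : ℝ) < T - t₂ by linarith)] with ε hε
  exact key ε hε.1 (by linarith [hε.2])

/-- A Lipschitz function whose increments are bounded by the integral of `A` has derivative at
most `A` almost everywhere. -/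
theorem ae_deriv_le_of_sub_le_integral {F A : ℝ → ℝ} {T C : ℝ} (hA : Measurable A)
    (hAC : ∀ t, |A t| ≤ C)
    (h : ∀ t₁ t₂, 0 < t₁ → t₁ ≤ t₂ → t₂ < T → F t₂ - F t₁ ≤ ∫ τ in t₁..t₂, A τ) :
    ∀ᵐ t, t ∈ Ioo 0 T → DifferentiableAt ℝ F t → deriv F t ≤ A t := by
  have hAi := intervalIntegrable_of_bounded hA hAC
  have hloc : LocallyIntegrable A volume := by
    refine (locallyIntegrable_const C).mono hA.aestronglyMeasurable
      (Eventually.of_forall fun t => ?_)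
    simpa using (hAC t).trans (le_abs_self C)
  filter_upwards [LocallyIntegrable.ae_hasDerivAt_integral hloc] with t ht htT hd
  have hD := (ht 0).sub hd.hasDerivAt
  -- The hypothesis says exactly that this difference is monotone, and at a Lebesgue point of `A`
  -- its derivative is `A t - deriv F t`.
  have hm : MonotoneOn (fun x => (∫ τ in (0 : ℝ)..x, A τ) - F x) (Ioo 0 T) := by
    intro a ha b hb hab
    have := h a b ha.1 hab hb.2
    have e := intervalIntegral.integral_add_adjacent_intervals (hAi 0 a) (hAi a b)
    simp only
    linarith
  have h0 := hm.derivWithin_nonneg (x := t)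
  rw [derivWithin_of_isOpen isOpen_Ioo htT] at h0
  have h1 : deriv (fun x => (∫ τ in (0 : ℝ)..x, A τ) - F x) t = A t - deriv F t := hD.deriv
  rw [h1] at h0
  linarith

/-- One-sided bounds for the increments of `F` in each of its two variables bound its increments
along the diagonal. -/
theorem diagonal_sub_le_integral {F A B E : ℝ → ℝ → ℝ} {K : ℝ≥0} {T C : ℝ}
    (hF : LipschitzWith K (fun p : ℝ × ℝ => F p.1 p.2))
    (hA : Measurable (fun p : ℝ × ℝ => A p.1 p.2)) (hB : Measurable (fun p : ℝ × ℝ => B p.1 p.2))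
    (hAC : ∀ t s, |A t s| ≤ C) (hBC : ∀ t s, |B t s| ≤ C)
    (hFA : ∀ s ∈ Ioo 0 T, ∀ t₁ t₂, 0 < t₁ → t₁ ≤ t₂ → t₂ < T →
      F t₂ s - F t₁ s ≤ ∫ τ in t₁..t₂, A τ s)
    (hFB : ∀ t ∈ Ioo 0 T, ∀ s₁ s₂, 0 < s₁ → s₁ ≤ s₂ → s₂ < T →
      F t s₂ - F t s₁ ≤ ∫ τ in s₁..s₂, B t τ)
    (hE : Continuous (fun p : ℝ × ℝ => E p.1 p.2))
    (hABE : ∀ t s, A t s + B t s ≤ E t s) {a b : ℝ} (ha : 0 < a) (hab : a ≤ b) (hb : b < T) :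
    F b b - F a a ≤ ∫ t in a..b, E t t := by
  have hFc := hF.continuous
  -- Rademacher's theorem in the plane. Joint differentiability is what makes the diagonal
  -- derivative the sum of the two partial ones.
  have hdiff : ∀ᵐ p : ℝ × ℝ, DifferentiableAt ℝ (fun p : ℝ × ℝ => F p.1 p.2) p :=
    hF.ae_differentiableAt
  have m1 : Measurable (fun p : ℝ × ℝ => deriv (fun τ => F τ p.2) p.1) := by
    have := measurable_deriv_with_param (f := fun s t => F t s)
      (hFc.comp (continuous_snd.prodMk continuous_fst))
    exact this.comp measurable_swap
  have m2 : Measurable (fun p : ℝ × ℝ => deriv (fun τ => F p.1 τ) p.2) :=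
    measurable_deriv_with_param (f := F) hFc
  have mI1 : MeasurableSet {p : ℝ × ℝ | p.1 ∈ Ioo 0 T} := measurable_fst measurableSet_Ioo
  have mI2 : MeasurableSet {p : ℝ × ℝ | p.2 ∈ Ioo 0 T} := measurable_snd measurableSet_Ioo
  have mD : MeasurableSet {p : ℝ × ℝ | DifferentiableAt ℝ (fun p : ℝ × ℝ => F p.1 p.2) p} :=
    measurableSet_of_differentiableAt ℝ _
  have pd1 : ∀ p : ℝ × ℝ, DifferentiableAt ℝ (fun p : ℝ × ℝ => F p.1 p.2) p →
      DifferentiableAt ℝ (fun τ => F τ p.2) p.1 := fun p hp =>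
    DifferentiableAt.comp (f := fun τ : ℝ => (τ, p.2)) p.1 hp (by fun_prop)
  have pd2 : ∀ p : ℝ × ℝ, DifferentiableAt ℝ (fun p : ℝ × ℝ => F p.1 p.2) p →
      DifferentiableAt ℝ (fun τ => F p.1 τ) p.2 := fun p hp =>
    DifferentiableAt.comp (f := fun τ : ℝ => (p.1, τ)) p.2 hp (by fun_prop)
  -- On each vertical line the bound holds almost everywhere; Fubini's theorem lifts it to the plane
  -- because the exceptional set is measurable.
  have a2 : ∀ᵐ p : ℝ × ℝ, p.1 ∈ Ioo 0 T → p.2 ∈ Ioo 0 T →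
      DifferentiableAt ℝ (fun p : ℝ × ℝ => F p.1 p.2) p →
      deriv (fun τ => F p.1 τ) p.2 ≤ B p.1 p.2 := by
    rw [Measure.volume_eq_prod]
    refine (Measure.ae_prod_iff_ae_ae ?_).2 ?_
    · exact mI1.imp (mI2.imp (mD.imp (measurableSet_le m2 hB)))
    · refine Eventually.of_forall fun t => ?_
      by_cases ht : t ∈ Ioo 0 T
      · filter_upwards [ae_deriv_le_of_sub_le_integral (hB.comp measurable_prodMk_left) (hBC t)
          (hFB t ht)] with s hs _ h2 h3
        exact hs h2 (pd2 (t, s) h3)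
      · exact Eventually.of_forall fun s h => absurd h ht
  have a1 : ∀ᵐ p : ℝ × ℝ, p.1 ∈ Ioo 0 T → p.2 ∈ Ioo 0 T →
      DifferentiableAt ℝ (fun p : ℝ × ℝ => F p.1 p.2) p →
      deriv (fun τ => F τ p.2) p.1 ≤ A p.1 p.2 := by
    have hs : ∀ᵐ p : ℝ × ℝ, p.2 ∈ Ioo 0 T → p.1 ∈ Ioo 0 T →
        DifferentiableAt ℝ (fun p : ℝ × ℝ => F p.1 p.2) p.swap →
        deriv (fun τ => F τ p.1) p.2 ≤ A p.2 p.1 := by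
      rw [Measure.volume_eq_prod]
      refine (Measure.ae_prod_iff_ae_ae ?_).2 ?_
      · exact mI2.imp (mI1.imp ((measurable_swap mD).imp
          (measurableSet_le (m1.comp measurable_swap) (hA.comp measurable_swap))))
      · refine Eventually.of_forall fun s => ?_
        by_cases hs : s ∈ Ioo 0 T
        · filter_upwards [ae_deriv_le_of_sub_le_integral (hA.comp measurable_prodMk_right)
            (fun t => hAC t s) (hFA s hs)] with t ht h2 _ h3
          exact ht h2 (pd1 (t, s) h3)
        · exact Eventually.of_forall fun t _ h => absurd h hs
    have := (Measure.measurePreserving_swap (μ := (volume : Measure ℝ))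
      (ν := (volume : Measure ℝ))).quasiMeasurePreserving.ae hs
    exact this
  have a3 : ∀ᵐ p : ℝ × ℝ, p.1 ∈ Ioo 0 T → p.2 ∈ Ioo 0 T →
      ∃ d ≤ E p.1 p.2, HasDerivAt (fun r => F (p.1 + r) (p.2 + r)) d 0 := by
    filter_upwards [hdiff, a1, a2] with p h0 h1 h2 hp1 hp2
    refine ⟨_, ?_, (HasFDerivAt.comp_hasDerivAt_of_eq (x := (0 : ℝ))
      (f := fun r : ℝ => (p.1 + r, p.2 + r)) (f' := ((1 : ℝ), (1 : ℝ))) h0.hasFDerivAt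
      (((hasDerivAt_id (0 : ℝ)).const_add p.1).prodMk ((hasDerivAt_id (0 : ℝ)).const_add p.2))
      (by simp))⟩
    have e1 : deriv (fun τ => F τ p.2) p.1
        = fderiv ℝ (fun p : ℝ × ℝ => F p.1 p.2) p (1, 0) :=
      (HasFDerivAt.comp_hasDerivAt_of_eq (x := p.1) (f := fun τ : ℝ => (τ, p.2)) (f' := ((1 : ℝ), (0 : ℝ)))
        h0.hasFDerivAt ((hasDerivAt_id p.1).prodMk (hasDerivAt_const p.1 p.2)) rfl).deriv
    have e2 : deriv (fun τ => F p.1 τ) p.2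
        = fderiv ℝ (fun p : ℝ × ℝ => F p.1 p.2) p (0, 1) :=
      (HasFDerivAt.comp_hasDerivAt_of_eq (x := p.2) (f := fun τ : ℝ => (p.1, τ)) (f' := ((0 : ℝ), (1 : ℝ)))
        h0.hasFDerivAt ((hasDerivAt_const p.2 p.1).prodMk (hasDerivAt_id p.2)) rfl).deriv
    have e3 : ((1 : ℝ), (1 : ℝ)) = (1, 0) + (0, 1) := by simp
    rw [e3, map_add, ← e1, ← e2]
    exact (add_le_add (h1 hp1 hp2 h0) (h2 hp1 hp2 h0)).trans (hABE _ _)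
  -- A measure-preserving shear turns a null set of the plane into null sets on almost all lines s =
  -- t + c. The diagonal itself may be exceptional, hence the detour through c ≠ 0.
  have a4 : ∀ᵐ c : ℝ, ∀ᵐ t : ℝ, t ∈ Ioo 0 T → t + c ∈ Ioo 0 T →
      ∃ d ≤ E t (t + c), HasDerivAt (fun r => F (t + r) (t + c + r)) d 0 := by
    have h1 := (measurePreserving_add_prod (volume : Measure ℝ)
      (volume : Measure ℝ)).quasiMeasurePreserving.ae (Measure.volume_eq_prod ℝ ℝ ▸
        ((Measure.measurePreserving_swap (μ := (volume : Measure ℝ))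
      (ν := (volume : Measure ℝ))).quasiMeasurePreserving.ae a3))
    filter_upwards [Measure.ae_ae_of_ae_prod h1] with c hc
    filter_upwards [hc] with t ht
    simpa [add_comm c t] using ht
  set c₀ := min a (T - b) with hc₀
  have hc₀p : 0 < c₀ := lt_min ha (by linarith)
  have hstep : ∀ᵐ c : ℝ, |c| < c₀ → F b (b + c) - F a (a + c) ≤ ∫ t in a..b, E t (t + c) := by
    filter_upwards [a4] with c hc hcc
    have hc1 : |c| < a := hcc.trans_le (min_le_left _ _)
    have hc2 : |c| < T - b := hcc.trans_le (min_le_right _ _)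
    rw [abs_lt] at hc1 hc2
    have hL : LipschitzWith (K * 1) (fun t => F t (t + c)) := by
      refine hF.comp (g := fun t : ℝ => (t, t + c)) (LipschitzWith.of_dist_le_mul fun x y => ?_)
      simp [Prod.dist_eq]
    have hac := (hL.lipschitzOnWith (s := uIcc a b)).absolutelyContinuousOnInterval
    rw [← hac.integral_deriv_eq_sub]
    have hEi : IntervalIntegrable (fun t => E t (t + c)) volume a b :=
      (hE.comp (by fun_prop : Continuous fun t : ℝ => (t, t + c))).intervalIntegrable _ _
    refine intervalIntegral.integral_mono_ae_restrict hab hac.intervalIntegrable_deriv hEi ?_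
    refine (ae_restrict_iff' measurableSet_Icc).2 ?_
    filter_upwards [hc] with t ht hmem
    obtain ⟨d, hd, hder⟩ := ht ⟨by linarith [hmem.1], by linarith [hmem.2]⟩
      ⟨by linarith [hmem.1], by linarith [hmem.2]⟩
    have : HasDerivAt (fun t => F t (t + c)) d t := by
      have h1 : HasDerivAt (fun r => F (t + r) (t + c + r)) d (t - t) := by rwa [sub_self]
      have h2 := h1.comp_sub_const t t
      refine h2.congr_of_eventuallyEq (Eventually.of_forall fun r => ?_)
      simp only
      congr 1 <;> ring
    rw [this.deriv]
    exact hd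
  -- A conull set of shifts is dense and both sides are continuous in the shift, so the inequality
  -- passes to c = 0.
  have hdense : Dense {c : ℝ | |c| < c₀ → F b (b + c) - F a (a + c) ≤ ∫ t in a..b, E t (t + c)} :=
    Measure.dense_of_ae hstep
  have hcl : (0 : ℝ) ∈ closure (Metric.ball 0 c₀ ∩
      {c : ℝ | |c| < c₀ → F b (b + c) - F a (a + c) ≤ ∫ t in a..b, E t (t + c)}) :=
    hdense.open_subset_closure_inter Metric.isOpen_ball (Metric.mem_ball_self hc₀p)
  have hf1 : Continuous fun c : ℝ => F b (b + c) - F a (a + c) :=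
    (hFc.comp (by fun_prop : Continuous fun c : ℝ => (b, b + c))).sub
      (hFc.comp (by fun_prop : Continuous fun c : ℝ => (a, a + c)))
  have hf2 : Continuous fun c : ℝ => ∫ t in a..b, E t (t + c) :=
    intervalIntegral.continuous_parametric_intervalIntegral_of_continuous'
      (f := fun c t => E t (t + c))
      (hE.comp (by fun_prop : Continuous fun q : ℝ × ℝ => (q.2, q.2 + q.1))) a b
  have := le_on_closure (f := fun c : ℝ => F b (b + c) - F a (a + c))
    (g := fun c : ℝ => ∫ t in a..b, E t (t + c)) (fun c hc => hc.2 (by simpa using hc.1))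
    hf1.continuousOn hf2.continuousOn hcl
  simpa using this

/-- Grönwall's inequality in integral form. -/
theorem le_exp_mul_of_le_add_integral {n : ℝ → ℝ} {C a b : ℝ} (hn : Continuous n) (hC : 0 ≤ C)
    (hab : a ≤ b) (h : ∀ t ∈ Icc a b, n t ≤ n a + C * ∫ τ in a..t, n τ) :
    n b ≤ Real.exp (C * (b - a)) * n a := by
  set g : ℝ → ℝ := fun t => Real.exp (-(C * (t - a))) * (n a + C * ∫ τ in a..t, n τ) with hg
  have hint : ∀ t, HasDerivAt (fun t => ∫ τ in a..t, n τ) (n t) t := fun t =>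
    intervalIntegral.integral_hasDerivAt_right (hn.intervalIntegrable _ _)
      (hn.stronglyMeasurableAtFilter _ _) hn.continuousAt
  have hgd : ∀ t, HasDerivAt g (Real.exp (-(C * (t - a))) * C
      * (n t - (n a + C * ∫ τ in a..t, n τ))) t := by
    intro t
    have h1 : HasDerivAt (fun t => Real.exp (-(C * (t - a))))
        (Real.exp (-(C * (t - a))) * (-(C * 1))) t :=
      ((((hasDerivAt_id t).sub_const a).const_mul C).neg).exp
    refine (h1.mul (((hint t).const_mul C).const_add (n a))).congr_deriv ?_
    ring
  have hanti : AntitoneOn g (Icc a b) := by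
    refine antitoneOn_of_deriv_nonpos (convex_Icc a b)
      (fun t _ => (hgd t).continuousAt.continuousWithinAt)
      (fun t _ => (hgd t).differentiableAt.differentiableWithinAt) fun t ht => ?_
    rw [interior_Icc] at ht
    rw [(hgd t).deriv]
    have := h t ⟨ht.1.le, ht.2.le⟩
    exact mul_nonpos_of_nonneg_of_nonpos (by positivity) (by linarith)
  have h1 := hanti (left_mem_Icc.2 hab) (right_mem_Icc.2 hab) hab
  have h2 : g a = n a := by simp [hg]
  rw [h2] at h1
  have h3 := h b (right_mem_Icc.2 hab)
  have h4 : Real.exp (C * (b - a)) * g b = n a + C * ∫ τ in a..b, n τ := by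
    simp only [hg]
    rw [← mul_assoc, ← Real.exp_add, add_neg_cancel, Real.exp_zero, one_mul]
  calc n b ≤ Real.exp (C * (b - a)) * g b := by rw [h4]; exact h3
    _ ≤ _ := by gcongr

/-- Smooth mollifiers whose first absolute moment of the derivative is bounded independently of
the size of the support. -/
theorem exists_mollifier : ∃ c₁ : ℝ, 0 ≤ c₁ ∧ ∀ δ : ℝ, 0 < δ → ∃ ψ : ℝ → ℝ,
    ContDiff ℝ (⊤ : ℕ∞) ψ ∧ HasCompactSupport ψ ∧ (∀ z, 0 ≤ ψ z) ∧ (∫ z, ψ z = 1) ∧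
    (∀ z, |z| * ψ z ≤ δ * ψ z) ∧ ∫ z, |z| * |deriv ψ z| ≤ c₁ := by
  set b : ContDiffBump (0 : ℝ) := ⟨1 / 2, 1, by norm_num, by norm_num⟩ with hb
  set ρ : ℝ → ℝ := b.normed volume with hρ
  have hρC : ContDiff ℝ (⊤ : ℕ∞) ρ := b.contDiff_normed
  refine ⟨∫ z, |z| * |deriv ρ z|, integral_nonneg fun z => by positivity, fun δ hδ => ?_⟩
  have hδi : (0 : ℝ) < δ⁻¹ := inv_pos.2 hδ
  refine ⟨fun z => δ⁻¹ * ρ (δ⁻¹ * z), ?_, ?_, ?_, ?_, ?_, ?_⟩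
  · exact contDiff_const.mul (hρC.comp (contDiff_const.mul contDiff_id))
  · exact (b.hasCompactSupport_normed.comp_homeomorph
      (Homeomorph.mulLeft₀ δ⁻¹ hδi.ne')).mul_left
  · intro z
    exact mul_nonneg hδi.le (b.nonneg_normed _)
  · rw [integral_const_mul, Measure.integral_comp_mul_left ρ δ⁻¹, b.integral_normed]
    simp [abs_of_pos hδ, hδ.ne']
  · intro z
    by_cases hz : |z| ≤ δ
    · exact mul_le_mul_of_nonneg_right hz (mul_nonneg hδi.le (b.nonneg_normed _))
    · have : ρ (δ⁻¹ * z) = 0 := by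
        by_contra hne
        have hmem : δ⁻¹ * z ∈ Function.support ρ := hne
        rw [hρ, b.support_normed_eq, Metric.mem_ball, dist_zero_right, Real.norm_eq_abs, abs_mul,
          abs_of_pos hδi] at hmem
        have h1 : δ⁻¹ * |z| < 1 := hmem
        rw [inv_mul_lt_iff₀ hδ, mul_one] at h1
        exact hz h1.le
      simp [this]
  · have hd : ∀ z, deriv (fun z => δ⁻¹ * ρ (δ⁻¹ * z)) z = δ⁻¹ * (δ⁻¹ * deriv ρ (δ⁻¹ * z)) := by
      intro z
      have h1 : HasDerivAt ρ (deriv ρ (δ⁻¹ * z)) (δ⁻¹ * z) :=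
        (hρC.differentiable (by simp) _).hasDerivAt
      have h2 : HasDerivAt (fun z => δ⁻¹ * z) (δ⁻¹ * 1) z := (hasDerivAt_id z).const_mul _
      have h3 : HasDerivAt (fun z => δ⁻¹ * ρ (δ⁻¹ * z))
          (δ⁻¹ * (deriv ρ (δ⁻¹ * z) * (δ⁻¹ * 1))) z := (h1.comp z h2).const_mul δ⁻¹
      rw [h3.deriv]
      ring
    -- The moment is scale invariant: differentiation costs δ⁻¹, which the weight |z| returns. So
    -- `c₁` is the moment of the unscaled bump.
    have e : ∀ z, |z| * |deriv (fun z => δ⁻¹ * ρ (δ⁻¹ * z)) z|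
        = δ⁻¹ * (fun y => |y| * |deriv ρ y|) (δ⁻¹ * z) := by
      intro z
      rw [hd]
      simp only [abs_mul, abs_of_pos hδi]
      ring
    simp_rw [e]
    rw [integral_const_mul, Measure.integral_comp_mul_left (fun y => |y| * |deriv ρ y|) δ⁻¹]
    simp [abs_of_pos hδ, hδ.ne']

end Multilane

/-! ### The static part of the doubling argument -/

namespace Multilane

open Filter Topology

theorem abs_sign_le_one (r : ℝ) : |Real.sign r| ≤ 1 := by
  rcases Real.sign_apply_eq r with h | h | h <;> simp [h]

theorem measurable_sign : Measurable Real.sign := by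
  unfold Real.sign
  exact Measurable.ite measurableSet_Iio measurable_const
    (Measurable.ite measurableSet_Ioi measurable_const measurable_const)

theorem sign_sub_comm (a b : ℝ) : Real.sign (b - a) = -Real.sign (a - b) := by
  rw [← Real.sign_neg, neg_sub]

/-- The Kruzhkov entropy flux `sgn(a - b) (f a - f b)`. -/
def entropyFlux (f : ℝ → ℝ) (a b : ℝ) : ℝ := Real.sign (a - b) * (f a - f b)

theorem abs_entropyFlux_le {f : ℝ → ℝ} {M : ℝ}
    (hf : ∀ a ∈ Icc (0 : ℝ) 1, ∀ b ∈ Icc (0 : ℝ) 1, |f a - f b| ≤ M * |a - b|) {a b : ℝ}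
    (ha : a ∈ Icc (0 : ℝ) 1) (hb : b ∈ Icc (0 : ℝ) 1) : |entropyFlux f a b| ≤ M * |a - b| := by
  rw [entropyFlux, abs_mul]
  calc _ ≤ 1 * |f a - f b| := by gcongr; exact abs_sign_le_one _
    _ ≤ _ := by rw [one_mul]; exact hf a ha b hb

/-- If b and c lie on the same side of a, the signs agree and f(a) cancels. If they lie on opposite
sides, the two fluxes are bounded by M|a - b| and M|a - c|, and these distances add up to |b - c|.
-/
theorem abs_entropyFlux_sub_le {f : ℝ → ℝ} {M : ℝ}
    (hf : ∀ a ∈ Icc (0 : ℝ) 1, ∀ b ∈ Icc (0 : ℝ) 1, |f a - f b| ≤ M * |a - b|) {a b c : ℝ}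
    (ha : a ∈ Icc (0 : ℝ) 1) (hb : b ∈ Icc (0 : ℝ) 1) (hc : c ∈ Icc (0 : ℝ) 1) :
    |entropyFlux f a b - entropyFlux f a c| ≤ M * |b - c| := by
  have h1 := hf a ha b hb
  have h2 := hf a ha c hc
  have h3 := hf b hb c hc
  have h3' := h3
  rw [abs_le] at h1 h2 h3
  unfold entropyFlux
  rcases lt_trichotomy a b with hab | hab | hab <;> rcases lt_trichotomy a c with hac | hac | hac
  · rw [Real.sign_of_neg (by linarith), Real.sign_of_neg (by linarith)]
    rw [show -1 * (f a - f b) - -1 * (f a - f c) = f b - f c by ring]; exact h3'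
  · subst hac
    rw [Real.sign_of_neg (by linarith)]
    simp only [sub_self, Real.sign_zero, zero_mul, sub_zero, neg_mul, one_mul, neg_sub]; exact h3'
  · rw [Real.sign_of_neg (by linarith), Real.sign_of_pos (by linarith)]
    rw [abs_of_neg (by linarith : a - b < 0)] at h1
    rw [abs_of_pos (by linarith : 0 < a - c)] at h2
    rw [abs_of_pos (by linarith : 0 < b - c), abs_le]
    constructor <;> nlinarith [h1.1, h1.2, h2.1, h2.2]
  · subst hab
    rw [Real.sign_of_neg (by linarith : a - c < 0)]
    simpa using h3'
  · subst hab; subst hac; simp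
  · subst hab
    rw [Real.sign_of_pos (by linarith : 0 < a - c)]
    rw [abs_sub_comm (f a)] at h3'
    simpa using h3'
  · rw [Real.sign_of_pos (by linarith), Real.sign_of_neg (by linarith)]
    rw [abs_of_pos (by linarith : 0 < a - b)] at h1
    rw [abs_of_neg (by linarith : a - c < 0)] at h2
    rw [abs_of_neg (by linarith : b - c < 0), abs_le]
    constructor <;> nlinarith [h1.1, h1.2, h2.1, h2.2]
  · subst hac
    rw [Real.sign_of_pos (by linarith)]
    simp only [sub_self, Real.sign_zero, zero_mul, sub_zero, one_mul]
    rwa [abs_sub_comm]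
  · rw [Real.sign_of_pos (by linarith), Real.sign_of_pos (by linarith)]
    rw [show 1 * (f a - f b) - 1 * (f a - f c) = -(f b - f c) by ring, abs_neg]; exact h3'

/-- The integrand of the entropy inequality for a test function with value `ψ` and slope `dψ`:
`a` is the value of the solution, `b` the Kruzhkov constant, `U` and `D` are the velocity and its
spatial derivative, `R` is the source. -/
def entropyDensity (f : ℝ → ℝ) (a b U D R dψ ψ : ℝ) : ℝ :=
  entropyFlux f a b * U * dψ - Real.sign (a - b) * f b * D * ψ + Real.sign (a - b) * R * ψ

/-- Pointwise form of the sum of the two entropy inequalities after doubling the variables. Here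
`a = u(x)`, `b = v(y)`, `c = v(x)`. -/
theorem entropyDensity_add_le {f : ℝ → ℝ} {M L κ : ℝ}
    (hf : ∀ a ∈ Icc (0 : ℝ) 1, ∀ b ∈ Icc (0 : ℝ) 1, |f a - f b| ≤ M * |a - b|) (hf0 : f 0 = 0)
    {a b c : ℝ} (ha : a ∈ Icc (0 : ℝ) 1) (hb : b ∈ Icc (0 : ℝ) 1) (hc : c ∈ Icc (0 : ℝ) 1)
    {Ux Vx Vy dUx dUy dVy Rux Rvx Rvy z dψ ψ : ℝ} (hψ : 0 ≤ ψ) (hH : |Ux - Vx| ≤ κ)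
    (hV : |Vx - Vy| ≤ L * |z|) (hdV : |dVy| ≤ L) :
    entropyDensity f a b Ux dUx Rux dψ ψ + entropyDensity f b a Vy dVy Rvy (-dψ) ψ
      ≤ entropyFlux f a c * (Ux - Vx) * dψ + M * κ * |dψ| * |b - c| + M * L * |z| * |dψ| * |a - b|
        + M * L * ψ * |a - b| + M * ψ * (|b| * |dVy - dUy|) + M * ψ * (|b| * |dUx - dUy|)
        + ψ * |Rux - Rvx| + ψ * |Rvx - Rvy| := by
  set σ := Real.sign (a - b) with hσ
  have hσ1 : |σ| ≤ 1 := abs_sign_le_one _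
  have hσ' : Real.sign (b - a) = -σ := sign_sub_comm a b
  have hmul : ∀ X Y : ℝ, |X| ≤ Y → σ * X ≤ Y := fun X Y h =>
    (le_abs_self _).trans (by rw [abs_mul]; exact (mul_le_of_le_one_left (abs_nonneg _) hσ1).trans h)
  have hfb : |f b| ≤ M * |b| := by simpa [hf0] using hf b hb 0 ⟨le_rfl, zero_le_one⟩
  have hGab : |entropyFlux f a b| ≤ M * |a - b| := abs_entropyFlux_le hf ha hb
  have hGs : entropyFlux f b a = entropyFlux f a b := by
    rw [entropyFlux, entropyFlux, hσ']; ring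
  -- The cost of freezing the flux at v(x) instead of v(y); it becomes small after integration by
  -- the translation modulus of v.
  have t1 : (entropyFlux f a b - entropyFlux f a c) * (Ux - Vx) * dψ ≤ M * κ * |dψ| * |b - c| := by
    refine (le_abs_self _).trans ?_
    rw [abs_mul, abs_mul]
    calc _ ≤ (M * |b - c|) * κ * |dψ| := by
          gcongr
          · exact (abs_nonneg _).trans (abs_entropyFlux_sub_le hf ha hb hc)
          · exact abs_entropyFlux_sub_le hf ha hb hc
      _ = _ := by ring
  have t2 : entropyFlux f a b * (Vx - Vy) * dψ ≤ M * L * |z| * |dψ| * |a - b| := by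
    refine (le_abs_self _).trans ?_
    rw [abs_mul, abs_mul]
    calc _ ≤ (M * |a - b|) * (L * |z|) * |dψ| := by
          gcongr
          exact (abs_nonneg _).trans hGab
      _ = _ := by ring
  have t3 : σ * ((f a - f b) * dVy * ψ) ≤ M * L * ψ * |a - b| := by
    apply hmul
    rw [abs_mul, abs_mul, abs_of_nonneg hψ]
    calc _ ≤ (M * |a - b|) * L * ψ := by
          gcongr
          · exact (abs_nonneg _).trans (hf a ha b hb)
          · exact hf a ha b hb
      _ = _ := by ring
  have t4 : σ * (f b * (dVy - dUy) * ψ) ≤ M * ψ * (|b| * |dVy - dUy|) := by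
    apply hmul
    rw [abs_mul, abs_mul, abs_of_nonneg hψ]
    calc _ ≤ (M * |b|) * |dVy - dUy| * ψ := by gcongr
      _ = _ := by ring
  have t5 : σ * (f b * (dUy - dUx) * ψ) ≤ M * ψ * (|b| * |dUx - dUy|) := by
    apply hmul
    rw [abs_mul, abs_mul, abs_of_nonneg hψ, abs_sub_comm dUy]
    calc _ ≤ (M * |b|) * |dUx - dUy| * ψ := by gcongr
      _ = _ := by ring
  have t6 : σ * ((Rux - Rvx) * ψ) ≤ ψ * |Rux - Rvx| := by
    apply hmul
    rw [abs_mul, abs_of_nonneg hψ, mul_comm]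
  have t7 : σ * ((Rvx - Rvy) * ψ) ≤ ψ * |Rvx - Rvy| := by
    apply hmul
    rw [abs_mul, abs_of_nonneg hψ, mul_comm]
  unfold entropyDensity
  rw [hGs, hσ', ← hσ]
  -- The first summand is deliberately not estimated. Its coefficient of `dψ` involves x only, so it
  -- disappears when the mollifier derivative is integrated.
  calc _ = entropyFlux f a c * (Ux - Vx) * dψ
        + (entropyFlux f a b - entropyFlux f a c) * (Ux - Vx) * dψ
        + entropyFlux f a b * (Vx - Vy) * dψ + σ * ((f a - f b) * dVy * ψ)
        + σ * (f b * (dVy - dUy) * ψ) + σ * (f b * (dUy - dUx) * ψ)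
        + σ * ((Rux - Rvx) * ψ) + σ * ((Rvx - Rvy) * ψ) := by ring
    _ ≤ _ := by linarith

/-- The product measure on the plane is invariant under `(x, z) ↦ (x, x - z)`. -/
theorem measurePreserving_fst_sub :
    MeasurePreserving (fun p : ℝ × ℝ => (p.1, p.1 - p.2)) volume volume := by
  have h1 : MeasurePreserving (Prod.map id Neg.neg : ℝ × ℝ → ℝ × ℝ) volume volume :=
    (MeasurePreserving.id (volume : Measure ℝ)).prod (Measure.measurePreserving_neg volume)
  have h2 := (measurePreserving_prod_add (volume : Measure ℝ) (volume : Measure ℝ)).comp h1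
  have e : (fun p : ℝ × ℝ => (p.1, p.1 - p.2))
      = (fun z : ℝ × ℝ => (z.1, z.1 + z.2)) ∘ (Prod.map id Neg.neg) := by
    funext p
    simp [sub_eq_add_neg]
  rw [e]
  exact h2

/-- With z = x - y held fixed, the mollifier is constant on each slice and the inner integral in x
is an `L¹` translation estimate. -/
theorem integral_prod_eq_integral_slices {Φ : ℝ → ℝ → ℝ}
    (hΦ : Integrable (fun p : ℝ × ℝ => Φ p.1 p.2)) :
    Integrable (fun z => ∫ x, Φ x (x - z)) ∧ (∀ᵐ z, Integrable fun x => Φ x (x - z)) ∧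
      ∫ p : ℝ × ℝ, Φ p.1 p.2 = ∫ z, ∫ x, Φ x (x - z) := by
  have h1 : Integrable (fun p : ℝ × ℝ => Φ p.1 (p.1 - p.2)) := by
    have := measurePreserving_fst_sub.integrable_comp_of_integrable hΦ
    exact this
  rw [Measure.volume_eq_prod] at h1 hΦ
  refine ⟨h1.integral_prod_right, h1.swap.prod_right_ae, ?_⟩
  rw [Measure.volume_eq_prod, integral_prod _ hΦ,
    integral_integral_swap (f := fun z x => Φ x (x - z)) h1.swap]
  refine integral_congr_ae (Eventually.of_forall fun x => ?_)
  exact (integral_sub_left_eq_self (fun y => Φ x y) volume x).symm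

/-- Carrying integrability and the numerical bound together lets long sums be estimated one term at
a time. -/
theorem integrable_add_and_integral_le {f g : ℝ → ℝ} {a b : ℝ} (hf : Integrable f)
    (hg : Integrable g) (ha : ∫ x, f x ≤ a) (hb : ∫ x, g x ≤ b) :
    Integrable (fun x => f x + g x) ∧ ∫ x, (f x + g x) ≤ a + b :=
  ⟨hf.add hg, (integral_add hf hg).le.trans (add_le_add ha hb)⟩

theorem integral_abs_sub_translate_le {u v : ℝ → ℝ} (hu : Integrable u) (hv : Integrable v)
    {V : ℝ} (hV : ∀ h, ∫ x, |v (x + h) - v x| ≤ V * |h|) (z : ℝ) :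
    ∫ x, |u x - v (x - z)| ≤ (∫ x, |u x - v x|) + V * |z| := by
  have h1 := hV (-z)
  rw [abs_neg] at h1
  have i1 : Integrable fun x => |u x - v x| := (hu.sub hv).abs
  have i2 : Integrable fun x => |v (x + -z) - v x| := ((hv.comp_add_right (-z)).sub hv).abs
  have i3 : Integrable fun x => |u x - v (x - z)| := (hu.sub (hv.comp_sub_right z)).abs
  calc _ ≤ ∫ x, (|u x - v x| + |v (x + -z) - v x|) := by
        refine integral_mono i3 (i1.add i2) fun x => ?_
        simp only [← sub_eq_add_neg]
        rw [abs_sub_comm (v (x - z)) (v x)]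
        exact abs_sub_le _ _ _
    _ ≤ _ := by rw [integral_add i1 i2]; linarith

theorem integral_deriv_eq_zero_of_hasCompactSupport {ψ : ℝ → ℝ} (hψ : ContDiff ℝ (⊤ : ℕ∞) ψ)
    (hc : HasCompactSupport ψ) : ∫ z, deriv ψ z = 0 := by
  have hd : ∀ x, HasDerivAt ψ (deriv ψ x) x := fun x =>
    (hψ.differentiable (by simp) x).hasDerivAt
  exact integral_eq_zero_of_hasDerivAt_of_integrable hd
    ((hψ.continuous_deriv (by simp)).integrable_of_hasCompactSupport hc.deriv)
    (hψ.continuous.integrable_of_hasCompactSupport hc)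

/-- Spatial Kruzhkov estimate: the doubled entropy densities of two profiles `u` and `v` are
controlled by their distance and by the distances of their velocities and sources, up to an error
of the order of the support of the mollifier. -/
theorem integral_entropyDensity_add_le {f u v U W dU dW Ru Rw ψ : ℝ → ℝ}
    {M L κ Λ K V r δ c₁ : ℝ} (hM : 0 ≤ M) (hL : 0 ≤ L) (hδ : 0 ≤ δ) (hV0 : 0 ≤ V) (hK : 0 ≤ K)
    (hfm : Measurable f)
    (hf : ∀ a ∈ Icc (0 : ℝ) 1, ∀ b ∈ Icc (0 : ℝ) 1, |f a - f b| ≤ M * |a - b|) (hf0 : f 0 = 0)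
    (hu1 : ∀ x, u x ∈ Icc (0 : ℝ) 1) (hu : Integrable u) (hum : Measurable u)
    (hv1 : ∀ x, v x ∈ Icc (0 : ℝ) 1) (hv : Integrable v) (hvm : Measurable v)
    (hvV : ∀ h, ∫ x, |v (x + h) - v x| ≤ V * |h|)
    (hUm : Measurable U) (hWm : Measurable W) (hdUm : Measurable dU) (hdWm : Measurable dW)
    (hκ : ∀ x, |U x - W x| ≤ κ) (hWL : ∀ x y, |W x - W y| ≤ L * |x - y|)
    (hdU : ∀ x, |dU x| ≤ L) (hdW : ∀ x, |dW x| ≤ L)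
    (hΛ : ∫ x, |v x| * |dW x - dU x| ≤ Λ)
    (hdUt : ∀ z, ∫ x, |v x| * |dU (x + z) - dU x| ≤ K * |z|)
    (hRu : Integrable Ru) (hRw : Integrable Rw) (hr : ∫ x, |Ru x - Rw x| ≤ r)
    (hRt : ∀ z, ∫ x, |Rw (x + z) - Rw x| ≤ K * |z|)
    (hψ : ContDiff ℝ (⊤ : ℕ∞) ψ) (hψc : HasCompactSupport ψ) (hψ0 : ∀ z, 0 ≤ ψ z)
    (hψ1 : ∫ z, ψ z = 1) (hψδ : ∀ z, |z| * ψ z ≤ δ * ψ z)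
    (hψ' : ∫ z, |z| * |deriv ψ z| ≤ c₁)
    (hint : Integrable (fun p : ℝ × ℝ =>
      entropyDensity f (u p.1) (v p.2) (U p.1) (dU p.1) (Ru p.1) (deriv ψ (p.1 - p.2))
        (ψ (p.1 - p.2))
      + entropyDensity f (v p.2) (u p.1) (W p.2) (dW p.2) (Rw p.2) (-deriv ψ (p.1 - p.2))
        (ψ (p.1 - p.2)))) :
    ∫ p : ℝ × ℝ, (entropyDensity f (u p.1) (v p.2) (U p.1) (dU p.1) (Ru p.1)
        (deriv ψ (p.1 - p.2)) (ψ (p.1 - p.2))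
      + entropyDensity f (v p.2) (u p.1) (W p.2) (dW p.2) (Rw p.2) (-deriv ψ (p.1 - p.2))
        (ψ (p.1 - p.2)))
      ≤ c₁ * (M * κ * V + M * L * ((∫ x, |u x - v x|) + V * δ))
        + (M * L * ((∫ x, |u x - v x|) + V * δ) + M * (Λ + K * δ) + (r + K * δ)) := by
  set n := ∫ x, |u x - v x| with hn
  have hn0 : 0 ≤ n := integral_nonneg fun x => abs_nonneg _
  have hκ0 : 0 ≤ κ := (abs_nonneg _).trans (hκ 0)
  set Φ : ℝ → ℝ → ℝ := fun x y =>
    entropyDensity f (u x) (v y) (U x) (dU x) (Ru x) (deriv ψ (x - y)) (ψ (x - y))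
      + entropyDensity f (v y) (u x) (W y) (dW y) (Rw y) (-deriv ψ (x - y)) (ψ (x - y)) with hΦ
  obtain ⟨hI, hSl, hE⟩ := integral_prod_eq_integral_slices (Φ := Φ) hint
  set c₀ := ∫ x, entropyFlux f (u x) (v x) * (U x - W x) with hc₀
  set B₁ := M * κ * V + M * L * (n + V * δ) with hB₁
  set B₂ := M * L * (n + V * δ) + M * (Λ + K * δ) + (r + K * δ) with hB₂
  have hB₁0 : 0 ≤ B₁ := by positivity
  have hΛ0 : 0 ≤ Λ := le_trans (integral_nonneg fun x => by positivity) hΛ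
  have hr0 : 0 ≤ r := le_trans (integral_nonneg fun x => by positivity) hr
  have hB₂0 : 0 ≤ B₂ := by positivity
  have hψ'c : Continuous (deriv ψ) := hψ.continuous_deriv (by simp)
  have hψ'i : Integrable (deriv ψ) := hψ'c.integrable_of_hasCompactSupport hψc.deriv
  have hψi : Integrable ψ := hψ.continuous.integrable_of_hasCompactSupport hψc
  have hψ'z : Integrable fun z => |z| * |deriv ψ z| := by
    have : Continuous fun z => |z| * |deriv ψ z| := by fun_prop
    refine this.integrable_of_hasCompactSupport ?_
    exact (hψc.deriv.comp_left (g := fun y => |y|) abs_zero).mul_left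
  -- The support condition on the mollifier is encoded in `hψδ`, since (|z| - δ)ψ(z) ≤ 0 with ψ ≥ 0.
  have hzero : ∀ z, δ < |z| → ψ z = 0 := fun z hz => by
    have := hψδ z
    nlinarith [hψ0 z]
  have hzero' : ∀ z, δ < |z| → deriv ψ z = 0 := fun z hz => by
    have : ψ =ᶠ[𝓝 z] fun _ => 0 := by
      filter_upwards [(isOpen_lt continuous_const continuous_abs).mem_nhds hz] with y hy
        using hzero y hy
    rw [this.deriv_eq]; simp
  have bvi : ∀ {g : ℝ → ℝ} {w : ℝ → ℝ} {C : ℝ}, Measurable g → (∀ x, |g x| ≤ C) → Integrable w →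
      Integrable fun x => |w x| * |g x| := by
    intro g w C hg hC hw
    refine hw.abs.mul_bdd (c := C) (hg.aestronglyMeasurable.norm) (Eventually.of_forall fun x => ?_)
    simpa using hC x
  have hGm : Measurable fun x => entropyFlux f (u x) (v x) := by
    unfold entropyFlux
    exact (measurable_sign.comp (hum.sub hvm)).mul ((hfm.comp hum).sub (hfm.comp hvm))
  have hGi : Integrable fun x => entropyFlux f (u x) (v x) * (U x - W x) := by
    refine ((hu.sub hv).abs.const_mul (M * κ)).mono' ((hGm.mul (hUm.sub hWm)).aestronglyMeasurable)
      (Eventually.of_forall fun x => ?_)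
    rw [Real.norm_eq_abs, abs_mul]
    calc _ ≤ (M * |u x - v x|) * κ := by
          gcongr
          · exact abs_entropyFlux_le hf (hu1 x) (hv1 x)
          · exact hκ x
      _ = M * κ * |u x - v x| := by ring
  -- The coefficients `c₀`, `B₁`, `B₂` do not depend on z, so integrating in z only needs ∫ψ' = 0,
  -- the moment bound `c₁` and ∫ψ = 1.
  have hslice : ∀ᵐ z, ∫ x, Φ x (x - z) ≤ c₀ * deriv ψ z + B₁ * (|z| * |deriv ψ z|) + B₂ * ψ z := by
    filter_upwards [hSl] with z hΦi
    rcases lt_or_ge δ |z| with hz | hz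
    · simp [hΦ, entropyDensity, hzero z hz, hzero' z hz]
    set d := deriv ψ z with hd
    set e := ψ z with he
    have he0 : 0 ≤ e := hψ0 z
    have hvz : Integrable fun x => v (x - z) := hv.comp_sub_right z
    have j1 : Integrable fun x => |v (x - z) - v x| := (hvz.sub hv).abs
    have j2 : Integrable fun x => |u x - v (x - z)| := (hu.sub hvz).abs
    have j3' : Integrable fun x => |v x| * |dW x - dU x| :=
      bvi (C := L + L) (hdWm.sub hdUm)
        (fun x => (abs_sub _ _).trans (add_le_add (hdW x) (hdU x))) hv
    have j3 : Integrable fun x => |v (x - z)| * |dW (x - z) - dU (x - z)| := j3'.comp_sub_right z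
    have j4' : Integrable fun x => |v x| * |dU (x + z) - dU x| :=
      bvi (C := L + L) ((hdUm.comp (measurable_id.add_const z)).sub hdUm)
        (fun x => (abs_sub _ _).trans (add_le_add (hdU _) (hdU x))) hv
    have j4 : Integrable fun x => |v (x - z)| * |dU x - dU (x - z)| := by
      simpa using j4'.comp_sub_right z
    have j5 : Integrable fun x => |Ru x - Rw x| := (hRu.sub hRw).abs
    have j6 : Integrable fun x => |Rw x - Rw (x - z)| := (hRw.sub (hRw.comp_sub_right z)).abs
    have b1 : ∫ x, |v (x - z) - v x| ≤ V * |z| := by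
      have := hvV (-z); simpa [← sub_eq_add_neg] using this
    have b2 : ∫ x, |u x - v (x - z)| ≤ n + V * δ :=
      (integral_abs_sub_translate_le hu hv hvV z).trans (by gcongr)
    have b3 : ∫ x, |v (x - z)| * |dW (x - z) - dU (x - z)| ≤ Λ := by
      rw [integral_sub_right_eq_self (fun x => |v x| * |dW x - dU x|) z]; exact hΛ
    have b4 : ∫ x, |v (x - z)| * |dU x - dU (x - z)| ≤ K * δ := by
      have h1 := integral_sub_right_eq_self (μ := volume) (fun x => |v x| * |dU (x + z) - dU x|) z
      simp only [sub_add_cancel] at h1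
      rw [h1]; exact (hdUt z).trans (by gcongr)
    have b6 : ∫ x, |Rw x - Rw (x - z)| ≤ K * δ := by
      have h1 := integral_sub_right_eq_self (μ := volume) (fun x => |Rw (x + z) - Rw x|) z
      simp only [sub_add_cancel] at h1
      rw [h1]; exact (hRt z).trans (by gcongr)
    have hpt : ∀ x, Φ x (x - z) ≤ entropyFlux f (u x) (v x) * (U x - W x) * d
        + M * κ * |d| * |v (x - z) - v x| + M * L * |z| * |d| * |u x - v (x - z)|
        + M * L * e * |u x - v (x - z)| + M * e * (|v (x - z)| * |dW (x - z) - dU (x - z)|)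
        + M * e * (|v (x - z)| * |dU x - dU (x - z)|)
        + e * |Ru x - Rw x| + e * |Rw x - Rw (x - z)| := by
      intro x
      simp only [hΦ, sub_sub_cancel]
      refine entropyDensity_add_le hf hf0 (hu1 x) (hv1 _) (hv1 x) he0 (hκ x) ?_ (hdW _)
      have := hWL x (x - z)
      rwa [sub_sub_cancel] at this
    have i1 := hGi.mul_const d
    have i2 := j1.const_mul (M * κ * |d|)
    have i3 := j2.const_mul (M * L * |z| * |d|)
    have i4 := j2.const_mul (M * L * e)
    have i5 := j3.const_mul (M * e)
    have i6 := j4.const_mul (M * e)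
    have i7 := j5.const_mul e
    have i8 := j6.const_mul e
    have s2 := integrable_add_and_integral_le i1 i2 (integral_mul_const _ _).le
      ((integral_const_mul _ _).le.trans (mul_le_mul_of_nonneg_left b1 (by positivity)))
    have s3 := integrable_add_and_integral_le s2.1 i3 s2.2
      ((integral_const_mul _ _).le.trans (mul_le_mul_of_nonneg_left b2 (by positivity)))
    have s4 := integrable_add_and_integral_le s3.1 i4 s3.2
      ((integral_const_mul _ _).le.trans (mul_le_mul_of_nonneg_left b2 (by positivity)))
    have s5 := integrable_add_and_integral_le s4.1 i5 s4.2
      ((integral_const_mul _ _).le.trans (mul_le_mul_of_nonneg_left b3 (by positivity)))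
    have s6 := integrable_add_and_integral_le s5.1 i6 s5.2
      ((integral_const_mul _ _).le.trans (mul_le_mul_of_nonneg_left b4 (by positivity)))
    have s7 := integrable_add_and_integral_le s6.1 i7 s6.2
      ((integral_const_mul _ _).le.trans (mul_le_mul_of_nonneg_left hr he0))
    have s8 := integrable_add_and_integral_le s7.1 i8 s7.2
      ((integral_const_mul _ _).le.trans (mul_le_mul_of_nonneg_left b6 he0))
    have hle : ∫ x, Φ x (x - z) ≤ c₀ * d + M * κ * |d| * (V * |z|)
        + M * L * |z| * |d| * (n + V * δ) + M * L * e * (n + V * δ) + M * e * Λ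
        + M * e * (K * δ) + e * r + e * (K * δ) :=
      (integral_mono hΦi s8.1 hpt).trans s8.2
    refine hle.trans (le_of_eq ?_)
    rw [hB₁, hB₂]; ring
  rw [hE]
  have k1 := hψ'i.const_mul c₀
  have k2 := hψ'z.const_mul B₁
  have k3 := hψi.const_mul B₂
  have t1 := integrable_add_and_integral_le k1 k2 (integral_const_mul _ _).le
    ((integral_const_mul _ _).le.trans (mul_le_mul_of_nonneg_left hψ' hB₁0))
  have t2 := integrable_add_and_integral_le t1.1 k3 t1.2 (integral_const_mul _ _).le
  refine ((integral_mono_ae hI t2.1 hslice).trans t2.2).trans (le_of_eq ?_)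
  rw [integral_deriv_eq_zero_of_hasCompactSupport hψ hψc, hψ1]
  ring

end Multilane

/-! ### Kruzhkov curves -/

namespace Multilane

open Filter Topology

theorem integrable_mul_comp_sub {u k : ℝ → ℝ} (hu : Integrable u) (hk : Integrable k) :
    Integrable (fun p : ℝ × ℝ => u p.1 * k (p.1 - p.2)) ∧
      ∫ p : ℝ × ℝ, u p.1 * k (p.1 - p.2) = (∫ x, u x) * ∫ z, k z := by
  have h := hu.mul_prod hk
  rw [← Measure.volume_eq_prod] at h
  have e : ((fun p : ℝ × ℝ => u p.1 * k p.2) ∘ fun p : ℝ × ℝ => (p.1, p.1 - p.2))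
      = fun p : ℝ × ℝ => u p.1 * k (p.1 - p.2) := rfl
  refine ⟨?_, ?_⟩
  · rw [← e]
    exact measurePreserving_fst_sub.integrable_comp_of_integrable h
  · have hemb : MeasurableEmbedding (fun p : ℝ × ℝ => (p.1, p.1 - p.2)) := by
      refine MeasurableEquiv.measurableEmbedding (⟨⟨fun p => (p.1, p.1 - p.2),
        fun p => (p.1, p.1 - p.2), fun p => by simp, fun p => by simp⟩, ?_, ?_⟩ : ℝ × ℝ ≃ᵐ ℝ × ℝ)
      · exact (by fun_prop : Measurable fun p : ℝ × ℝ => (p.1, p.1 - p.2))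
      · exact (by fun_prop : Measurable fun p : ℝ × ℝ => (p.1, p.1 - p.2))
    have := measurePreserving_fst_sub.integral_comp hemb (fun p : ℝ × ℝ => u p.1 * k p.2)
    simp only at this
    rw [this, Measure.volume_eq_prod, integral_prod_mul]

theorem integrable_mul_comp_sub' {w k : ℝ → ℝ} (hw : Integrable w) (hk : Integrable k) :
    Integrable (fun p : ℝ × ℝ => w p.2 * k (p.1 - p.2)) ∧
      ∫ p : ℝ × ℝ, w p.2 * k (p.1 - p.2) = (∫ x, w x) * ∫ z, k z := by
  obtain ⟨h1, h2⟩ := integrable_mul_comp_sub hw hk.comp_neg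
  simp only [neg_sub] at h1 h2
  rw [Measure.volume_eq_prod] at h1 h2 ⊢
  refine ⟨h1.swap, ?_⟩
  rw [integral_neg_eq_self (fun z => k z)] at h2
  rw [← h2]
  exact (integral_prod_swap (fun p : ℝ × ℝ => w p.2 * k (p.1 - p.2))).symm

theorem integral_swap_plane (g : ℝ × ℝ → ℝ) : ∫ p : ℝ × ℝ, g p.swap = ∫ p, g p := by
  rw [Measure.volume_eq_prod]; exact integral_prod_swap g

theorem measurable_entropyDensity {α : Type*} [MeasurableSpace α] {f : ℝ → ℝ} (hf : Measurable f)
    {a b U D R d e : α → ℝ} (ha : Measurable a) (hb : Measurable b) (hU : Measurable U)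
    (hD : Measurable D) (hR : Measurable R) (hd : Measurable d) (he : Measurable e) :
    Measurable fun q => entropyDensity f (a q) (b q) (U q) (D q) (R q) (d q) (e q) := by
  have hs := measurable_sign.comp (ha.sub hb)
  unfold entropyDensity entropyFlux
  exact ((((hs.mul ((hf.comp ha).sub (hf.comp hb))).mul hU).mul hd).sub
    (((hs.mul (hf.comp hb)).mul hD).mul he)).add ((hs.mul hR).mul he)

theorem abs_entropyDensity_le {f : ℝ → ℝ} {M C : ℝ} (hM : 0 ≤ M)
    (hf : ∀ a ∈ Icc (0 : ℝ) 1, ∀ b ∈ Icc (0 : ℝ) 1, |f a - f b| ≤ M * |a - b|) (hf0 : f 0 = 0)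
    {a b U D R d e : ℝ} (ha : a ∈ Icc (0 : ℝ) 1) (hb : b ∈ Icc (0 : ℝ) 1) (hU : |U| ≤ C)
    (hD : |D| ≤ C) (he : 0 ≤ e) :
    |entropyDensity f a b U D R d e|
      ≤ M * C * (|a| * |d| + |b| * |d|) + M * C * (|b| * e) + |R| * e := by
  have hC : 0 ≤ C := (abs_nonneg _).trans hU
  have hfb : |f b| ≤ M * |b| := by simpa [hf0] using hf b hb 0 ⟨le_rfl, zero_le_one⟩
  have h1 : |entropyFlux f a b * U * d| ≤ M * C * (|a| * |d| + |b| * |d|) := by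
    rw [abs_mul, abs_mul]
    calc _ ≤ (M * (|a| + |b|)) * C * |d| := by
          gcongr
          exact (abs_entropyFlux_le hf ha hb).trans (by gcongr; exact abs_sub _ _)
      _ = _ := by ring
  have h2 : |Real.sign (a - b) * f b * D * e| ≤ M * C * (|b| * e) := by
    rw [abs_mul, abs_mul, abs_mul, abs_of_nonneg he]
    calc _ ≤ 1 * (M * |b|) * C * e := by gcongr; exact abs_sign_le_one _
      _ = _ := by ring
  have h3 : |Real.sign (a - b) * R * e| ≤ |R| * e := by
    rw [abs_mul, abs_mul, abs_of_nonneg he]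
    calc _ ≤ 1 * |R| * e := by gcongr; exact abs_sign_le_one _
      _ = _ := by ring
  unfold entropyDensity
  refine (abs_add_le _ _).trans (add_le_add ((abs_sub _ _).trans (add_le_add h1 h2)) h3)

/-- The explicit right-hand side depends on the profiles only through their `L¹` norms and `C`,
hence is uniform in time along a Kruzhkov curve. -/
theorem integrable_entropyDensity {f u w U D R ψ : ℝ → ℝ} {M C : ℝ} (hM : 0 ≤ M)
    (hfm : Measurable f)
    (hf : ∀ a ∈ Icc (0 : ℝ) 1, ∀ b ∈ Icc (0 : ℝ) 1, |f a - f b| ≤ M * |a - b|) (hf0 : f 0 = 0)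
    (hu1 : ∀ x, u x ∈ Icc (0 : ℝ) 1) (hu : Integrable u) (hum : Measurable u)
    (hw1 : ∀ x, w x ∈ Icc (0 : ℝ) 1) (hw : Integrable w) (hwm : Measurable w)
    (hUm : Measurable U) (hDm : Measurable D) (hRm : Measurable R) (hU : ∀ x, |U x| ≤ C)
    (hD : ∀ x, |D x| ≤ C) (hR : Integrable R)
    (hψ : ContDiff ℝ (⊤ : ℕ∞) ψ) (hψc : HasCompactSupport ψ) (hψ0 : ∀ z, 0 ≤ ψ z) :
    Integrable (fun p : ℝ × ℝ => entropyDensity f (u p.1) (w p.2) (U p.1) (D p.1) (R p.1)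
        (deriv ψ (p.1 - p.2)) (ψ (p.1 - p.2))) ∧
      ∫ p : ℝ × ℝ, |entropyDensity f (u p.1) (w p.2) (U p.1) (D p.1) (R p.1)
        (deriv ψ (p.1 - p.2)) (ψ (p.1 - p.2))|
      ≤ M * C * ((∫ x, |u x|) * (∫ z, |deriv ψ z|) + (∫ x, |w x|) * (∫ z, |deriv ψ z|))
        + M * C * ((∫ x, |w x|) * ∫ z, ψ z) + (∫ x, |R x|) * ∫ z, ψ z := by
  have hψ'c : Continuous (deriv ψ) := hψ.continuous_deriv (by simp)
  have hψ'i : Integrable fun z => |deriv ψ z| :=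
    (hψ'c.integrable_of_hasCompactSupport hψc.deriv).abs
  have hψi : Integrable ψ := hψ.continuous.integrable_of_hasCompactSupport hψc
  have hC : 0 ≤ C := (abs_nonneg _).trans (hU 0)
  obtain ⟨i1, e1⟩ := integrable_mul_comp_sub hu.abs hψ'i
  obtain ⟨i2, e2⟩ := integrable_mul_comp_sub' hw.abs hψ'i
  obtain ⟨i3, e3⟩ := integrable_mul_comp_sub' hw.abs hψi
  obtain ⟨i4, e4⟩ := integrable_mul_comp_sub hR.abs hψi
  have hm : Measurable (fun p : ℝ × ℝ => entropyDensity f (u p.1) (w p.2) (U p.1) (D p.1) (R p.1)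
        (deriv ψ (p.1 - p.2)) (ψ (p.1 - p.2))) :=
    measurable_entropyDensity hfm (hum.comp measurable_fst) (hwm.comp measurable_snd)
      (hUm.comp measurable_fst) (hDm.comp measurable_fst) (hRm.comp measurable_fst)
      (hψ'c.measurable.comp (measurable_fst.sub measurable_snd))
      (hψ.continuous.measurable.comp (measurable_fst.sub measurable_snd))
  have hb : ∀ p : ℝ × ℝ, |entropyDensity f (u p.1) (w p.2) (U p.1) (D p.1) (R p.1)
        (deriv ψ (p.1 - p.2)) (ψ (p.1 - p.2))|
      ≤ M * C * (|u p.1| * |deriv ψ (p.1 - p.2)| + |w p.2| * |deriv ψ (p.1 - p.2)|)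
        + M * C * (|w p.2| * ψ (p.1 - p.2)) + |R p.1| * ψ (p.1 - p.2) := fun p =>
    abs_entropyDensity_le hM hf hf0 (hu1 _) (hw1 _) (hU _) (hD _) (hψ0 _)
  have s12 := (i1.add i2).const_mul (M * C)
  have s3 := i3.const_mul (M * C)
  have hdom := (s12.add s3).add i4
  have hint := hdom.mono' hm.aestronglyMeasurable (Eventually.of_forall hb)
  refine ⟨hint, (integral_mono hint.abs hdom hb).trans (le_of_eq ?_)⟩
  rw [integral_add' (s12.add s3) i4, integral_add' s12 s3, integral_const_mul, integral_const_mul,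
    integral_add' i1 i2, e1, e2, e3, e4]

/-- A curve `u` of profiles on `(0, T)` satisfying the Kruzhkov inequalities of
`∂ₜu + ∂ₓ(f(u) U) = R` integrated in time, where `D` stands for `∂ₓU`. -/
structure KruzhkovCurve (f : ℝ → ℝ) (T B : ℝ) (u U D R : ℝ → ℝ → ℝ) : Prop where
  u_meas : Measurable (fun p : ℝ × ℝ => u p.1 p.2)
  U_meas : Measurable (fun p : ℝ × ℝ => U p.1 p.2)
  D_meas : Measurable (fun p : ℝ × ℝ => D p.1 p.2)
  R_meas : Measurable (fun p : ℝ × ℝ => R p.1 p.2)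
  u_range : ∀ t x, u t x ∈ Icc (0 : ℝ) 1
  u_int : ∀ t, Integrable (u t)
  u_norm : ∀ t, ∫ x, |u t x| ≤ B
  u_lip : ∀ s t, ∫ x, |u s x - u t x| ≤ B * |s - t|
  U_bdd : ∀ t x, |U t x| ≤ B
  D_bdd : ∀ t x, |D t x| ≤ B
  R_int : ∀ t, Integrable (R t)
  R_norm : ∀ t, ∫ x, |R t x| ≤ B
  ineq : ∀ α ∈ Icc (0 : ℝ) 1, ∀ ψ : ℝ → ℝ, ContDiff ℝ (⊤ : ℕ∞) ψ → HasCompactSupport ψ →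
    (∀ x, 0 ≤ ψ x) → ∀ t₁ t₂, 0 < t₁ → t₁ ≤ t₂ → t₂ < T →
    (∫ x, |u t₂ x - α| * ψ x) - (∫ x, |u t₁ x - α| * ψ x)
      ≤ ∫ τ in t₁..t₂, ∫ x, entropyDensity f (u τ x) α (U τ x) (D τ x) (R τ x) (deriv ψ x) (ψ x)

theorem integrable_abs_sub_mul {u w ψ : ℝ → ℝ} (hu : Integrable u) (hw : Integrable w)
    (hψ : Integrable ψ) (hψ0 : ∀ z, 0 ≤ ψ z) :
    Integrable (fun p : ℝ × ℝ => |u p.1 - w p.2| * ψ (p.1 - p.2)) := by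
  obtain ⟨i1, -⟩ := integrable_mul_comp_sub hu hψ
  obtain ⟨i2, -⟩ := integrable_mul_comp_sub' hw hψ
  refine (i1.sub i2).abs.congr (Eventually.of_forall fun p => ?_)
  simp only [Pi.sub_apply]
  rw [← sub_mul, abs_mul, abs_of_nonneg (hψ0 _)]

variable {f : ℝ → ℝ} {T B M : ℝ} {u U D R : ℝ → ℝ → ℝ}

/-- Kruzhkov inequality integrated against a second profile in place of the constant. -/
theorem KruzhkovCurve.doubled (h : KruzhkovCurve f T B u U D R) (hM : 0 ≤ M) (hfm : Measurable f)
    (hf : ∀ a ∈ Icc (0 : ℝ) 1, ∀ b ∈ Icc (0 : ℝ) 1, |f a - f b| ≤ M * |a - b|) (hf0 : f 0 = 0)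
    {w ψ : ℝ → ℝ} (hw1 : ∀ x, w x ∈ Icc (0 : ℝ) 1) (hw : Integrable w) (hwm : Measurable w)
    (hψ : ContDiff ℝ (⊤ : ℕ∞) ψ) (hψc : HasCompactSupport ψ) (hψ0 : ∀ z, 0 ≤ ψ z)
    {t₁ t₂ : ℝ} (h1 : 0 < t₁) (h12 : t₁ ≤ t₂) (h2 : t₂ < T) :
    (∫ p : ℝ × ℝ, |u t₂ p.1 - w p.2| * ψ (p.1 - p.2))
        - (∫ p : ℝ × ℝ, |u t₁ p.1 - w p.2| * ψ (p.1 - p.2))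
      ≤ ∫ τ in t₁..t₂, ∫ p : ℝ × ℝ, entropyDensity f (u τ p.1) (w p.2) (U τ p.1) (D τ p.1)
        (R τ p.1) (deriv ψ (p.1 - p.2)) (ψ (p.1 - p.2)) := by
  have hψ'c : Continuous (deriv ψ) := hψ.continuous_deriv (by simp)
  have hψi : Integrable ψ := hψ.continuous.integrable_of_hasCompactSupport hψc
  set g : ℝ → ℝ × ℝ → ℝ := fun τ p => entropyDensity f (u τ p.1) (w p.2) (U τ p.1) (D τ p.1)
        (R τ p.1) (deriv ψ (p.1 - p.2)) (ψ (p.1 - p.2)) with hg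
  have m1 : Measurable fun q : ℝ × (ℝ × ℝ) => (q.1, q.2.1) := by fun_prop
  have m2 : Measurable fun q : ℝ × (ℝ × ℝ) => q.2.2 := by fun_prop
  have m3 : Measurable fun q : ℝ × (ℝ × ℝ) => q.2.1 - q.2.2 := by fun_prop
  have hgm : Measurable (fun q : ℝ × (ℝ × ℝ) => g q.1 q.2) :=
    measurable_entropyDensity hfm (h.u_meas.comp m1) (hwm.comp m2) (h.U_meas.comp m1)
      (h.D_meas.comp m1) (h.R_meas.comp m1) (hψ'c.measurable.comp m3)
      (hψ.continuous.measurable.comp m3)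
  have hslice : ∀ τ, Integrable (g τ) ∧ ∫ p, |g τ p| ≤ _ := fun τ =>
    integrable_entropyDensity hM hfm hf hf0 (h.u_range τ) (h.u_int τ)
      (h.u_meas.comp measurable_prodMk_left) hw1 hw hwm (h.U_meas.comp measurable_prodMk_left)
      (h.D_meas.comp measurable_prodMk_left) (h.R_meas.comp measurable_prodMk_left)
      (h.U_bdd τ) (h.D_bdd τ) (h.R_int τ) hψ hψc hψ0
  have hB : 0 ≤ B := (abs_nonneg _).trans (h.U_bdd 0 0)
  have hψ1 : 0 ≤ ∫ z, ψ z := integral_nonneg hψ0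
  have hψ'1 : 0 ≤ ∫ z, |deriv ψ z| := integral_nonneg fun z => abs_nonneg _
  obtain ⟨C, hC⟩ : ∃ C, ∀ τ, ∫ p, |g τ p| ≤ C := by
    refine ⟨M * B * (B * (∫ z, |deriv ψ z|) + (∫ x, |w x|) * (∫ z, |deriv ψ z|))
        + M * B * ((∫ x, |w x|) * ∫ z, ψ z) + B * ∫ z, ψ z, fun τ => (hslice τ).2.trans ?_⟩
    gcongr
    · exact h.u_norm τ
    · exact h.R_norm τ
  have hgi : Integrable (fun q : ℝ × (ℝ × ℝ) => g q.1 q.2)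
      ((volume.restrict (Ioc t₁ t₂)).prod volume) := by
    rw [integrable_prod_iff hgm.aestronglyMeasurable]
    refine ⟨Eventually.of_forall fun τ => (hslice τ).1, ?_⟩
    refine (integrable_const C).mono' ?_ (Eventually.of_forall fun τ => ?_)
    · exact (hgm.norm.stronglyMeasurable.integral_prod_right').aestronglyMeasurable
    · rw [Real.norm_of_nonneg (integral_nonneg fun p => norm_nonneg _)]
      exact hC τ
  -- Reassociated as ((τ, y), x): integrating out x first leaves a function of (τ, y), on which the
  -- integrals in τ and y can be exchanged.
  have hgi' : Integrable (fun q : (ℝ × ℝ) × ℝ => g q.1.1 (q.2, q.1.2))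
      (((volume.restrict (Ioc t₁ t₂)).prod volume).prod volume) := by
    have hsw : Integrable (fun q : ℝ × (ℝ × ℝ) => g q.1 q.2.swap)
        ((volume.restrict (Ioc t₁ t₂)).prod (volume.prod volume)) :=
      ((MeasurePreserving.id (volume.restrict (Ioc t₁ t₂))).prod
        (Measure.measurePreserving_swap (μ := (volume : Measure ℝ))
          (ν := (volume : Measure ℝ)))).integrable_comp_of_integrable hgi
    exact (measurePreserving_prodAssoc (volume.restrict (Ioc t₁ t₂)) (volume : Measure ℝ)
      (volume : Measure ℝ)).integrable_comp_of_integrable hsw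
  have hQ := hgi'.integral_prod_left
  have hP : ∀ t, Integrable (fun y => ∫ x, |u t x - w y| * ψ (x - y)) ∧
      ∫ p : ℝ × ℝ, |u t p.1 - w p.2| * ψ (p.1 - p.2) = ∫ y, ∫ x, |u t x - w y| * ψ (x - y) := by
    intro t
    have := integrable_abs_sub_mul (h.u_int t) hw hψi hψ0
    rw [Measure.volume_eq_prod] at this ⊢
    exact ⟨this.integral_prod_right, integral_prod_symm _ this⟩
  have hpt : ∀ y, (∫ x, |u t₂ x - w y| * ψ (x - y)) - (∫ x, |u t₁ x - w y| * ψ (x - y))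
      ≤ ∫ τ in Ioc t₁ t₂, ∫ x, g τ (x, y) := by
    intro y
    -- For each y, the value w(y) serves as Kruzhkov constant and the translated mollifier as test
    -- function.
    have := h.ineq (w y) (hw1 y) (fun x => ψ (x - y)) (hψ.comp (contDiff_id.sub contDiff_const))
      (hψc.comp_homeomorph (Homeomorph.subRight y)) (fun x => hψ0 _) t₁ t₂ h1 h12 h2
    rw [intervalIntegral.integral_of_le h12] at this
    simpa only [deriv_comp_sub_const] using this
  rw [(hP t₂).2, (hP t₁).2, ← integral_sub (hP t₂).1 (hP t₁).1,
    intervalIntegral.integral_of_le h12]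
  refine (integral_mono ((hP t₂).1.sub (hP t₁).1) hQ.integral_prod_right hpt).trans (le_of_eq ?_)
  rw [integral_integral_swap (f := fun y τ => ∫ x, g τ (x, y)) hQ.swap]
  refine integral_congr_ae (Eventually.of_forall fun τ => ?_)
  have := (hslice τ).1
  simp only
  rw [Measure.volume_eq_prod] at this ⊢
  exact (integral_prod_symm _ this).symm

end Multilane

/-! ### Doubling of the variables -/

namespace Multilane

open Filter Topology

variable {f : ℝ → ℝ} {T B M : ℝ} {u U D R v W D' R' : ℝ → ℝ → ℝ}

theorem integral_comp_swap_plane (g : ℝ × ℝ → ℝ) :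
    integral volume (g ∘ Prod.swap) = integral volume g :=
  integral_swap_plane g

theorem deriv_comp_neg_apply (ψ : ℝ → ℝ) : deriv (fun z => ψ (-z)) = fun z => -deriv ψ (-z) := by
  funext z
  exact deriv_comp_neg ψ z

/-- One constant serves all times and all second profiles of norm at most `B`;
`diagonal_sub_le_integral` asks for such uniform bounds. -/
theorem KruzhkovCurve.integrable_density (h : KruzhkovCurve f T B u U D R) (hM : 0 ≤ M)
    (hfm : Measurable f)
    (hf : ∀ a ∈ Icc (0 : ℝ) 1, ∀ b ∈ Icc (0 : ℝ) 1, |f a - f b| ≤ M * |a - b|) (hf0 : f 0 = 0)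
    {ψ : ℝ → ℝ} (hψ : ContDiff ℝ (⊤ : ℕ∞) ψ) (hψc : HasCompactSupport ψ) (hψ0 : ∀ z, 0 ≤ ψ z) :
    ∃ C, ∀ w : ℝ → ℝ, Measurable w → (∀ x, w x ∈ Icc (0 : ℝ) 1) → Integrable w →
      (∫ x, |w x| ≤ B) → ∀ t,
      Integrable (fun p : ℝ × ℝ => entropyDensity f (u t p.1) (w p.2) (U t p.1) (D t p.1) (R t p.1)
        (deriv ψ (p.1 - p.2)) (ψ (p.1 - p.2))) ∧
      |∫ p : ℝ × ℝ, entropyDensity f (u t p.1) (w p.2) (U t p.1) (D t p.1) (R t p.1)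
        (deriv ψ (p.1 - p.2)) (ψ (p.1 - p.2))| ≤ C := by
  have hB : 0 ≤ B := (abs_nonneg _).trans (h.U_bdd 0 0)
  have hψ1 : 0 ≤ ∫ z, ψ z := integral_nonneg hψ0
  have hψ'1 : 0 ≤ ∫ z, |deriv ψ z| := integral_nonneg fun z => abs_nonneg _
  refine ⟨M * B * (B * (∫ z, |deriv ψ z|) + B * (∫ z, |deriv ψ z|))
        + M * B * (B * ∫ z, ψ z) + B * ∫ z, ψ z, fun w hwm hw1 hw hwB t => ?_⟩
  obtain ⟨i, e⟩ := integrable_entropyDensity hM hfm hf hf0 (h.u_range t) (h.u_int t)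
      (h.u_meas.comp measurable_prodMk_left) hw1 hw hwm (h.U_meas.comp measurable_prodMk_left)
      (h.D_meas.comp measurable_prodMk_left) (h.R_meas.comp measurable_prodMk_left)
      (h.U_bdd t) (h.D_bdd t) (h.R_int t) hψ hψc hψ0
  refine ⟨i, abs_integral_le_integral_abs.trans (e.trans ?_)⟩
  gcongr
  · exact h.u_norm t
  · exact h.R_norm t

/-- The density for the second solution, with the roles of the variables exchanged. -/
theorem density_reflect (ψ : ℝ → ℝ) (t s : ℝ) :
    (fun p : ℝ × ℝ => entropyDensity f (v s p.2) (u t p.1) (W s p.2) (D' s p.2) (R' s p.2)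
        (-deriv ψ (p.1 - p.2)) (ψ (p.1 - p.2)))
      = (fun p : ℝ × ℝ => entropyDensity f (v s p.1) (u t p.2) (W s p.1) (D' s p.1) (R' s p.1)
        (deriv (fun z => ψ (-z)) (p.1 - p.2)) ((fun z => ψ (-z)) (p.1 - p.2))) ∘ Prod.swap := by
  funext p
  simp [deriv_comp_neg_apply]

/-- The second density is of the first kind after exchanging x and y, with the reflected mollifier z
↦ ψ(-z); no symmetry of ψ is needed. -/
theorem KruzhkovCurve.integrable_density_add (h : KruzhkovCurve f T B u U D R)
    (h' : KruzhkovCurve f T B v W D' R') (hM : 0 ≤ M) (hfm : Measurable f)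
    (hf : ∀ a ∈ Icc (0 : ℝ) 1, ∀ b ∈ Icc (0 : ℝ) 1, |f a - f b| ≤ M * |a - b|) (hf0 : f 0 = 0)
    {ψ : ℝ → ℝ} (hψ : ContDiff ℝ (⊤ : ℕ∞) ψ) (hψc : HasCompactSupport ψ) (hψ0 : ∀ z, 0 ≤ ψ z) :
    ∃ C, ∀ t s,
      Integrable (fun p : ℝ × ℝ => entropyDensity f (u t p.1) (v s p.2) (U t p.1) (D t p.1)
        (R t p.1) (deriv ψ (p.1 - p.2)) (ψ (p.1 - p.2))) ∧
      Integrable (fun p : ℝ × ℝ => entropyDensity f (v s p.2) (u t p.1) (W s p.2) (D' s p.2)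
        (R' s p.2) (-deriv ψ (p.1 - p.2)) (ψ (p.1 - p.2))) ∧
      |∫ p : ℝ × ℝ, entropyDensity f (u t p.1) (v s p.2) (U t p.1) (D t p.1)
        (R t p.1) (deriv ψ (p.1 - p.2)) (ψ (p.1 - p.2))| ≤ C ∧
      |∫ p : ℝ × ℝ, entropyDensity f (v s p.2) (u t p.1) (W s p.2) (D' s p.2)
        (R' s p.2) (-deriv ψ (p.1 - p.2)) (ψ (p.1 - p.2))| ≤ C := by
  obtain ⟨C₁, h1⟩ := h.integrable_density hM hfm hf hf0 hψ hψc hψ0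
  obtain ⟨C₂, h2⟩ := h'.integrable_density hM hfm hf hf0 (ψ := fun z => ψ (-z))
    (hψ.comp contDiff_neg) (hψc.comp_homeomorph (Homeomorph.neg ℝ)) (fun z => hψ0 _)
  refine ⟨max C₁ C₂, fun t s => ?_⟩
  obtain ⟨i1, e1⟩ := h1 (v s) (h'.u_meas.comp measurable_prodMk_left) (h'.u_range s) (h'.u_int s)
    (h'.u_norm s) t
  obtain ⟨i2, e2⟩ := h2 (u t) (h.u_meas.comp measurable_prodMk_left) (h.u_range t) (h.u_int t)
    (h.u_norm t) s
  refine ⟨i1, ?_, e1.trans (le_max_left _ _), ?_⟩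
  · rw [density_reflect]
    rw [Measure.volume_eq_prod] at i2 ⊢
    exact i2.swap
  · rw [density_reflect]
    refine le_trans (le_of_eq ?_) (e2.trans (le_max_right _ _))
    congr 1
    exact integral_comp_swap_plane _

/-- Doubling of the variables: the growth of the distance of two Kruzhkov curves is bounded by any
continuous bound `E` for the doubled entropy densities. -/
theorem KruzhkovCurve.dist_sub_le (h : KruzhkovCurve f T B u U D R)
    (h' : KruzhkovCurve f T B v W D' R') (hM : 0 ≤ M) (hfm : Measurable f)
    (hf : ∀ a ∈ Icc (0 : ℝ) 1, ∀ b ∈ Icc (0 : ℝ) 1, |f a - f b| ≤ M * |a - b|) (hf0 : f 0 = 0)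
    {ψ : ℝ → ℝ} {δ V : ℝ} (hV0 : 0 ≤ V)
    (hψ : ContDiff ℝ (⊤ : ℕ∞) ψ) (hψc : HasCompactSupport ψ) (hψ0 : ∀ z, 0 ≤ ψ z)
    (hψ1 : ∫ z, ψ z = 1) (hψδ : ∀ z, |z| * ψ z ≤ δ * ψ z)
    (hV : ∀ t h, ∫ x, |v t (x + h) - v t x| ≤ V * |h|)
    {E : ℝ → ℝ → ℝ} (hE : Continuous (fun p : ℝ × ℝ => E p.1 p.2))
    (hABE : ∀ t s, ∫ p : ℝ × ℝ, (entropyDensity f (u t p.1) (v s p.2) (U t p.1) (D t p.1)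
        (R t p.1) (deriv ψ (p.1 - p.2)) (ψ (p.1 - p.2))
      + entropyDensity f (v s p.2) (u t p.1) (W s p.2) (D' s p.2)
        (R' s p.2) (-deriv ψ (p.1 - p.2)) (ψ (p.1 - p.2))) ≤ E t s)
    {a b : ℝ} (ha : 0 < a) (hab : a ≤ b) (hb : b < T) :
    (∫ x, |u b x - v b x|) ≤ (∫ x, |u a x - v a x|) + (∫ t in a..b, E t t) + 2 * V * δ := by
  have hψ'c : Continuous (deriv ψ) := hψ.continuous_deriv (by simp)
  have hψi : Integrable ψ := hψ.continuous.integrable_of_hasCompactSupport hψc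
  have hB : 0 ≤ B := (abs_nonneg _).trans (h.U_bdd 0 0)
  obtain ⟨C, hC⟩ := h.integrable_density_add h' hM hfm hf hf0 hψ hψc hψ0
  set F : ℝ → ℝ → ℝ := fun t s => ∫ p : ℝ × ℝ, |u t p.1 - v s p.2| * ψ (p.1 - p.2) with hF
  have hFi : ∀ t s, Integrable (fun p : ℝ × ℝ => |u t p.1 - v s p.2| * ψ (p.1 - p.2)) := fun t s =>
    integrable_abs_sub_mul (h.u_int t) (h'.u_int s) hψi hψ0
  -- As ∫ψ = 1, the doubled distance inherits the `L¹`-Lipschitz constants of both curves.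
  have hFL1 : ∀ t t' s s', F t s - F t' s' ≤ B * |t - t'| + B * |s - s'| := by
    intro t t' s s'
    obtain ⟨i1, e1⟩ := integrable_mul_comp_sub ((h.u_int t).sub (h.u_int t')).abs hψi
    obtain ⟨i2, e2⟩ := integrable_mul_comp_sub' ((h'.u_int s).sub (h'.u_int s')).abs hψi
    rw [hψ1, mul_one] at e1 e2
    simp only [Pi.sub_apply] at i1 i2 e1 e2
    have := integral_mono (hFi t s) ((hFi t' s').add (i1.add i2)) fun p => by
      simp only [Pi.add_apply]
      rw [← add_mul, ← add_mul]
      refine mul_le_mul_of_nonneg_right ?_ (hψ0 _)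
      have a1 := abs_sub_le (u t p.1 - v s p.2) (u t' p.1 - v s' p.2) 0
      have a2 := abs_sub (u t p.1 - u t' p.1) (v s p.2 - v s' p.2)
      rw [sub_zero, sub_zero] at a1
      rw [show u t p.1 - v s p.2 - (u t' p.1 - v s' p.2)
        = u t p.1 - u t' p.1 - (v s p.2 - v s' p.2) by ring] at a1
      linarith
    rw [integral_add' (hFi t' s') (i1.add i2), integral_add' i1 i2, e1, e2] at this
    have b1 := h.u_lip t t'
    have b2 := h'.u_lip s s'
    simp only [hF]
    linarith
  have hFL : LipschitzWith (Real.toNNReal (2 * B)) (fun p : ℝ × ℝ => F p.1 p.2) := by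
    refine LipschitzWith.of_dist_le_mul fun p q => ?_
    have h1 := hFL1 p.1 q.1 p.2 q.2
    have h2 := hFL1 q.1 p.1 q.2 p.2
    rw [abs_sub_comm q.1, abs_sub_comm q.2] at h2
    have d1 : |p.1 - q.1| ≤ dist p q := by
      rw [← Real.dist_eq, Prod.dist_eq]; exact le_max_left _ _
    have d2 : |p.2 - q.2| ≤ dist p q := by
      rw [← Real.dist_eq, Prod.dist_eq]; exact le_max_right _ _
    rw [Real.coe_toNNReal _ (by positivity), Real.dist_eq, abs_le]
    constructor <;> nlinarith
  have m1 : Measurable fun q : (ℝ × ℝ) × (ℝ × ℝ) => (q.1.1, q.2.1) := by fun_prop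
  have m2 : Measurable fun q : (ℝ × ℝ) × (ℝ × ℝ) => (q.1.2, q.2.2) := by fun_prop
  have m3 : Measurable fun q : (ℝ × ℝ) × (ℝ × ℝ) => q.2.1 - q.2.2 := by fun_prop
  have hd := hψ'c.measurable.comp m3
  have he := hψ.continuous.measurable.comp m3
  have hAm : Measurable (fun q : ℝ × ℝ => ∫ p : ℝ × ℝ, entropyDensity f (u q.1 p.1) (v q.2 p.2)
      (U q.1 p.1) (D q.1 p.1) (R q.1 p.1) (deriv ψ (p.1 - p.2)) (ψ (p.1 - p.2))) :=
    (StronglyMeasurable.integral_prod_right' (measurable_entropyDensity hfm (h.u_meas.comp m1)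
      (h'.u_meas.comp m2) (h.U_meas.comp m1) (h.D_meas.comp m1) (h.R_meas.comp m1) hd
      he).stronglyMeasurable).measurable
  have hBm : Measurable (fun q : ℝ × ℝ => ∫ p : ℝ × ℝ, entropyDensity f (v q.2 p.2) (u q.1 p.1)
      (W q.2 p.2) (D' q.2 p.2) (R' q.2 p.2) (-deriv ψ (p.1 - p.2)) (ψ (p.1 - p.2))) :=
    (StronglyMeasurable.integral_prod_right' (measurable_entropyDensity hfm (h'.u_meas.comp m2)
      (h.u_meas.comp m1) (h'.U_meas.comp m2) (h'.D_meas.comp m2) (h'.R_meas.comp m2) hd.neg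
      he).stronglyMeasurable).measurable
  have hFswap : ∀ t s, F t s
      = ∫ p : ℝ × ℝ, |v s p.1 - u t p.2| * (fun z => ψ (-z)) (p.1 - p.2) := by
    intro t s
    rw [← integral_swap_plane]
    simp only [hF, Prod.fst_swap, Prod.snd_swap, neg_sub]
    refine integral_congr_ae (Eventually.of_forall fun p => ?_)
    beta_reduce
    rw [abs_sub_comm]
  have key := diagonal_sub_le_integral (F := F)
    (A := fun t s => ∫ p : ℝ × ℝ, entropyDensity f (u t p.1) (v s p.2) (U t p.1) (D t p.1)
        (R t p.1) (deriv ψ (p.1 - p.2)) (ψ (p.1 - p.2)))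
    (B := fun t s => ∫ p : ℝ × ℝ, entropyDensity f (v s p.2) (u t p.1) (W s p.2) (D' s p.2)
        (R' s p.2) (-deriv ψ (p.1 - p.2)) (ψ (p.1 - p.2))) (T := T)
    hFL hAm hBm (fun t s => (hC t s).2.2.1) (fun t s => (hC t s).2.2.2)
    (fun s _ t₁ t₂ h1 h12 h2 => h.doubled hM hfm hf hf0 (h'.u_range s) (h'.u_int s)
      (h'.u_meas.comp measurable_prodMk_left) hψ hψc hψ0 h1 h12 h2)
    (fun t _ s₁ s₂ h1 h12 h2 => by
      rw [hFswap, hFswap]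
      refine (h'.doubled hM hfm hf hf0 (h.u_range t) (h.u_int t)
        (h.u_meas.comp measurable_prodMk_left) (ψ := fun z => ψ (-z)) (hψ.comp contDiff_neg)
        (hψc.comp_homeomorph (Homeomorph.neg ℝ)) (fun z => hψ0 _) h1 h12 h2).trans (le_of_eq ?_)
      refine intervalIntegral.integral_congr fun τ _ => ?_
      rw [density_reflect]
      exact (integral_comp_swap_plane _).symm)
    hE (fun t s => by
      rw [← integral_add (hC t s).1 (hC t s).2.1]
      exact hABE t s) ha hab hb
  -- The doubled distance exceeds or misses the true one by the translation of v over the support of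
  -- ψ. The price is paid at both end times, hence 2Vδ.
  have hFn : ∀ t, |F t t - (∫ x, |u t x - v t x|)| ≤ V * δ := by
    intro t
    obtain ⟨i1, e1⟩ := integrable_mul_comp_sub ((h.u_int t).sub (h'.u_int t)).abs hψi
    rw [hψ1, mul_one] at e1
    simp only [Pi.sub_apply] at i1 e1
    rw [← e1]
    simp only [hF]
    rw [← integral_sub (hFi t t) i1]
    refine abs_integral_le_integral_abs.trans ?_
    have hi := ((hFi t t).sub i1).abs
    simp only [Pi.sub_apply] at hi
    obtain ⟨j1, j2, j3⟩ := integral_prod_eq_integral_slices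
      (Φ := fun x y => |(|u t x - v t y| * ψ (x - y) - |u t x - v t x| * ψ (x - y))|) hi
    rw [j3]
    calc _ ≤ ∫ z, V * δ * ψ z := by
          refine integral_mono_ae j1 (hψi.const_mul _) ?_
          filter_upwards [j2] with z hz
          simp only [sub_sub_cancel] at hz ⊢
          have i2 : Integrable fun x => |v t (x - z) - v t x| :=
            (((h'.u_int t).comp_sub_right z).sub (h'.u_int t)).abs
          calc _ ≤ ∫ x, |v t (x - z) - v t x| * ψ z := by
                refine integral_mono hz (i2.mul_const _) fun x => ?_
                simp only
                rw [← sub_mul, abs_mul, abs_of_nonneg (hψ0 z)]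
                refine mul_le_mul_of_nonneg_right ?_ (hψ0 z)
                refine (abs_abs_sub_abs_le_abs_sub _ _).trans (le_of_eq ?_)
                rw [abs_sub_comm (v t (x - z))]
                congr 1; ring
            _ ≤ V * |z| * ψ z := by
                rw [integral_mul_const]
                refine mul_le_mul_of_nonneg_right ?_ (hψ0 z)
                have := hV t (-z)
                simpa [← sub_eq_add_neg] using this
            _ = V * (|z| * ψ z) := by ring
            _ ≤ V * (δ * ψ z) := mul_le_mul_of_nonneg_left (hψδ z) hV0
            _ = _ := by ring
      _ = V * δ := by rw [integral_const_mul, hψ1, mul_one]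
  have ea := abs_le.1 (hFn a)
  have eb := abs_le.1 (hFn b)
  linarith [ea.1, ea.2, eb.1, eb.2]

end Multilane

/-! ### The nonlocal term -/

namespace Multilane

open Filter Topology

/-- Young's inequality in `L¹` for `x ↦ ∫ w(y) k(y - x) dy`. -/
theorem integral_abs_correlation_le {w k : ℝ → ℝ} (hw : Integrable w) (hk : Integrable k) :
    Integrable (fun x => ∫ y, w y * k (y - x)) ∧
      ∫ x, |∫ y, w y * k (y - x)| ≤ (∫ x, |w x|) * ∫ z, |k z| := by
  obtain ⟨h1, -⟩ := integrable_mul_comp_sub hw hk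
  obtain ⟨h2, e2⟩ := integrable_mul_comp_sub hw.abs hk.abs
  rw [Measure.volume_eq_prod] at h1 h2 e2
  have i1 := h1.integral_prod_right
  have i2 := h2.integral_prod_right
  refine ⟨i1, ?_⟩
  calc _ ≤ ∫ x, ∫ y, |w y| * |k (y - x)| := by
        refine integral_mono i1.abs i2 fun x => ?_
        refine abs_integral_le_integral_abs.trans (le_of_eq ?_)
        simp only [abs_mul]
    _ = _ := by rw [← e2]; exact (integral_prod_symm _ h2).symm

namespace Model

variable {m : Model} {N : ℕ} {M : ℝ}

/-- The kernel extended by zero to the line. -/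
def ker (m : Model) : ℝ → ℝ := m.supp.indicator m.ω

theorem measurableSet_supp (m : Model) : MeasurableSet m.supp :=
  measurableSet_Ici.inter (measurableSet_le measurable_coe_real_ereal measurable_const)

theorem ker_nonneg (h : m.Admissible N) (z : ℝ) : 0 ≤ m.ker z :=
  indicator_nonneg (fun z hz => h.ω_nonneg z hz) z

theorem integral_ker (h : m.Admissible N) : ∫ z, m.ker z = 1 := by
  rw [ker, integral_indicator m.measurableSet_supp]; exact h.ω_mass

/-- Unit mass already forces integrability, since the integral of a non-integrable function is 0 by
convention. -/
theorem integrable_ker (h : m.Admissible N) : Integrable m.ker := by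
  by_contra hn
  have := integral_ker h
  rw [integral_undef hn] at this
  exact zero_ne_one this

theorem ker_of_neg {z : ℝ} (hz : z < 0) : m.ker z = 0 :=
  indicator_of_notMem (fun h => absurd h.1 (not_le.2 hz)) _

/-- The jump to zero beyond η is downward because ω ≥ 0, so only the jump at the origin breaks
monotonicity. -/
theorem antitoneOn_ker (h : m.Admissible N) : AntitoneOn m.ker (Ici 0) := by
  intro y hy z _ hyz
  by_cases hzs : z ∈ m.supp
  · have hys : y ∈ m.supp := ⟨hy, (EReal.coe_le_coe_iff.2 hyz).trans hzs.2⟩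
    rw [ker, indicator_of_mem hzs, indicator_of_mem hys]
    exact h.ω_anti hys hzs hyz
  · rw [show m.ker z = 0 from indicator_of_notMem hzs _]
    exact ker_nonneg h y

theorem ker_le (hM : 0 ≤ M) (hω : ∀ z ∈ m.supp, |m.ω z| ≤ M) (z : ℝ) : m.ker z ≤ M := by
  by_cases hz : z ∈ m.supp
  · rw [ker, indicator_of_mem hz]; exact (le_abs_self _).trans (hω z hz)
  · rw [show m.ker z = 0 from indicator_of_notMem hz _]; exact hM

/-- The kernel has `L¹` translation modulus `2 ‖ω‖_∞`, being unimodal. -/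
theorem integral_abs_ker_translate_le (h : m.Admissible N) (hM : 0 ≤ M)
    (hω : ∀ z ∈ m.supp, |m.ω z| ≤ M) (t : ℝ) :
    ∫ z, |m.ker (z - t) - m.ker z| ≤ 2 * M * |t| := by
  have key : ∀ t : ℝ, 0 ≤ t → ∫ z, |m.ker (z - t) - m.ker z| ≤ 2 * M * t := by
    intro t ht
    have hi := integrable_ker h
    have hit : Integrable fun z => m.ker (z - t) := hi.comp_sub_right t
    -- Beyond `t` the difference has a sign and needs no correction. On [0, t) the shifted kernel
    -- vanishes and 2M pays for flipping the sign. The signed difference integrates to zero, leaving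
    -- 2Mt.
    have hpt : ∀ z, |m.ker (z - t) - m.ker z|
        ≤ (m.ker (z - t) - m.ker z) + (Ico 0 t).indicator (fun _ => 2 * M) z := by
      intro z
      by_cases hz : z ∈ Ico 0 t
      · rw [indicator_of_mem hz, ker_of_neg (by linarith [hz.2] : z - t < 0), zero_sub, abs_neg,
          abs_of_nonneg (ker_nonneg h z)]
        linarith [ker_le hM hω z]
      · rw [indicator_of_notMem hz, add_zero]
        rw [mem_Ico, not_and_or, not_le, not_lt] at hz
        rcases hz with hz | hz
        · rw [ker_of_neg hz, ker_of_neg (by linarith : z - t < 0)]; simp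
        · have := antitoneOn_ker h (show z - t ∈ Ici (0 : ℝ) by simpa using hz)
            (show z ∈ Ici (0 : ℝ) from ht.trans hz) (by linarith)
          rw [abs_of_nonneg (by linarith)]
    have hind : Integrable ((Ico 0 t).indicator fun _ : ℝ => 2 * M) :=
      (integrable_indicator_iff measurableSet_Ico).2 (integrableOn_const (by simp))
    refine (integral_mono (hit.sub hi).abs ((hit.sub hi).add hind) hpt).trans (le_of_eq ?_)
    rw [integral_add' (hit.sub hi) hind, integral_sub' hit hi,
      integral_sub_right_eq_self (fun z => m.ker z), sub_self, zero_add,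
      integral_indicator measurableSet_Ico]
    simp [ht]; ring
  rcases le_total 0 t with ht | ht
  · rw [abs_of_nonneg ht]; exact key t ht
  · rw [abs_of_nonpos ht]
    refine le_trans (le_of_eq ?_) (key (-t) (by linarith))
    rw [← integral_add_right_eq_self (fun z => |m.ker (z - t) - m.ker z|) t]
    refine integral_congr_ae (Eventually.of_forall fun z => ?_)
    simp only [add_sub_cancel_right, sub_neg_eq_add]
    rw [abs_sub_comm]

theorem conv_eq (w : ℝ → ℝ) (x : ℝ) : m.conv w x = ∫ y, w y * m.ker (y - x) := by
  have hms : MeasurableSet {y : ℝ | y - x ∈ m.supp} :=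
    (measurable_id.sub_const x) m.measurableSet_supp
  rw [conv, ← integral_indicator hms]
  refine integral_congr_ae (Eventually.of_forall fun y => ?_)
  by_cases hy : y - x ∈ m.supp
  · simp [ker, indicator_of_mem hy, indicator_of_mem (show y ∈ {y : ℝ | y - x ∈ m.supp} from hy),
      mul_comm]
  · simp [ker, indicator_of_notMem hy,
      indicator_of_notMem (show y ∉ {y : ℝ | y - x ∈ m.supp} from hy)]

theorem conv_congr {w w' : ℝ → ℝ} (hww : w =ᵐ[volume] w') (x : ℝ) : m.conv w x = m.conv w' x := by
  rw [conv_eq, conv_eq]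
  refine integral_congr_ae ?_
  filter_upwards [hww] with y hy
  rw [hy]

theorem integrable_mul_ker (h : m.Admissible N) {w : ℝ → ℝ} {C : ℝ} (hwm : Measurable w)
    (hC : ∀ x, |w x| ≤ C) (x : ℝ) : Integrable fun y => w y * m.ker (y - x) :=
  ((integrable_ker h).comp_sub_right x).bdd_mul (c := C) hwm.aestronglyMeasurable
    (Eventually.of_forall hC)

theorem conv_sub (h : m.Admissible N) {w w' : ℝ → ℝ} {C : ℝ} (hwm : Measurable w)
    (hC : ∀ x, |w x| ≤ C) (hwm' : Measurable w') (hC' : ∀ x, |w' x| ≤ C) (x : ℝ) :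
    m.conv (fun y => w y - w' y) x = m.conv w x - m.conv w' x := by
  rw [conv_eq, conv_eq, conv_eq, ← integral_sub (integrable_mul_ker h hwm hC x)
    (integrable_mul_ker h hwm' hC' x)]
  simp only [sub_mul]

theorem conv_translate (w : ℝ → ℝ) (z x : ℝ) :
    m.conv (fun y => w (y + z)) x = m.conv w (x + z) := by
  rw [conv_eq, conv_eq, ← integral_add_right_eq_self (fun y => w y * m.ker (y - (x + z))) z]
  refine integral_congr_ae (Eventually.of_forall fun y => ?_)
  simp only
  congr 2; ring

/-- Averaging against a nonnegative kernel of unit mass stays in [0, 1], the only range where the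
bounds on ν and its derivatives are available. -/
theorem conv_mem (h : m.Admissible N) {w : ℝ → ℝ} (hwm : Measurable w)
    (hw : ∀ x, w x ∈ Icc (0 : ℝ) 1) (x : ℝ) : m.conv w x ∈ Icc (0 : ℝ) 1 := by
  rw [conv_eq]
  refine ⟨integral_nonneg fun y => mul_nonneg (hw y).1 (ker_nonneg h _), ?_⟩
  have hi := integrable_mul_ker h hwm (C := 1)
    (fun x => abs_le.2 ⟨by linarith [(hw x).1], (hw x).2⟩) x
  refine (integral_mono hi ((integrable_ker h).comp_sub_right x) fun y =>
    mul_le_of_le_one_left (ker_nonneg h _) (hw y).2).trans (le_of_eq ?_)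
  rw [integral_sub_right_eq_self (fun z => m.ker z), integral_ker h]

theorem abs_conv_le (h : m.Admissible N) (hM : 0 ≤ M) (hω : ∀ z ∈ m.supp, |m.ω z| ≤ M)
    {w : ℝ → ℝ} (hw : Integrable w) (x : ℝ) : |m.conv w x| ≤ M * ∫ y, |w y| := by
  rw [conv_eq]
  refine abs_integral_le_integral_abs.trans ?_
  rw [← integral_const_mul]
  refine integral_mono_of_nonneg (Eventually.of_forall fun y => abs_nonneg _)
    (hw.abs.const_mul M) (Eventually.of_forall fun y => ?_)
  simp only
  rw [abs_mul, abs_of_nonneg (ker_nonneg h _), mul_comm]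
  exact mul_le_mul_of_nonneg_right (ker_le hM hω _) (abs_nonneg _)

theorem integral_abs_conv_le (h : m.Admissible N) {w : ℝ → ℝ} (hw : Integrable w) :
    Integrable (m.conv w) ∧ ∫ x, |m.conv w x| ≤ ∫ x, |w x| := by
  obtain ⟨h1, h2⟩ := integral_abs_correlation_le hw (integrable_ker h)
  have e : m.conv w = fun x => ∫ y, w y * m.ker (y - x) := funext fun x => conv_eq w x
  rw [e]
  refine ⟨h1, h2.trans (le_of_eq ?_)⟩
  simp only [abs_of_nonneg (ker_nonneg h _), integral_ker h, mul_one]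

/-- The shift is moved from the density to the kernel, so no regularity of `w` beyond boundedness is
involved. -/
theorem abs_conv_sub_le (h : m.Admissible N) (hM : 0 ≤ M) (hω : ∀ z ∈ m.supp, |m.ω z| ≤ M)
    {w : ℝ → ℝ} {C : ℝ} (hC0 : 0 ≤ C) (hwm : Measurable w) (hC : ∀ x, |w x| ≤ C) (x y : ℝ) :
    |m.conv w x - m.conv w y| ≤ C * (2 * M) * |x - y| := by
  rw [conv_eq, conv_eq, ← integral_sub (integrable_mul_ker h hwm hC x)
    (integrable_mul_ker h hwm hC y)]
  refine abs_integral_le_integral_abs.trans ?_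
  have hi : Integrable fun z => |m.ker (z - x) - m.ker (z - y)| :=
    (((integrable_ker h).comp_sub_right x).sub ((integrable_ker h).comp_sub_right y)).abs
  calc _ ≤ ∫ z, C * |m.ker (z - x) - m.ker (z - y)| := by
        refine integral_mono_of_nonneg (Eventually.of_forall fun y => abs_nonneg _)
          (hi.const_mul C) (Eventually.of_forall fun z => ?_)
        simp only
        rw [← mul_sub, abs_mul]
        exact mul_le_mul_of_nonneg_right (hC z) (abs_nonneg _)
    _ = C * ∫ z, |m.ker (z - (x - y)) - m.ker z| := by
        rw [integral_const_mul, ← integral_sub_right_eq_self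
          (fun z => |m.ker (z - (x - y)) - m.ker z|) y]
        congr 1
        refine integral_congr_ae (Eventually.of_forall fun z => ?_)
        simp only
        congr 3; ring
    _ ≤ C * (2 * M * |x - y|) := by
        gcongr; exact integral_abs_ker_translate_le h hM hω _
    _ = _ := by ring

theorem lipschitzWith_conv (h : m.Admissible N) (hM : 0 ≤ M) (hω : ∀ z ∈ m.supp, |m.ω z| ≤ M)
    {w : ℝ → ℝ} (hwm : Measurable w) (hC : ∀ x, |w x| ≤ 1) :
    LipschitzWith (Real.toNNReal (2 * M)) (m.conv w) := by
  refine LipschitzWith.of_dist_le_mul fun x y => ?_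
  rw [Real.coe_toNNReal _ (by positivity), Real.dist_eq, Real.dist_eq]
  simpa using abs_conv_sub_le h hM hω zero_le_one hwm hC x y

theorem abs_deriv_conv_le (h : m.Admissible N) (hM : 0 ≤ M) (hω : ∀ z ∈ m.supp, |m.ω z| ≤ M)
    {w : ℝ → ℝ} (hwm : Measurable w) (hC : ∀ x, |w x| ≤ 1) (x : ℝ) :
    |deriv (m.conv w) x| ≤ 2 * M := by
  have := norm_deriv_le_of_lipschitz (lipschitzWith_conv h hM hω hwm hC) (x₀ := x)
  rwa [Real.coe_toNNReal _ (by positivity)] at this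

/-- The derivative of the nonlocal term is bounded in `L¹` by the density. -/
theorem integral_abs_deriv_conv_le (h : m.Admissible N) (hM : 0 ≤ M)
    (hω : ∀ z ∈ m.supp, |m.ω z| ≤ M) {w : ℝ → ℝ} (hwm : Measurable w) (hC : ∀ x, |w x| ≤ 1)
    (hw : Integrable w) :
    Integrable (deriv (m.conv w)) ∧ ∫ x, |deriv (m.conv w) x| ≤ 2 * M * ∫ x, |w x| := by
  have hL := lipschitzWith_conv h hM hω hwm hC
  have hn0 : 0 ≤ ∫ x, |w x| := integral_nonneg fun x => abs_nonneg _
  set ε : ℕ → ℝ := fun n => 1 / ((n : ℝ) + 1) with hε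
  have hεp : ∀ n, 0 < ε n := fun n => Nat.one_div_pos_of_nat
  -- Difference quotients are correlations of `w` with difference quotients of the kernel, whose
  -- `L¹` norm is at most 2M.
  have hq : ∀ n, ∫⁻ x, ‖(ε n)⁻¹ * (m.conv w (x + ε n) - m.conv w x)‖ₑ
      ≤ ENNReal.ofReal (2 * M * ∫ x, |w x|) := by
    intro n
    have hk : Integrable fun z => m.ker (z - ε n) - m.ker z :=
      ((integrable_ker h).comp_sub_right _).sub (integrable_ker h)
    obtain ⟨h1, h2⟩ := integral_abs_correlation_le hw hk
    have e : ∀ x, ∫ y, w y * (m.ker (y - x - ε n) - m.ker (y - x))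
        = m.conv w (x + ε n) - m.conv w x := by
      intro x
      rw [conv_eq, conv_eq, ← integral_sub (integrable_mul_ker h hwm hC _)
        (integrable_mul_ker h hwm hC _)]
      simp only [mul_sub, sub_sub]
    simp only [e] at h1 h2
    have h3 := h1.const_mul (ε n)⁻¹
    rw [← ofReal_integral_norm_eq_lintegral_enorm h3]
    apply ENNReal.ofReal_le_ofReal
    simp only [norm_mul, Real.norm_eq_abs, abs_of_pos (inv_pos.2 (hεp n))]
    rw [integral_const_mul, inv_mul_le_iff₀ (hεp n)]
    refine h2.trans ?_
    have h4 := integral_abs_ker_translate_le h hM hω (ε n)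
    rw [abs_of_pos (hεp n)] at h4
    calc _ ≤ (∫ x, |w x|) * (2 * M * ε n) := by gcongr
      _ = _ := by ring
  have hlim : ∀ᵐ x, ‖deriv (m.conv w) x‖ₑ
      = liminf (fun n => ‖(ε n)⁻¹ * (m.conv w (x + ε n) - m.conv w x)‖ₑ) atTop := by
    filter_upwards [hL.ae_differentiableAt_real] with x hx
    have h1 := (hasDerivAt_iff_tendsto_slope_zero.1 hx.hasDerivAt).comp
      (tendsto_nhdsWithin_iff.2 ⟨tendsto_one_div_add_atTop_nhds_zero_nat,
        Eventually.of_forall fun n => (hεp n).ne'⟩)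
    exact ((continuous_enorm.tendsto _).comp h1).liminf_eq.symm
  -- Fatou's lemma along the difference quotients, which converge almost everywhere because the
  -- nonlocal term is Lipschitz.
  have hb : ∫⁻ x, ‖deriv (m.conv w) x‖ₑ ≤ ENNReal.ofReal (2 * M * ∫ x, |w x|) := by
    rw [lintegral_congr_ae hlim]
    refine (lintegral_liminf_le fun n => ?_).trans ?_
    · have := hL.continuous.measurable
      fun_prop
    · refine (liminf_le_liminf (Eventually.of_forall hq)).trans ?_
      simp
  have hi : Integrable (deriv (m.conv w)) :=
    ⟨(measurable_deriv _).aestronglyMeasurable, hb.trans_lt ENNReal.ofReal_lt_top⟩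
  refine ⟨hi, ?_⟩
  rw [integral_abs_eq_toReal hi.1]
  exact ENNReal.toReal_le_of_le_ofReal (by positivity) hb

end Model

end Multilane

/-! ### The velocities -/

namespace Multilane

open Filter Topology

/-- An integrable Borel density with values in `[0, 1]`. -/
structure IsDensity (w : ℝ → ℝ) : Prop where
  meas : Measurable w
  range : ∀ x, w x ∈ Icc (0 : ℝ) 1
  int : Integrable w

theorem IsDensity.abs_le_one {w : ℝ → ℝ} (hw : IsDensity w) (x : ℝ) : |w x| ≤ 1 :=
  abs_le.2 ⟨by linarith [(hw.range x).1], (hw.range x).2⟩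

theorem IsDensity.abs_sub_le_one {w w' : ℝ → ℝ} (hw : IsDensity w) (hw' : IsDensity w') (x : ℝ) :
    |w x - w' x| ≤ 1 :=
  abs_le.2 ⟨by linarith [(hw.range x).1, (hw'.range x).2], by
    linarith [(hw.range x).2, (hw'.range x).1]⟩

theorem IsDensity.translate {w : ℝ → ℝ} (hw : IsDensity w) (z : ℝ) :
    IsDensity fun x => w (x + z) :=
  ⟨hw.meas.comp (measurable_id.add_const z), fun _ => hw.range _, hw.int.comp_add_right z⟩

/-- The mean value inequality is applied along the horizontal segment and then the vertical one, so
separate differentiability suffices. It serves ν and both of its first derivatives. -/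
theorem abs_sub_le_of_partial_derivatives {h : ℝ → ℝ → ℝ} {M : ℝ}
    (h1 : ∀ u ∈ Icc (0 : ℝ) 1, ∀ x, DifferentiableAt ℝ (fun y => h y u) x)
    (h2 : ∀ x, ∀ u ∈ Icc (0 : ℝ) 1, DifferentiableAt ℝ (fun w => h x w) u)
    (b1 : ∀ x, ∀ u ∈ Icc (0 : ℝ) 1, |D1 h x u| ≤ M) (b2 : ∀ x, ∀ u ∈ Icc (0 : ℝ) 1, |D2 h x u| ≤ M)
    (x y : ℝ) {u w : ℝ} (hu : u ∈ Icc (0 : ℝ) 1) (hw : w ∈ Icc (0 : ℝ) 1) :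
    |h x u - h y w| ≤ M * (|x - y| + |u - w|) := by
  have e1 := Convex.norm_image_sub_le_of_norm_deriv_le (f := fun y => h y u) (s := univ)
    (fun x _ => h1 u hu x) (fun x _ => b1 x u hu) convex_univ (mem_univ y) (mem_univ x)
  have e2 := Convex.norm_image_sub_le_of_norm_deriv_le (f := fun w => h y w) (s := Icc (0 : ℝ) 1)
    (fun w hw => h2 y w hw) (fun w hw => b2 y w hw) (convex_Icc 0 1) hw hu
  simp only [Real.norm_eq_abs] at e1 e2
  have := abs_sub_le (h x u) (h y u) (h y w)
  linarith

namespace Model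

/-- The bounds on the data that enter the stability constant. -/
structure DataBounds (m : Model) (N : ℕ) (M : ℝ) : Prop where
  nonneg : 0 ≤ M
  ω_sup : ∀ z ∈ m.supp, |m.ω z| ≤ M
  f_lip : ∀ k ∈ Finset.Icc 1 N, ∀ a ∈ Icc (0 : ℝ) 1, ∀ b ∈ Icc (0 : ℝ) 1,
    |m.f k a - m.f k b| ≤ M * |a - b|
  ν_deriv : ∀ k ∈ Finset.Icc 1 N, ∀ x, ∀ w ∈ Icc (0 : ℝ) 1,
    |D1 (m.ν k) x w| ≤ M ∧ |D2 (m.ν k) x w| ≤ M ∧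
      |D1 (D1 (m.ν k)) x w| ≤ M ∧ |D2 (D1 (m.ν k)) x w| ≤ M ∧
      |D1 (D2 (m.ν k)) x w| ≤ M ∧ |D2 (D2 (m.ν k)) x w| ≤ M
  S_lip : ∀ k ∈ Finset.Icc 1 N, ∀ x,
    ∀ a ∈ Icc (0 : ℝ) 1, ∀ b ∈ Icc (0 : ℝ) 1, ∀ A ∈ Icc (0 : ℝ) 1, ∀ B ∈ Icc (0 : ℝ) 1,
    ∀ a' ∈ Icc (0 : ℝ) 1, ∀ b' ∈ Icc (0 : ℝ) 1, ∀ A' ∈ Icc (0 : ℝ) 1, ∀ B' ∈ Icc (0 : ℝ) 1,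
    |m.S N k x a b A B - m.S N k x a' b' A' B'|
      ≤ M * (|a - a'| + |b - b'| + |A - A'| + |B - B'|)

/-- The velocity of lane `k` generated by the density `w`. -/
def vel (m : Model) (k : ℕ) (w : ℝ → ℝ) (x : ℝ) : ℝ := m.ν k x (m.conv w x)

variable {m : Model} {N : ℕ} {M : ℝ} {k : ℕ}

theorem abs_ν_sub_le (h : m.Admissible N) (hb : m.DataBounds N M) (hk : k ∈ Finset.Icc 1 N)
    (x y : ℝ) {u w : ℝ} (hu : u ∈ Icc (0 : ℝ) 1) (hw : w ∈ Icc (0 : ℝ) 1) :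
    |m.ν k x u - m.ν k y w| ≤ M * (|x - y| + |u - w|) :=
  abs_sub_le_of_partial_derivatives
    (fun u _ x => (h.ν_C2_left k hk u).differentiable two_ne_zero x)
    (fun x u _ => (h.ν_C2_right k hk x).differentiable two_ne_zero u)
    (fun x u hu => (hb.ν_deriv k hk x u hu).1) (fun x u hu => (hb.ν_deriv k hk x u hu).2.1)
    x y hu hw

theorem abs_D1_ν_sub_le (h : m.Admissible N) (hb : m.DataBounds N M) (hk : k ∈ Finset.Icc 1 N)
    (x y : ℝ) {u w : ℝ} (hu : u ∈ Icc (0 : ℝ) 1) (hw : w ∈ Icc (0 : ℝ) 1) :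
    |D1 (m.ν k) x u - D1 (m.ν k) y w| ≤ M * (|x - y| + |u - w|) :=
  abs_sub_le_of_partial_derivatives
    (fun u _ x => (h.ν_C2_left k hk u).differentiable_deriv_two x)
    (fun x u hu => (h.ν_mixed k hk x u hu).1)
    (fun x u hu => (hb.ν_deriv k hk x u hu).2.2.1)
    (fun x u hu => (hb.ν_deriv k hk x u hu).2.2.2.1) x y hu hw

theorem abs_D2_ν_sub_le (h : m.Admissible N) (hb : m.DataBounds N M) (hk : k ∈ Finset.Icc 1 N)
    (x y : ℝ) {u w : ℝ} (hu : u ∈ Icc (0 : ℝ) 1) (hw : w ∈ Icc (0 : ℝ) 1) :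
    |D2 (m.ν k) x u - D2 (m.ν k) y w| ≤ M * (|x - y| + |u - w|) :=
  abs_sub_le_of_partial_derivatives
    (fun u hu x => (h.ν_mixed k hk x u hu).2)
    (fun x u _ => (h.ν_C2_right k hk x).differentiable_deriv_two u)
    (fun x u hu => (hb.ν_deriv k hk x u hu).2.2.2.2.1)
    (fun x u hu => (hb.ν_deriv k hk x u hu).2.2.2.2.2) x y hu hw

/-- Chain rule for `x ↦ ν(x, W(x))`. -/
theorem hasDerivAt_ν_comp (h : m.Admissible N) (hb : m.DataBounds N M) (hk : k ∈ Finset.Icc 1 N)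
    {W : ℝ → ℝ} (hW : ∀ x, W x ∈ Icc (0 : ℝ) 1) {x W' : ℝ} (hx : HasDerivAt W W' x) :
    HasDerivAt (fun y => m.ν k y (W y)) (D1 (m.ν k) x (W x) + D2 (m.ν k) x (W x) * W') x := by
  have hM := hb.nonneg
  have h2 : HasDerivAt (fun y => m.ν k x (W y)) (D2 (m.ν k) x (W x) * W') x :=
    (((h.ν_C2_right k hk x).differentiable two_ne_zero (W x)).hasDerivAt).comp x hx
  -- Joint differentiability of ν is not among the hypotheses. The increment in position is compared
  -- with its linearisation by the mean value inequality, at the moving argument W(y); the joint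
  -- Lipschitz bound on `D1` makes the error o(|y - x|).
  have h1 : HasDerivAt (fun y => m.ν k y (W y) - m.ν k x (W y)) (D1 (m.ν k) x (W x)) x := by
    rw [hasDerivAt_iff_isLittleO]
    have hbound : ∀ y, |m.ν k y (W y) - m.ν k x (W y) - (m.ν k x (W x) - m.ν k x (W x))
        - (y - x) * D1 (m.ν k) x (W x)| ≤ M * (|y - x| + |W y - W x|) * |y - x| := by
      intro y
      have hd : ∀ z, HasDerivAt (fun z => m.ν k z (W y) - z * D1 (m.ν k) x (W x))
          (D1 (m.ν k) z (W y) - 1 * D1 (m.ν k) x (W x)) z := fun z =>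
        (((h.ν_C2_left k hk (W y)).differentiable two_ne_zero z).hasDerivAt).sub
          ((hasDerivAt_id z).mul_const _)
      have hmv := (convex_uIcc x y).norm_image_sub_le_of_norm_hasDerivWithin_le
        (C := M * (|y - x| + |W y - W x|)) (fun z _ => (hd z).hasDerivWithinAt) (fun z hz => by
          rw [one_mul, Real.norm_eq_abs]
          refine (abs_D1_ν_sub_le h hb hk z x (hW y) (hW x)).trans ?_
          have : |z - x| ≤ |y - x| := abs_sub_left_of_mem_uIcc hz
          gcongr) left_mem_uIcc right_mem_uIcc
      simp only [Real.norm_eq_abs] at hmv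
      refine le_trans (le_of_eq ?_) hmv
      congr 1; ring
    refine Asymptotics.IsBigO.trans_isLittleO (g := fun y => M * (|y - x| + |W y - W x|) * (y - x))
      (Asymptotics.isBigO_of_le _ fun y => ?_) ?_
    · simp only [smul_eq_mul, Real.norm_eq_abs]
      rw [abs_mul, abs_of_nonneg (by positivity : 0 ≤ M * (|y - x| + |W y - W x|))]
      exact hbound y
    · have ht : Tendsto (fun y => M * (|y - x| + |W y - W x|)) (𝓝 x) (𝓝 0) := by
        have hc : ContinuousAt (fun y => M * (|y - x| + |W y - W x|)) x := by
          have := hx.continuousAt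
          fun_prop
        simpa using hc.tendsto
      have := (Asymptotics.isLittleO_one_iff ℝ).2 ht
      simpa using this.mul_isBigO (Asymptotics.isBigO_refl (fun y => y - x) (𝓝 x))
  have := h1.add h2
  refine this.congr_of_eventuallyEq (Eventually.of_forall fun y => ?_)
  simp

theorem abs_conv_sub_conv_le (h : m.Admissible N) (hb : m.DataBounds N M) {w : ℝ → ℝ}
    (hw : IsDensity w) (x y : ℝ) : |m.conv w x - m.conv w y| ≤ 2 * M * |x - y| := by
  simpa using abs_conv_sub_le h hb.nonneg hb.ω_sup zero_le_one hw.meas hw.abs_le_one x y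

theorem abs_vel_sub_le (h : m.Admissible N) (hb : m.DataBounds N M) (hk : k ∈ Finset.Icc 1 N)
    {w : ℝ → ℝ} (hw : IsDensity w) (x y : ℝ) :
    |m.vel k w x - m.vel k w y| ≤ M * (1 + 2 * M) * |x - y| := by
  have hM := hb.nonneg
  refine (abs_ν_sub_le h hb hk x y (conv_mem h hw.meas hw.range x)
    (conv_mem h hw.meas hw.range y)).trans ?_
  have := abs_conv_sub_conv_le h hb hw x y
  calc _ ≤ M * (|x - y| + 2 * M * |x - y|) := by gcongr
    _ = _ := by ring

theorem abs_deriv_vel_le (h : m.Admissible N) (hb : m.DataBounds N M) (hk : k ∈ Finset.Icc 1 N)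
    {w : ℝ → ℝ} (hw : IsDensity w) (x : ℝ) : |deriv (m.vel k w) x| ≤ M * (1 + 2 * M) := by
  have hM := hb.nonneg
  have hL : LipschitzWith (Real.toNNReal (M * (1 + 2 * M))) (m.vel k w) := by
    refine LipschitzWith.of_dist_le_mul fun x y => ?_
    rw [Real.coe_toNNReal _ (by positivity), Real.dist_eq, Real.dist_eq]
    exact abs_vel_sub_le h hb hk hw x y
  have := norm_deriv_le_of_lipschitz hL (x₀ := x)
  rwa [Real.coe_toNNReal _ (by positivity)] at this

theorem conv_sub_density (h : m.Admissible N) {u v : ℝ → ℝ} (hu : IsDensity u) (hv : IsDensity v)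
    (x : ℝ) : m.conv (fun y => u y - v y) x = m.conv u x - m.conv v x :=
  conv_sub h hu.meas hu.abs_le_one hv.meas hv.abs_le_one x

theorem abs_conv_sub_density_le (h : m.Admissible N) (hb : m.DataBounds N M) {u v : ℝ → ℝ}
    (hu : IsDensity u) (hv : IsDensity v) (x : ℝ) :
    |m.conv u x - m.conv v x| ≤ M * ∫ y, |u y - v y| := by
  rw [← conv_sub_density h hu hv]
  exact abs_conv_le h hb.nonneg hb.ω_sup (hu.int.sub hv.int) x

theorem integral_abs_conv_sub_density_le (h : m.Admissible N) {u v : ℝ → ℝ}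
    (hu : IsDensity u) (hv : IsDensity v) :
    Integrable (fun x => |m.conv u x - m.conv v x|) ∧
      ∫ x, |m.conv u x - m.conv v x| ≤ ∫ y, |u y - v y| := by
  obtain ⟨h1, h2⟩ := integral_abs_conv_le h (hu.int.sub hv.int)
  have e : m.conv (u - v) = fun x => m.conv u x - m.conv v x :=
    funext fun x => conv_sub_density h hu hv x
  rw [e] at h1 h2
  exact ⟨h1.abs, h2⟩

theorem abs_vel_sub_vel_le (h : m.Admissible N) (hb : m.DataBounds N M) (hk : k ∈ Finset.Icc 1 N)
    {u v : ℝ → ℝ} (hu : IsDensity u) (hv : IsDensity v) (x : ℝ) :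
    |m.vel k u x - m.vel k v x| ≤ M * (M * ∫ y, |u y - v y|) := by
  have hM := hb.nonneg
  refine (abs_ν_sub_le h hb hk x x (conv_mem h hu.meas hu.range x)
    (conv_mem h hv.meas hv.range x)).trans ?_
  rw [sub_self, abs_zero, zero_add]
  gcongr
  exact abs_conv_sub_density_le h hb hu hv x

theorem ae_differentiableAt_conv (h : m.Admissible N) (hb : m.DataBounds N M) {w : ℝ → ℝ}
    (hw : IsDensity w) : ∀ᵐ x, DifferentiableAt ℝ (m.conv w) x :=
  (lipschitzWith_conv h hb.nonneg hb.ω_sup hw.meas hw.abs_le_one).ae_differentiableAt_real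

/-- Comparison of the velocity gradients of two densities at two points, in terms of the nonlocal
terms and their gradients. -/
theorem abs_deriv_vel_sub_le (h : m.Admissible N) (hb : m.DataBounds N M)
    (hk : k ∈ Finset.Icc 1 N) {u v : ℝ → ℝ} (hu : IsDensity u) (hv : IsDensity v) {x y : ℝ}
    (hx : DifferentiableAt ℝ (m.conv u) x) (hy : DifferentiableAt ℝ (m.conv v) y) :
    |deriv (m.vel k u) x - deriv (m.vel k v) y|
      ≤ M * (1 + 2 * M) * (|x - y| + |m.conv u x - m.conv v y|)
        + M * |deriv (m.conv u) x - deriv (m.conv v) y| := by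
  have hM := hb.nonneg
  have mu := conv_mem h hu.meas hu.range
  have mv := conv_mem h hv.meas hv.range
  have e1 : deriv (m.vel k u) x = _ := (hasDerivAt_ν_comp h hb hk mu hx.hasDerivAt).deriv
  have e2 : deriv (m.vel k v) y = _ := (hasDerivAt_ν_comp h hb hk mv hy.hasDerivAt).deriv
  rw [e1, e2]
  have b1 := abs_D1_ν_sub_le h hb hk x y (mu x) (mv y)
  have b2 := abs_D2_ν_sub_le h hb hk x y (mu x) (mv y)
  have b3 := (hb.ν_deriv k hk y _ (mv y)).2.1
  have b4 := abs_deriv_conv_le h hM hb.ω_sup hu.meas hu.abs_le_one x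
  set p := deriv (m.conv u) x
  set q := deriv (m.conv v) y
  set A := m.conv u x
  set B := m.conv v y
  -- Product rule for differences: the gradient of the nonlocal term is kept only as a difference
  -- where it multiplies `D2`, and is bounded by 2M elsewhere.
  calc _ = |(D1 (m.ν k) x A - D1 (m.ν k) y B) + (D2 (m.ν k) x A - D2 (m.ν k) y B) * p
        + D2 (m.ν k) y B * (p - q)| := by congr 1; ring
    _ ≤ |D1 (m.ν k) x A - D1 (m.ν k) y B| + |D2 (m.ν k) x A - D2 (m.ν k) y B| * |p|
        + |D2 (m.ν k) y B| * |p - q| := by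
        rw [← abs_mul, ← abs_mul]; exact abs_add_three _ _ _
    _ ≤ M * (|x - y| + |A - B|) + M * (|x - y| + |A - B|) * (2 * M) + M * |p - q| := by
        gcongr
    _ = _ := by ring

/-- The nonlocal term is linear, so the gradient bound applies to the signed difference u - v, which
is still bounded by 1. -/
theorem integral_abs_deriv_conv_sub_le (h : m.Admissible N) (hb : m.DataBounds N M) {u v : ℝ → ℝ}
    (hu : IsDensity u) (hv : IsDensity v) :
    Integrable (fun x => |deriv (m.conv u) x - deriv (m.conv v) x|) ∧
      ∫ x, |deriv (m.conv u) x - deriv (m.conv v) x| ≤ 2 * M * ∫ x, |u x - v x| := by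
  obtain ⟨h1, h2⟩ := integral_abs_deriv_conv_le h hb.nonneg hb.ω_sup (hu.meas.sub hv.meas)
    (hu.abs_sub_le_one hv) (hu.int.sub hv.int)
  have e : m.conv (u - v) = fun x => m.conv u x - m.conv v x :=
    funext fun x => conv_sub_density h hu hv x
  have hae : (fun x => |deriv (m.conv (u - v)) x|)
      =ᵐ[volume] fun x => |deriv (m.conv u) x - deriv (m.conv v) x| := by
    filter_upwards [ae_differentiableAt_conv h hb hu, ae_differentiableAt_conv h hb hv]
      with x hx hy
    rw [e, deriv_fun_sub hx hy]
  refine ⟨h1.abs.congr hae, ?_⟩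
  rw [← integral_congr_ae hae]
  exact h2

/-- Stability of the velocity gradient with respect to the density. -/
theorem integral_abs_mul_deriv_vel_sub_le (h : m.Admissible N) (hb : m.DataBounds N M)
    (hk : k ∈ Finset.Icc 1 N) {u v : ℝ → ℝ} (hu : IsDensity u) (hv : IsDensity v)
    (hvM : ∫ x, |v x| ≤ M) :
    ∫ x, |v x| * |deriv (m.vel k v) x - deriv (m.vel k u) x|
      ≤ (M * (1 + 2 * M) * M * M + M * (2 * M)) * ∫ x, |u x - v x| := by
  have hM := hb.nonneg
  set n := ∫ x, |u x - v x| with hn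
  have hn0 : 0 ≤ n := integral_nonneg fun x => abs_nonneg _
  have hn' : ∫ x, |v x - u x| = n := by simp only [hn, abs_sub_comm]
  obtain ⟨i2, e2⟩ := integral_abs_deriv_conv_sub_le h hb hv hu
  rw [hn'] at e2
  obtain ⟨i, e⟩ := integrable_add_and_integral_le (hv.int.abs.mul_const (M * (1 + 2 * M) * (M * n)))
    (i2.const_mul M) ((integral_mul_const _ _).le.trans
      (mul_le_mul_of_nonneg_right hvM (by positivity)))
    ((integral_const_mul _ _).le.trans (mul_le_mul_of_nonneg_left e2 hM))
  refine (integral_mono_of_nonneg (Eventually.of_forall fun x => by positivity) i ?_).trans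
    (e.trans (le_of_eq (by ring)))
  filter_upwards [ae_differentiableAt_conv h hb hv, ae_differentiableAt_conv h hb hu] with x hx hy
  have b1 := abs_deriv_vel_sub_le h hb hk hv hu hx hy
  have b2 := abs_conv_sub_density_le h hb hv hu x
  rw [hn'] at b2
  rw [sub_self, abs_zero, zero_add] at b1
  -- The nonlocal terms are compared uniformly and are paired with the integrable weight |v|; their
  -- gradients are compared in `L¹` and use |v| ≤ 1.
  calc _ ≤ |v x| * (M * (1 + 2 * M) * (M * n)
          + M * |deriv (m.conv v) x - deriv (m.conv u) x|) := by
        gcongr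
        exact b1.trans (by gcongr)
    _ = |v x| * (M * (1 + 2 * M) * (M * n))
          + |v x| * (M * |deriv (m.conv v) x - deriv (m.conv u) x|) := by ring
    _ ≤ _ := add_le_add le_rfl (mul_le_of_le_one_left (by positivity) (hv.abs_le_one x))

/-- Translation modulus of the velocity gradient, weighted with a second density. -/
theorem integral_abs_mul_deriv_vel_translate_le (h : m.Admissible N) (hb : m.DataBounds N M)
    (hk : k ∈ Finset.Icc 1 N) {u v : ℝ → ℝ} (hu : IsDensity u) (hv : IsDensity v)
    (hvM : ∫ x, |v x| ≤ M) (huV : ∀ z, ∫ x, |u (x + z) - u x| ≤ M * |z|) (z : ℝ) :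
    ∫ x, |v x| * |deriv (m.vel k u) (x + z) - deriv (m.vel k u) x|
      ≤ (M * (1 + 2 * M) * (1 + 2 * M) * M + M * (2 * M) * M) * |z| := by
  have hM := hb.nonneg
  have huz := hu.translate z
  have hct : m.conv (fun x => u (x + z)) = fun x => m.conv u (x + z) :=
    funext fun x => conv_translate u z x
  -- The nonlocal term commutes with translations, so its gradient's modulus is the stability bound
  -- for `u` and its translate, and the variation of `u` yields the factor |z|.
  obtain ⟨i2, e2⟩ := integral_abs_deriv_conv_sub_le h hb huz hu
  rw [hct] at i2 e2
  simp only [deriv_comp_add_const] at i2 e2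
  have e2' := e2.trans (mul_le_mul_of_nonneg_left (huV z) (by positivity))
  obtain ⟨i, e⟩ := integrable_add_and_integral_le
    (hv.int.abs.mul_const (M * (1 + 2 * M) * ((1 + 2 * M) * |z|)))
    (i2.const_mul M) ((integral_mul_const _ _).le.trans
      (mul_le_mul_of_nonneg_right hvM (by positivity)))
    ((integral_const_mul _ _).le.trans (mul_le_mul_of_nonneg_left e2' hM))
  refine (integral_mono_of_nonneg (Eventually.of_forall fun x => by positivity) i ?_).trans
    (e.trans (le_of_eq (by ring)))
  have hdz : ∀ᵐ x, DifferentiableAt ℝ (m.conv u) (x + z) :=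
    (measurePreserving_add_right volume z).quasiMeasurePreserving.ae
      (ae_differentiableAt_conv h hb hu)
  filter_upwards [ae_differentiableAt_conv h hb hu, hdz] with x hx hy
  have b1 := abs_deriv_vel_sub_le h hb hk hu hu hy hx
  have b2 := abs_conv_sub_conv_le h hb hu (x + z) x
  rw [add_sub_cancel_left] at b1 b2
  calc _ ≤ |v x| * (M * (1 + 2 * M) * ((1 + 2 * M) * |z|)
          + M * |deriv (m.conv u) (x + z) - deriv (m.conv u) x|) := by
        gcongr
        refine b1.trans ?_
        gcongr
        linarith
    _ = |v x| * (M * (1 + 2 * M) * ((1 + 2 * M) * |z|))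
          + |v x| * (M * |deriv (m.conv u) (x + z) - deriv (m.conv u) x|) := by ring
    _ ≤ _ := add_le_add le_rfl (mul_le_of_le_one_left (by positivity) (hv.abs_le_one x))

end Model

end Multilane

/-! ### The lane changes -/

namespace Multilane

open Filter Topology
namespace Model

variable {m : Model} {N : ℕ} {M : ℝ} {k : ℕ}

/-- The rate of lane changes from lane `k` to lane `k + 1` for the densities `w`. -/
def exchange (m : Model) (N : ℕ) (w : ℕ → ℝ → ℝ) (k : ℕ) (x : ℝ) : ℝ :=
  m.S N k x (w k x) (w (k + 1) x) (m.conv (w k) x) (m.conv (w (k + 1)) x)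

/-- The net flow into lane `k` for the densities `w`. -/
def netFlow (m : Model) (N : ℕ) (w : ℕ → ℝ → ℝ) (k : ℕ) (x : ℝ) : ℝ :=
  m.exchange N w (k - 1) x - m.exchange N w k x

theorem source_eq_netFlow (u : ℕ → ℝ → ℝ → ℝ) (hk : k ∈ Finset.Icc 1 N) (t x : ℝ) :
    m.source N u k t x = m.netFlow N (fun j => u j t) k x := by
  -- Truncated subtraction is harmless since k ≥ 1; for k = 1 the incoming rate has index 0 and
  -- vanishes.
  have : k - 1 + 1 = k := Nat.sub_add_cancel (Finset.mem_Icc.1 hk).1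
  rw [source, netFlow, exchange, exchange, this]

theorem S_of_not {j : ℕ} (hj : ¬(1 ≤ j ∧ j < N)) (x a b A B : ℝ) : m.S N j x a b A B = 0 :=
  if_neg hj

theorem abs_exchange_sub_le (h : m.Admissible N) (hb : m.DataBounds N M) {w w' : ℕ → ℝ → ℝ}
    (hw : ∀ j, IsDensity (w j)) (hw' : ∀ j, IsDensity (w' j)) (j : ℕ) (x : ℝ) :
    |m.exchange N w j x - m.exchange N w' j x|
      ≤ M * (|w j x - w' j x| + |w (j + 1) x - w' (j + 1) x| + |m.conv (w j) x - m.conv (w' j) x|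
        + |m.conv (w (j + 1)) x - m.conv (w' (j + 1)) x|) := by
  by_cases hj : 1 ≤ j ∧ j < N
  · exact hb.S_lip j (Finset.mem_Icc.2 ⟨hj.1, hj.2.le⟩) x _ ((hw _).range x) _ ((hw _).range x)
      _ (conv_mem h (hw _).meas (hw _).range x) _ (conv_mem h (hw _).meas (hw _).range x)
      _ ((hw' _).range x) _ ((hw' _).range x)
      _ (conv_mem h (hw' _).meas (hw' _).range x) _ (conv_mem h (hw' _).meas (hw' _).range x)
  · have hM := hb.nonneg
    rw [exchange, exchange, S_of_not hj, S_of_not hj, sub_self, abs_zero]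
    positivity

theorem conv_zero (x : ℝ) : m.conv (fun _ => 0) x = 0 := by simp [conv]

theorem isDensity_zero : IsDensity (fun _ => 0) :=
  ⟨measurable_const, fun _ => ⟨le_rfl, zero_le_one⟩, integrable_zero _ _ _⟩

theorem S_zero (j : ℕ) (x A B : ℝ) : m.S N j x 0 0 A B = 0 := by
  unfold S; split_ifs <;> simp

theorem abs_exchange_le (h : m.Admissible N) (hb : m.DataBounds N M) {w : ℕ → ℝ → ℝ}
    (hw : ∀ j, IsDensity (w j)) (j : ℕ) (x : ℝ) :
    |m.exchange N w j x| ≤ M * (|w j x| + |w (j + 1) x| + |m.conv (w j) x|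
        + |m.conv (w (j + 1)) x|) := by
  -- The size of the exchange follows from its Lipschitz bound by comparison with empty lanes,
  -- between which nothing is exchanged.
  have := abs_exchange_sub_le h hb hw (w' := fun _ _ => 0) (fun _ => isDensity_zero) j x
  rw [show m.exchange N (fun _ _ => 0) j x = 0 from S_zero _ _ _ _] at this
  simpa [conv_zero] using this

theorem measurable_g (h : m.Admissible N) (hk : k ∈ Finset.Icc 1 N) : Measurable (m.g k) := by
  obtain ⟨L, hL⟩ := h.g_lip k hk
  exact hL.continuous.measurable

theorem measurable_f (h : m.Admissible N) (hk : k ∈ Finset.Icc 1 N) : Measurable (m.f k) :=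
  measurable_id.mul (measurable_g h hk)

theorem f_zero (k : ℕ) : m.f k 0 = 0 := by simp [f]

/-- Measurability of the velocities is asked only for the indices at which the rate is not
identically zero, since nothing is assumed about the other lanes. -/
theorem measurable_S {α : Type*} [MeasurableSpace α] (h : m.Admissible N) {X a b A B : α → ℝ}
    (j : ℕ) (ha : Measurable a) (hb : Measurable b)
    (hA : 1 ≤ j → j < N → Measurable fun q => m.ν j (X q) (A q))
    (hB : 1 ≤ j → j < N → Measurable fun q => m.ν (j + 1) (X q) (B q)) :
    Measurable fun q => m.S N j (X q) (a q) (b q) (A q) (B q) := by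
  by_cases hj : 1 ≤ j ∧ j < N
  · have h1 := (measurable_g h (Finset.mem_Icc.2 ⟨hj.1, hj.2.le⟩)).comp ha
    have h2 := (measurable_g h (k := j + 1) (Finset.mem_Icc.2 ⟨by omega, by omega⟩)).comp hb
    have h3 := (h2.mul (hB hj.1 hj.2)).sub (h1.mul (hA hj.1 hj.2))
    simp only [S, if_pos hj]
    exact ((h3.max measurable_const).mul ha).sub ((h3.min measurable_const).neg.mul hb)
  · simp only [S, if_neg hj]
    exact measurable_const

theorem continuous_vel (h : m.Admissible N) (hb : m.DataBounds N M) (hk : k ∈ Finset.Icc 1 N)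
    {w : ℝ → ℝ} (hw : IsDensity w) : Continuous (m.vel k w) := by
  have hM := hb.nonneg
  have hL : LipschitzWith (Real.toNNReal (M * (1 + 2 * M))) (m.vel k w) := by
    refine LipschitzWith.of_dist_le_mul fun x y => ?_
    rw [Real.coe_toNNReal _ (by positivity), Real.dist_eq, Real.dist_eq]
    exact abs_vel_sub_le h hb hk hw x y
  exact hL.continuous

theorem measurable_exchange (h : m.Admissible N) (hb : m.DataBounds N M) {w : ℕ → ℝ → ℝ}
    (hw : ∀ j, IsDensity (w j)) (j : ℕ) : Measurable (m.exchange N w j) :=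
  measurable_S h j (hw _).meas (hw _).meas
    (fun h1 h2 => (continuous_vel h hb (Finset.mem_Icc.2 ⟨h1, h2.le⟩) (hw j)).measurable)
    (fun h1 h2 => (continuous_vel h hb (Finset.mem_Icc.2 ⟨by omega, by omega⟩)
      (hw (j + 1))).measurable)

theorem integrable_exchange (h : m.Admissible N) (hb : m.DataBounds N M) {w : ℕ → ℝ → ℝ}
    (hw : ∀ j, IsDensity (w j)) (j : ℕ) : Integrable (m.exchange N w j) := by
  have hi := ((((hw j).int.abs.add (hw (j + 1)).int.abs).add
    (integral_abs_conv_le h (hw j).int).1.abs).add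
      (integral_abs_conv_le h (hw (j + 1)).int).1.abs).const_mul M
  exact hi.mono' (measurable_exchange h hb hw j).aestronglyMeasurable
    (Eventually.of_forall fun x => abs_exchange_le h hb hw j x)

/-- The unit-mass kernel contracts `L¹`, so the nonlocal arguments cost no more than the densities
themselves; this doubles the constant. -/
theorem integral_abs_exchange_sub_le (h : m.Admissible N) (hb : m.DataBounds N M)
    {w w' : ℕ → ℝ → ℝ} (hw : ∀ j, IsDensity (w j)) (hw' : ∀ j, IsDensity (w' j)) (j : ℕ) :
    ∫ x, |m.exchange N w j x - m.exchange N w' j x|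
      ≤ 2 * M * ((∫ x, |w j x - w' j x|) + ∫ x, |w (j + 1) x - w' (j + 1) x|) := by
  have hM := hb.nonneg
  have d : ∀ i, Integrable fun x => |w i x - w' i x| := fun i => ((hw i).int.sub (hw' i).int).abs
  have c := fun i => integral_abs_conv_sub_density_le h (hw i) (hw' i)
  obtain ⟨i1, e1⟩ := integrable_add_and_integral_le (d j) (d (j + 1)) le_rfl le_rfl
  obtain ⟨i2, e2⟩ := integrable_add_and_integral_le i1 (c j).1 e1 (c j).2
  obtain ⟨i3, e3⟩ := integrable_add_and_integral_le i2 (c (j + 1)).1 e2 (c (j + 1)).2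
  have := integral_mono ((integrable_exchange h hb hw j).sub (integrable_exchange h hb hw' j)).abs
    (i3.const_mul M) (abs_exchange_sub_le h hb hw hw' j)
  rw [integral_const_mul] at this
  refine this.trans ((mul_le_mul_of_nonneg_left e3 hM).trans (le_of_eq ?_))
  ring

theorem integral_abs_exchange_sub_le_sum (h : m.Admissible N) (hb : m.DataBounds N M)
    {w w' : ℕ → ℝ → ℝ} (hw : ∀ j, IsDensity (w j)) (hw' : ∀ j, IsDensity (w' j)) (j : ℕ) :
    ∫ x, |m.exchange N w j x - m.exchange N w' j x|
      ≤ 4 * M * ∑ i ∈ Finset.Icc 1 N, ∫ x, |w i x - w' i x| := by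
  have hM := hb.nonneg
  have hn : ∀ i ∈ Finset.Icc 1 N, 0 ≤ ∫ x, |w i x - w' i x| := fun i _ =>
    integral_nonneg fun x => abs_nonneg _
  by_cases hj : 1 ≤ j ∧ j < N
  · have h1 := Finset.single_le_sum hn (Finset.mem_Icc.2 ⟨hj.1, hj.2.le⟩)
    have h2 := Finset.single_le_sum hn (show j + 1 ∈ Finset.Icc 1 N from
      Finset.mem_Icc.2 ⟨by omega, by omega⟩)
    refine (integral_abs_exchange_sub_le h hb hw hw' j).trans ?_
    nlinarith
  · simp only [exchange, S_of_not hj, sub_self, abs_zero, integral_zero]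
    have := Finset.sum_nonneg hn
    positivity

theorem netFlow_stability (h : m.Admissible N) (hb : m.DataBounds N M)
    {w w' : ℕ → ℝ → ℝ} (hw : ∀ j, IsDensity (w j)) (hw' : ∀ j, IsDensity (w' j)) (k : ℕ) :
    ∫ x, |m.netFlow N w k x - m.netFlow N w' k x|
      ≤ 8 * M * ∑ i ∈ Finset.Icc 1 N, ∫ x, |w i x - w' i x| := by
  have I := fun j => ((integrable_exchange h hb hw j).sub (integrable_exchange h hb hw' j)).abs
  obtain ⟨i, e⟩ := integrable_add_and_integral_le (I (k - 1)) (I k)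
    (integral_abs_exchange_sub_le_sum h hb hw hw' _) (integral_abs_exchange_sub_le_sum h hb hw hw' _)
  refine (integral_mono_of_nonneg (Eventually.of_forall fun x => abs_nonneg _) i
    (Eventually.of_forall fun x => ?_)).trans (e.trans (le_of_eq (by ring)))
  simp only [netFlow, Pi.sub_apply]
  rw [show ∀ a b c d : ℝ, a - b - (c - d) = (a - c) - (b - d) by intros; ring]
  exact abs_sub _ _

theorem integrable_netFlow (h : m.Admissible N) (hb : m.DataBounds N M) {w : ℕ → ℝ → ℝ}
    (hw : ∀ j, IsDensity (w j)) (k : ℕ) : Integrable (m.netFlow N w k) :=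
  (integrable_exchange h hb hw _).sub (integrable_exchange h hb hw _)

theorem integral_abs_exchange_le (h : m.Admissible N) (hb : m.DataBounds N M) {w : ℕ → ℝ → ℝ}
    (hw : ∀ j, IsDensity (w j)) {C : ℝ} (hC : ∀ j, ∫ x, |w j x| ≤ C) (j : ℕ) :
    ∫ x, |m.exchange N w j x| ≤ 4 * M * C := by
  have hM := hb.nonneg
  have := integral_abs_exchange_sub_le h hb hw (w' := fun _ _ => 0) (fun _ => isDensity_zero) j
  rw [show m.exchange N (fun _ _ => 0) j = fun _ => 0 from funext fun x => S_zero _ _ _ _] at this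
  simp only [sub_zero] at this
  refine this.trans ?_
  have h1 := hC j
  have h2 := hC (j + 1)
  nlinarith

theorem integral_abs_netFlow_le (h : m.Admissible N) (hb : m.DataBounds N M) {w : ℕ → ℝ → ℝ}
    (hw : ∀ j, IsDensity (w j)) {C : ℝ} (hC : ∀ j, ∫ x, |w j x| ≤ C) (k : ℕ) :
    ∫ x, |m.netFlow N w k x| ≤ 8 * M * C := by
  have I := fun j => (integrable_exchange h hb hw j).abs
  obtain ⟨i, e⟩ := integrable_add_and_integral_le (I (k - 1)) (I k)
    (integral_abs_exchange_le h hb hw hC _) (integral_abs_exchange_le h hb hw hC _)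
  exact (integral_mono_of_nonneg (Eventually.of_forall fun x => abs_nonneg _) i
    (Eventually.of_forall fun x => abs_sub _ _)).trans (e.trans (le_of_eq (by ring)))

theorem abs_netFlow_le (h : m.Admissible N) (hb : m.DataBounds N M) {w : ℕ → ℝ → ℝ}
    (hw : ∀ j, IsDensity (w j)) (k : ℕ) (x : ℝ) : |m.netFlow N w k x| ≤ 8 * M := by
  have hM := hb.nonneg
  have key : ∀ j, |m.exchange N w j x| ≤ 4 * M := by
    intro j
    have hc : ∀ i, |m.conv (w i) x| ≤ 1 := fun i => by
      have := conv_mem h (hw i).meas (hw i).range x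
      exact abs_le.2 ⟨by linarith [this.1], this.2⟩
    refine (abs_exchange_le h hb hw j x).trans ?_
    have h1 := (hw j).abs_le_one x
    have h2 := (hw (j + 1)).abs_le_one x
    have h3 := hc j
    have h4 := hc (j + 1)
    nlinarith
  refine (abs_sub _ _).trans ?_
  linarith [key (k - 1), key k]

/-- The zero at maximal density turns the Lipschitz bound into a sup bound on [0, 1]. The constant
belongs to the model and is not controlled by `M`. -/
theorem exists_g_bound (h : m.Admissible N) :
    ∃ G : ℝ, 0 ≤ G ∧ ∀ k ∈ Finset.Icc 1 N, (∀ a b, |m.g k a - m.g k b| ≤ G * |a - b|) ∧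
      ∀ a ∈ Icc (0 : ℝ) 1, |m.g k a| ≤ G := by
  choose! L hL using h.g_lip
  refine ⟨∑ k ∈ Finset.Icc 1 N, (L k : ℝ), Finset.sum_nonneg fun k _ => (L k).2, fun k hk => ?_⟩
  have hle : (L k : ℝ) ≤ ∑ k ∈ Finset.Icc 1 N, (L k : ℝ) :=
    Finset.single_le_sum (f := fun k => (L k : ℝ)) (fun i _ => (L i).2) hk
  have hlip : ∀ a b, |m.g k a - m.g k b| ≤ L k * |a - b| := fun a b => by
    simpa [Real.dist_eq] using (hL k hk).dist_le_mul a b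
  refine ⟨fun a b => (hlip a b).trans (by gcongr), fun a ha => ?_⟩
  have := hlip a 1
  rw [h.g_one k hk, sub_zero] at this
  have h1 : |a - 1| ≤ 1 := abs_le.2 ⟨by linarith [ha.1], by linarith [ha.2]⟩
  exact this.trans ((mul_le_of_le_one_right (L k).2 h1).trans hle)

/-- Dependence of the exchange rate on the position. -/
theorem abs_S_sub_le (h : m.Admissible N) (hb : m.DataBounds N M) {G : ℝ}
    (hG : ∀ k ∈ Finset.Icc 1 N, ∀ a ∈ Icc (0 : ℝ) 1, |m.g k a| ≤ G) (hG0 : 0 ≤ G) (j : ℕ)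
    (x y : ℝ) {a b A B : ℝ} (ha : a ∈ Icc (0 : ℝ) 1) (hb' : b ∈ Icc (0 : ℝ) 1)
    (hA : A ∈ Icc (0 : ℝ) 1) (hB : B ∈ Icc (0 : ℝ) 1) :
    |m.S N j x a b A B - m.S N j y a b A B| ≤ 2 * G * M * |x - y| * (|a| + |b|) := by
  have hM := hb.nonneg
  by_cases hj : 1 ≤ j ∧ j < N
  · have hj1 : j ∈ Finset.Icc 1 N := Finset.mem_Icc.2 ⟨hj.1, hj.2.le⟩
    have hj2 : j + 1 ∈ Finset.Icc 1 N := Finset.mem_Icc.2 ⟨by omega, by omega⟩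
    have n1 := abs_ν_sub_le h hb hj1 x y hA hA
    have n2 := abs_ν_sub_le h hb hj2 x y hB hB
    rw [sub_self, abs_zero, add_zero] at n1 n2
    simp only [S, if_pos hj]
    set P := m.g (j + 1) b * m.ν (j + 1) x B - m.g j a * m.ν j x A with hP
    set Q := m.g (j + 1) b * m.ν (j + 1) y B - m.g j a * m.ν j y A with hQ
    have hPQ : |P - Q| ≤ 2 * G * M * |x - y| := by
      have : P - Q = m.g (j + 1) b * (m.ν (j + 1) x B - m.ν (j + 1) y B)
          - m.g j a * (m.ν j x A - m.ν j y A) := by rw [hP, hQ]; ring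
      rw [this]
      refine (abs_sub _ _).trans ?_
      rw [abs_mul, abs_mul]
      calc _ ≤ G * (M * |x - y|) + G * (M * |x - y|) := by
            gcongr
            · exact hG _ hj2 b hb'
            · exact hG _ hj1 a ha
        _ = _ := by ring
    have h1 : |max P 0 - max Q 0| ≤ |P - Q| := by
      simpa using abs_max_sub_max_le_max P 0 Q 0
    have h2 : |min P 0 - min Q 0| ≤ |P - Q| := by
      simpa using abs_min_sub_min_le_max P 0 Q 0
    -- The factors a and b are kept, as they make the bound integrable over the whole line.
    calc _ = |(max P 0 - max Q 0) * a + (min P 0 - min Q 0) * b| := by congr 1; ring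
      _ ≤ |max P 0 - max Q 0| * |a| + |min P 0 - min Q 0| * |b| := by
          rw [← abs_mul, ← abs_mul]; exact abs_add_le _ _
      _ ≤ (2 * G * M * |x - y|) * |a| + (2 * G * M * |x - y|) * |b| := by
          gcongr
          · exact h1.trans hPQ
          · exact h2.trans hPQ
      _ = _ := by ring
  · rw [S_of_not hj, S_of_not hj, sub_self, abs_zero]
    positivity

/-- A shift acts on the densities and on the explicit position. The first effect is the stability of
the exchange for shifted densities at a frozen position, the second is `abs_S_sub_le`. -/
theorem integral_abs_exchange_translate_le (h : m.Admissible N) (hb : m.DataBounds N M)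
    {G C V : ℝ} (hG : ∀ k ∈ Finset.Icc 1 N, ∀ a ∈ Icc (0 : ℝ) 1, |m.g k a| ≤ G) (hG0 : 0 ≤ G)
    {w : ℕ → ℝ → ℝ} (hw : ∀ j, IsDensity (w j)) (hC : ∀ j, ∫ x, |w j x| ≤ C)
    (hV : ∀ j z, ∫ x, |w j (x + z) - w j x| ≤ V * |z|) (j : ℕ) (z : ℝ) :
    ∫ x, |m.exchange N w j (x + z) - m.exchange N w j x|
      ≤ (4 * G * M * C + 4 * M * V) * |z| := by
  have hM := hb.nonneg
  have hwz : ∀ i, IsDensity fun x => w i (x + z) := fun i => (hw i).translate z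
  have hct : ∀ i, m.conv (fun x => w i (x + z)) = fun x => m.conv (w i) (x + z) :=
    fun i => funext fun x => conv_translate (w i) z x
  have e1 := integral_abs_exchange_sub_le h hb hwz hw j
  have i1 := ((integrable_exchange h hb hwz j).sub (integrable_exchange h hb hw j)).abs
  have i2 := ((hwz j).int.abs.add (hwz (j + 1)).int.abs).const_mul (2 * G * M * |z|)
  have b2 : ∫ x, 2 * G * M * |z| * (|w j (x + z)| + |w (j + 1) (x + z)|)
      ≤ 2 * G * M * |z| * (C + C) := by
    rw [integral_const_mul, integral_add (hwz j).int.abs (hwz (j + 1)).int.abs,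
      integral_add_right_eq_self (fun x => |w j x|),
      integral_add_right_eq_self (fun x => |w (j + 1) x|)]
    gcongr
    · exact hC j
    · exact hC (j + 1)
  obtain ⟨i, e⟩ := integrable_add_and_integral_le i1 i2 e1 b2
  refine (integral_mono_of_nonneg (Eventually.of_forall fun x => abs_nonneg _) i
    (Eventually.of_forall fun x => ?_)).trans (e.trans ?_)
  · have s := abs_S_sub_le h hb hG hG0 j (x + z) x ((hwz j).range x) ((hwz (j + 1)).range x)
      (conv_mem h (hw j).meas (hw j).range (x + z))
      (conv_mem h (hw (j + 1)).meas (hw (j + 1)).range (x + z))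
    rw [add_sub_cancel_left] at s
    simp only [exchange, hct, Pi.sub_apply, Pi.add_apply] at s ⊢
    refine (abs_sub_le _ (m.S N j x (w j (x + z)) (w (j + 1) (x + z)) (m.conv (w j) (x + z))
      (m.conv (w (j + 1)) (x + z))) _).trans ?_
    rw [add_comm]
    exact add_le_add le_rfl s
  · have v1 := hV j z
    have v2 := hV (j + 1) z
    calc _ ≤ 2 * M * (V * |z| + V * |z|) + 2 * G * M * |z| * (C + C) := by gcongr
      _ = _ := by ring

theorem integral_abs_netFlow_translate_le (h : m.Admissible N) (hb : m.DataBounds N M)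
    {G C V : ℝ} (hG : ∀ k ∈ Finset.Icc 1 N, ∀ a ∈ Icc (0 : ℝ) 1, |m.g k a| ≤ G) (hG0 : 0 ≤ G)
    {w : ℕ → ℝ → ℝ} (hw : ∀ j, IsDensity (w j)) (hC : ∀ j, ∫ x, |w j x| ≤ C)
    (hV : ∀ j z, ∫ x, |w j (x + z) - w j x| ≤ V * |z|) (k : ℕ) (z : ℝ) :
    ∫ x, |m.netFlow N w k (x + z) - m.netFlow N w k x|
      ≤ (8 * G * M * C + 8 * M * V) * |z| := by
  have I := fun j => (((integrable_exchange h hb hw j).comp_add_right z).sub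
    (integrable_exchange h hb hw j)).abs
  have b := fun j => integral_abs_exchange_translate_le h hb hG hG0 hw hC hV j z
  obtain ⟨i, e⟩ := integrable_add_and_integral_le (I (k - 1)) (I k) (b (k - 1)) (b k)
  refine (integral_mono_of_nonneg (Eventually.of_forall fun x => abs_nonneg _) i
    (Eventually.of_forall fun x => ?_)).trans (e.trans (le_of_eq (by ring)))
  simp only [netFlow, Pi.sub_apply]
  rw [show ∀ a b c d : ℝ, a - b - (c - d) = (a - c) - (b - d) by intros; ring]
  exact abs_sub _ _

end Model

end Multilane

/-! ### Integration in time of the entropy inequality -/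

namespace Multilane

open Filter Topology

/-- Slicewise almost everywhere equality on a strip implies almost everywhere equality. -/
theorem ae_strip_of_slices {T : ℝ} {u w : ℝ → ℝ → ℝ}
    (hu : AEStronglyMeasurable (fun p : ℝ × ℝ => u p.1 p.2) (volume.restrict (Icc 0 T ×ˢ univ)))
    (hw : AEStronglyMeasurable (fun p : ℝ × ℝ => w p.1 p.2) (volume.restrict (Icc 0 T ×ˢ univ)))
    (h : ∀ t ∈ Icc 0 T, w t =ᵐ[volume] u t) :
    ∀ᵐ p : ℝ × ℝ ∂(volume.restrict (Icc 0 T ×ˢ univ)), w p.1 p.2 = u p.1 p.2 := by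
  have hR : (volume.restrict (Icc 0 T ×ˢ univ) : Measure (ℝ × ℝ))
      = (volume.restrict (Icc 0 T)).prod volume := by
    rw [Measure.volume_eq_prod, ← Measure.prod_restrict, Measure.restrict_univ]
  rw [hR] at hu hw ⊢
  have hg := hu.ae_eq_mk
  have hg' := hw.ae_eq_mk
  set g := hu.mk with hgd
  set g' := hw.mk with hgd'
  -- Fubini's theorem for null sets needs a measurable set, so the slices are compared through
  -- strongly measurable modifications.
  have hms : MeasurableSet {p : ℝ × ℝ | g' p = g p} :=
    measurableSet_eq_fun hw.stronglyMeasurable_mk.measurable hu.stronglyMeasurable_mk.measurable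
  have key : ∀ᵐ p ∂((volume.restrict (Icc 0 T)).prod (volume : Measure ℝ)), g' p = g p := by
    rw [Measure.ae_prod_iff_ae_ae hms]
    filter_upwards [Measure.ae_ae_of_ae_prod hg, Measure.ae_ae_of_ae_prod hg',
      ae_restrict_mem measurableSet_Icc] with t h1 h1' h2
    filter_upwards [h1, h1', h t h2] with x h3 h3' h4
    rw [← h3, ← h3', h4]
  filter_upwards [key, hg, hg'] with p h1 h2 h3
  rw [h3, h1, ← h2]

theorem integrableOn_strip {T C : ℝ} {c : ℝ × ℝ → ℝ} (hc : Measurable c) (hC : ∀ p, |c p| ≤ C)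
    {χ k : ℝ → ℝ} (hχ : Integrable χ) (hk : Integrable k) :
    IntegrableOn (fun p : ℝ × ℝ => c p * (χ p.1 * k p.2)) (Ioo 0 T ×ˢ univ) := by
  have h1 := hχ.mul_prod hk
  rw [← Measure.volume_eq_prod] at h1
  exact (h1.bdd_mul hc.aestronglyMeasurable (Eventually.of_forall hC)).integrableOn

theorem isTestFunction_mul {T : ℝ} {χ ψ : ℝ → ℝ} (hχ : ContDiff ℝ (⊤ : ℕ∞) χ)
    (hχ0 : ∀ t, 0 ≤ χ t) (hχc : HasCompactSupport χ) (hχs : tsupport χ ⊆ Ioo 0 T)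
    (hψ : ContDiff ℝ (⊤ : ℕ∞) ψ) (hψc : HasCompactSupport ψ) (hψ0 : ∀ x, 0 ≤ ψ x) :
    IsTestFunction T fun t x => χ t * ψ x := by
  have hsub : Function.support (fun p : ℝ × ℝ => χ p.1 * ψ p.2) ⊆ tsupport χ ×ˢ tsupport ψ := by
    intro p hp
    exact ⟨subset_tsupport _ (left_ne_zero_of_mul hp), subset_tsupport _ (right_ne_zero_of_mul hp)⟩
  have hcpt : IsCompact (tsupport χ ×ˢ tsupport ψ) := hχc.isCompact.prod hψc.isCompact
  refine ⟨(hχ.comp contDiff_fst).mul (hψ.comp contDiff_snd),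
    HasCompactSupport.of_support_subset_isCompact hcpt hsub, ?_,
    fun t _ x => mul_nonneg (hχ0 t) (hψ0 x)⟩
  refine (closure_minimal hsub hcpt.isClosed).trans (prod_mono ?_ (subset_univ _))
  exact fun t ht => (hχs ht).2

/-- The Kruzhkov inequality integrated in time from its distributional form for products of test
functions in time and space. -/
theorem integrated_of_distributional {f : ℝ → ℝ} {T B M α : ℝ} {u U D R : ℝ → ℝ → ℝ}
    (hfm : Measurable f) (hM : 0 ≤ M)
    (hf : ∀ a ∈ Icc (0 : ℝ) 1, ∀ b ∈ Icc (0 : ℝ) 1, |f a - f b| ≤ M * |a - b|) (hf0 : f 0 = 0)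
    (hα : α ∈ Icc (0 : ℝ) 1)
    (um : Measurable (fun p : ℝ × ℝ => u p.1 p.2)) (Um : Measurable (fun p : ℝ × ℝ => U p.1 p.2))
    (Dm : Measurable (fun p : ℝ × ℝ => D p.1 p.2)) (Rm : Measurable (fun p : ℝ × ℝ => R p.1 p.2))
    (ur : ∀ t x, u t x ∈ Icc (0 : ℝ) 1) (ui : ∀ t, Integrable (u t))
    (ul : ∀ s t, ∫ x, |u s x - u t x| ≤ B * |s - t|)
    (Ub : ∀ t x, |U t x| ≤ B) (Db : ∀ t x, |D t x| ≤ B) (Rb : ∀ t x, |R t x| ≤ B)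
    {ψ : ℝ → ℝ} (hψ : ContDiff ℝ (⊤ : ℕ∞) ψ) (hψc : HasCompactSupport ψ) (hψ0 : ∀ x, 0 ≤ ψ x)
    (h : ∀ χ : ℝ → ℝ, ContDiff ℝ (⊤ : ℕ∞) χ → (∀ t, 0 ≤ χ t) → HasCompactSupport χ →
      tsupport χ ⊆ Ioo 0 T →
      (∫ p in Ioo 0 T ×ˢ univ, |u p.1 p.2 - α| * (deriv χ p.1 * ψ p.2))
        + (∫ p in Ioo 0 T ×ˢ univ, entropyFlux f (u p.1 p.2) α * U p.1 p.2
            * (χ p.1 * deriv ψ p.2))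
        - (∫ p in Ioo 0 T ×ˢ univ, Real.sign (u p.1 p.2 - α) * f α * D p.1 p.2 * (χ p.1 * ψ p.2))
      ≥ -∫ p in Ioo 0 T ×ˢ univ, Real.sign (u p.1 p.2 - α) * R p.1 p.2 * (χ p.1 * ψ p.2))
    {t₁ t₂ : ℝ} (h1 : 0 < t₁) (h12 : t₁ ≤ t₂) (h2 : t₂ < T) :
    (∫ x, |u t₂ x - α| * ψ x) - (∫ x, |u t₁ x - α| * ψ x)
      ≤ ∫ τ in t₁..t₂, ∫ x, entropyDensity f (u τ x) α (U τ x) (D τ x) (R τ x)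
        (deriv ψ x) (ψ x) := by
  have hB : 0 ≤ B := (abs_nonneg _).trans (Ub 0 0)
  have hψ'c : Continuous (deriv ψ) := hψ.continuous_deriv (by simp)
  have hψ'i : Integrable (deriv ψ) := hψ'c.integrable_of_hasCompactSupport hψc.deriv
  have hψi : Integrable ψ := hψ.continuous.integrable_of_hasCompactSupport hψc
  obtain ⟨Cψ, hCψ⟩ := hψ.continuous.bounded_above_of_compact_support hψc
  have hCψ0 : 0 ≤ Cψ := (norm_nonneg _).trans (hCψ 0)
  have hua : ∀ t x, |u t x - α| ≤ 1 := fun t x =>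
    abs_le.2 ⟨by linarith [(ur t x).1, hα.2], by linarith [(ur t x).2, hα.1]⟩
  have um' : Measurable (fun p : ℝ × ℝ => |u p.1 p.2 - α|) := (um.sub_const α).abs
  have hpi : ∀ t, Integrable fun x => |u t x - α| * ψ x := fun t =>
    hψi.bdd_mul (um'.comp measurable_prodMk_left).aestronglyMeasurable
      (Eventually.of_forall fun x => by simpa using hua t x)
  have hpl : ∀ s t, (∫ x, |u s x - α| * ψ x) - (∫ x, |u t x - α| * ψ x)
      ≤ Cψ * B * |s - t| := by
    intro s t
    have hd : Integrable fun x => Cψ * |u s x - u t x| := ((ui s).sub (ui t)).abs.const_mul Cψ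
    rw [← integral_sub (hpi s) (hpi t)]
    refine (integral_mono ((hpi s).sub (hpi t)) hd fun x => ?_).trans ?_
    · simp only [Pi.sub_apply]
      rw [← sub_mul, mul_comm Cψ]
      have a1 : |u s x - α| - |u t x - α| ≤ |u s x - u t x| := by
        have := abs_sub_abs_le_abs_sub (u s x - α) (u t x - α)
        rwa [sub_sub_sub_cancel_right] at this
      have a2 : ψ x ≤ Cψ := (le_abs_self _).trans (hCψ x)
      exact mul_le_mul a1 a2 (hψ0 x) (abs_nonneg _)
    · rw [integral_const_mul, mul_assoc]
      exact mul_le_mul_of_nonneg_left (ul s t) hCψ0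
  -- Lipschitz continuity in time upgrades the distributional inequality to one valid for every pair
  -- of times.
  have hp : LipschitzWith (Real.toNNReal (Cψ * B)) (fun t => ∫ x, |u t x - α| * ψ x) := by
    refine LipschitzWith.of_dist_le_mul fun s t => ?_
    rw [Real.coe_toNNReal _ (by positivity), Real.dist_eq, Real.dist_eq, abs_le]
    have b1 := hpl s t
    have b2 := hpl t s
    rw [abs_sub_comm] at b2
    constructor <;> linarith
  have hgm : Measurable (fun p : ℝ × ℝ => entropyDensity f (u p.1 p.2) α (U p.1 p.2) (D p.1 p.2)
      (R p.1 p.2) (deriv ψ p.2) (ψ p.2)) :=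
    measurable_entropyDensity hfm um measurable_const Um Dm Rm
      (hψ'c.measurable.comp measurable_snd) (hψ.continuous.measurable.comp measurable_snd)
  have hgb : ∀ t x, |entropyDensity f (u t x) α (U t x) (D t x) (R t x) (deriv ψ x) (ψ x)|
      ≤ M * B * 2 * |deriv ψ x| + (M * B + B) * ψ x := by
    intro t x
    refine (abs_entropyDensity_le hM hf hf0 (ur t x) hα (Ub t x) (Db t x) (hψ0 x)).trans ?_
    have c1 : |u t x| ≤ 1 := abs_le.2 ⟨by linarith [(ur t x).1], (ur t x).2⟩
    have c2 : |α| ≤ 1 := abs_le.2 ⟨by linarith [hα.1], hα.2⟩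
    have c3 := Rb t x
    have hψx := hψ0 x
    calc _ ≤ M * B * (1 * |deriv ψ x| + 1 * |deriv ψ x|) + M * B * (1 * ψ x) + B * ψ x := by
          gcongr
      _ = _ := by ring
  have hgdom : Integrable fun x => M * B * 2 * |deriv ψ x| + (M * B + B) * ψ x :=
    (hψ'i.abs.const_mul _).add (hψi.const_mul _)
  have hgi : ∀ t, Integrable fun x => entropyDensity f (u t x) α (U t x) (D t x) (R t x)
      (deriv ψ x) (ψ x) := fun t =>
    hgdom.mono' (hgm.comp measurable_prodMk_left).aestronglyMeasurable
      (Eventually.of_forall (hgb t))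
  refine sub_le_integral_of_distributional (T := T)
    (B := ∫ x, (M * B * 2 * |deriv ψ x| + (M * B + B) * ψ x)) hp
    (q := fun τ => ∫ x, entropyDensity f (u τ x) α (U τ x) (D τ x) (R τ x) (deriv ψ x) (ψ x))
    (hgm.stronglyMeasurable.integral_prod_right').measurable
    (fun t => abs_integral_le_integral_abs.trans (integral_mono (hgi t).abs hgdom (hgb t)))
    (fun χ hχ hχ0 hχc hχs => ?_) h1 h12 h2
  have key := h χ hχ hχ0 hχc hχs
  have hχi : Integrable χ := hχ.continuous.integrable_of_hasCompactSupport hχc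
  have hχ'i : Integrable (deriv χ) :=
    (hχ.continuous_deriv (by simp)).integrable_of_hasCompactSupport hχc.deriv
  have sm : Measurable (fun p : ℝ × ℝ => Real.sign (u p.1 p.2 - α)) :=
    measurable_sign.comp (um.sub_const α)
  have fα : |f α| ≤ M := by
    have := hf α hα 0 ⟨le_rfl, zero_le_one⟩
    rw [hf0, sub_zero, sub_zero, abs_of_nonneg hα.1] at this
    nlinarith [hα.2]
  have I1 := integrableOn_strip (T := T) (C := 1) um'
    (fun p => by rw [abs_abs]; exact hua p.1 p.2) hχ'i hψi
  have I2 := integrableOn_strip (T := T) (C := M * B)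
    (c := fun p : ℝ × ℝ => entropyFlux f (u p.1 p.2) α * U p.1 p.2)
    ((sm.mul ((hfm.comp um).sub_const _)).mul Um) (fun p => by
      rw [abs_mul]
      refine mul_le_mul ?_ (Ub _ _) (abs_nonneg _) hM
      refine (abs_entropyFlux_le hf (ur _ _) hα).trans ?_
      exact mul_le_of_le_one_right hM (hua _ _)) hχi hψ'i
  have I3 := integrableOn_strip (T := T) (C := 1 * M * B)
    (c := fun p : ℝ × ℝ => Real.sign (u p.1 p.2 - α) * f α * D p.1 p.2)
    ((sm.mul_const _).mul Dm) (fun p => by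
      rw [abs_mul, abs_mul]
      have := abs_sign_le_one (u p.1 p.2 - α)
      have := Db p.1 p.2
      gcongr) hχi hψi
  have I4 := integrableOn_strip (T := T) (C := 1 * B)
    (c := fun p : ℝ × ℝ => Real.sign (u p.1 p.2 - α) * R p.1 p.2)
    (sm.mul Rm) (fun p => by
      rw [abs_mul]
      have := abs_sign_le_one (u p.1 p.2 - α)
      have := Rb p.1 p.2
      gcongr) hχi hψi
  have hT : 0 ≤ T := by linarith
  have hsum : IntegrableOn (fun p : ℝ × ℝ => |u p.1 p.2 - α| * (deriv χ p.1 * ψ p.2)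
      + entropyFlux f (u p.1 p.2) α * U p.1 p.2 * (χ p.1 * deriv ψ p.2)
      - Real.sign (u p.1 p.2 - α) * f α * D p.1 p.2 * (χ p.1 * ψ p.2)
      + Real.sign (u p.1 p.2 - α) * R p.1 p.2 * (χ p.1 * ψ p.2)) (Ioo 0 T ×ˢ univ) :=
    ((I1.add I2).sub I3).add I4
  have e1 : ∫ p in Ioo 0 T ×ˢ univ, (|u p.1 p.2 - α| * (deriv χ p.1 * ψ p.2)
      + entropyFlux f (u p.1 p.2) α * U p.1 p.2 * (χ p.1 * deriv ψ p.2)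
      - Real.sign (u p.1 p.2 - α) * f α * D p.1 p.2 * (χ p.1 * ψ p.2)
      + Real.sign (u p.1 p.2 - α) * R p.1 p.2 * (χ p.1 * ψ p.2))
      = _ := (integral_add ((I1.add I2).sub I3) I4).trans
        (congrArg (· + _) ((integral_sub (I1.add I2) I3).trans
          (congrArg (· - _) (integral_add I1 I2))))
  have e2 := setIntegral_prod (μ := (volume : Measure ℝ)) (ν := (volume : Measure ℝ))
    (fun p : ℝ × ℝ => |u p.1 p.2 - α| * (deriv χ p.1 * ψ p.2)
      + entropyFlux f (u p.1 p.2) α * U p.1 p.2 * (χ p.1 * deriv ψ p.2)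
      - Real.sign (u p.1 p.2 - α) * f α * D p.1 p.2 * (χ p.1 * ψ p.2)
      + Real.sign (u p.1 p.2 - α) * R p.1 p.2 * (χ p.1 * ψ p.2)) (s := Ioo 0 T) (t := univ)
    (by rwa [← Measure.volume_eq_prod])
  rw [← Measure.volume_eq_prod] at e2
  -- Fubini's theorem on the strip: for a product test function the four integrals of the entropy
  -- inequality collapse to the weak form of p' ≤ q.
  have e3 : ∫ t in (0 : ℝ)..T, ((∫ x, |u t x - α| * ψ x) * deriv χ t
      + (∫ x, entropyDensity f (u t x) α (U t x) (D t x) (R t x) (deriv ψ x) (ψ x)) * χ t)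
      = ∫ p in Ioo 0 T ×ˢ univ, (|u p.1 p.2 - α| * (deriv χ p.1 * ψ p.2)
      + entropyFlux f (u p.1 p.2) α * U p.1 p.2 * (χ p.1 * deriv ψ p.2)
      - Real.sign (u p.1 p.2 - α) * f α * D p.1 p.2 * (χ p.1 * ψ p.2)
      + Real.sign (u p.1 p.2 - α) * R p.1 p.2 * (χ p.1 * ψ p.2)) := by
    rw [e2, intervalIntegral.integral_of_le hT, integral_Ioc_eq_integral_Ioo]
    refine integral_congr_ae (Eventually.of_forall fun t => ?_)
    simp only [Measure.restrict_univ]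
    rw [← integral_mul_const, ← integral_mul_const,
      ← integral_add ((hpi t).mul_const _) ((hgi t).mul_const _)]
    refine integral_congr_ae (Eventually.of_forall fun x => ?_)
    simp only [entropyDensity]
    ring
  rw [e3, e1]
  linarith

end Multilane

/-! ### Entropy solutions as Kruzhkov curves -/

namespace Multilane

open Filter Topology

/-- A family of Borel measurable, globally defined, `L¹`-Lipschitz curves of densities with
uniformly bounded translation modulus. -/
structure RegularCurve (V L : ℝ) (w : ℕ → ℝ → ℝ → ℝ) : Prop where
  dens : ∀ k t, IsDensity (w k t)
  meas : ∀ k, Measurable (fun p : ℝ × ℝ => w k p.1 p.2)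
  var : ∀ k t z, ∫ x, |w k t (x + z) - w k t x| ≤ V * |z|
  lip : ∀ k s t, ∫ x, |w k s x - w k t x| ≤ L * |s - t|
  norm : ∀ k t, ∫ x, |w k t x| ≤ L

theorem integral_abs_le_add {u v : ℝ → ℝ} (hu : Integrable u) (hv : Integrable v) :
    ∫ x, |u x| ≤ (∫ x, |v x|) + ∫ x, |u x - v x| := by
  have hd : Integrable fun x => |u x - v x| := (hu.sub hv).abs
  rw [← integral_add hv.abs hd]
  refine integral_mono hu.abs (hv.abs.add hd) fun x => ?_
  have := abs_sub_abs_le_abs_sub (u x) (v x)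
  simp only
  linarith

/-- Curves outside the lanes 1, …, N are set to zero, so that neighbouring lanes always carry
densities, and times are projected to [0, T], so that the bounds hold for all real times. `L` is
qualitative; only the variation bound has to be `M`. -/
theorem InSolutionSpace.exists_regularCurve {N : ℕ} {T M : ℝ} {u : ℕ → ℝ → ℝ → ℝ}
    (hu : InSolutionSpace N T u) (hT : 0 ≤ T) (hM : 0 ≤ M)
    (hV : ∀ k ∈ Finset.Icc 1 N, ∀ t ∈ Icc 0 T, essVar (u k t) ≤ ENNReal.ofReal M) :
    ∃ (L : ℝ) (w : ℕ → ℝ → ℝ → ℝ), RegularCurve M L w ∧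
      (∀ k ∈ Finset.Icc 1 N, ∀ t ∈ Icc 0 T, w k t =ᵐ[volume] u k t) ∧
      ∀ k t, w k t = w k (clamp T t) := by
  have key : ∀ k, ∃ (L : ℝ) (w : ℝ → ℝ → ℝ), Measurable (fun p : ℝ × ℝ => w p.1 p.2) ∧
      (∀ t, IsDensity (w t)) ∧ (∀ t z, ∫ x, |w t (x + z) - w t x| ≤ M * |z|) ∧
      (∀ s t, ∫ x, |w s x - w t x| ≤ L * |s - t|) ∧ (∀ t, ∫ x, |w t x| ≤ L) ∧ 0 ≤ L ∧
      (k ∈ Finset.Icc 1 N → ∀ t ∈ Icc 0 T, w t =ᵐ[volume] u k t) ∧ ∀ t, w t = w (clamp T t) := by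
    intro k
    by_cases hk : k ∈ Finset.Icc 1 N
    · obtain ⟨L, hL⟩ := hu.lip k hk
      obtain ⟨w, wm, wr, wc, we⟩ := exists_measurable_representative hT (hu.integrable k hk)
        (hu.range k hk) hL
      have wi : ∀ t, Integrable (w t) := fun t => by
        rw [wc t]
        exact (hu.integrable k hk _ (clamp_mem hT t)).congr (we _ (clamp_mem hT t)).symm
      have wl : ∀ s t, ∫ x, |w s x - w t x| ≤ |L| * |s - t| := fun s t => by
        have e : (fun x => |w s x - w t x|)
            =ᵐ[volume] fun x => |u k (clamp T s) x - u k (clamp T t) x| := by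
          rw [wc s, wc t]
          filter_upwards [we _ (clamp_mem hT s), we _ (clamp_mem hT t)] with x h1 h2
          rw [h1, h2]
        rw [integral_congr_ae e]
        refine (hL _ (clamp_mem hT s) _ (clamp_mem hT t)).trans ?_
        have := abs_clamp_sub_le T s t
        have := le_abs_self L
        gcongr
      have n0 : 0 ≤ ∫ x, |w 0 x| := integral_nonneg fun x => abs_nonneg _
      -- The first summand is the Lipschitz constant; the other two bound the norm at any time by
      -- the norm at time 0 plus the drift over [0, T].
      refine ⟨|L| + (∫ x, |w 0 x|) + |L| * T, w, wm,
        fun t => ⟨wm.comp measurable_prodMk_left, wr t, wi t⟩, fun t z => ?_, fun s t => ?_,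
        fun t => ?_, by positivity, fun _ => we, wc⟩
      · refine integral_abs_translate_le_of_essVar (wi t) hM ?_ z
        rw [wc t]
        refine le_trans (le_of_eq ?_) (hV k hk _ (clamp_mem hT t))
        have := we _ (clamp_mem hT t)
        unfold essVar
        refine iInf_congr fun w' => iInf_congr_Prop ⟨fun h => h.trans this,
          fun h => h.trans this.symm⟩ fun _ => rfl
      · refine (wl s t).trans (mul_le_mul_of_nonneg_right ?_ (abs_nonneg _))
        have : 0 ≤ |L| * T := by positivity
        linarith
      · have h1 := integral_abs_le_add (wi (clamp T t)) (wi 0)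
        rw [← wc t] at h1
        have h2 := wl (clamp T t) 0
        rw [← wc t, sub_zero, abs_of_nonneg (clamp_mem hT t).1] at h2
        have h3 := mul_le_mul_of_nonneg_left (clamp_mem hT t).2 (abs_nonneg L)
        have := abs_nonneg L
        linarith
    · refine ⟨0, fun _ _ => 0, measurable_const, fun _ => Model.isDensity_zero, fun t z => ?_,
        fun s t => by simp, fun t => by simp, le_rfl, fun h => absurd h hk, fun _ => rfl⟩
      simp only [sub_self, abs_zero, integral_zero]
      positivity
  choose L w wm wd wv wl wn L0 we wc using key
  refine ⟨∑ k ∈ Finset.Icc 1 N, L k, fun k t => if k ∈ Finset.Icc 1 N then w k t else fun _ => 0,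
    ?_, fun k hk t ht => by
      beta_reduce; rw [if_pos hk]; exact we k hk t ht, fun k t => ?_⟩
  rotate_left
  · beta_reduce
    rw [wc k t]
  have S0 : 0 ≤ ∑ k ∈ Finset.Icc 1 N, L k := Finset.sum_nonneg fun k _ => L0 k
  have hle : ∀ k ∈ Finset.Icc 1 N, L k ≤ ∑ k ∈ Finset.Icc 1 N, L k := fun k hk =>
    Finset.single_le_sum (fun i _ => L0 i) hk
  constructor
  · intro k t
    split_ifs
    exacts [wd k t, Model.isDensity_zero]
  · intro k
    split_ifs
    exacts [wm k, measurable_const]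
  · intro k t z
    split_ifs with hk
    · exact wv k t z
    · simp only [sub_self, abs_zero, integral_zero]
      positivity
  · intro k s t
    split_ifs with hk
    · exact (wl k s t).trans (mul_le_mul_of_nonneg_right (hle k hk) (abs_nonneg _))
    · simp only [sub_self, abs_zero, integral_zero]
      positivity
  · intro k t
    split_ifs with hk
    · exact (wn k t).trans (hle k hk)
    · simpa using S0

theorem KruzhkovCurve.mono {f : ℝ → ℝ} {T B B' : ℝ} {u U D R : ℝ → ℝ → ℝ}
    (h : KruzhkovCurve f T B u U D R) (hB : B ≤ B') : KruzhkovCurve f T B' u U D R where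
  u_meas := h.u_meas
  U_meas := h.U_meas
  D_meas := h.D_meas
  R_meas := h.R_meas
  u_range := h.u_range
  u_int := h.u_int
  u_norm t := (h.u_norm t).trans hB
  u_lip s t := (h.u_lip s t).trans (mul_le_mul_of_nonneg_right hB (abs_nonneg _))
  U_bdd t x := (h.U_bdd t x).trans hB
  D_bdd t x := (h.D_bdd t x).trans hB
  R_int := h.R_int
  R_norm t := (h.R_norm t).trans hB
  ineq := h.ineq

namespace Model

variable {m : Model} {N : ℕ} {M : ℝ} {k : ℕ}

/-- The velocity depends on the density uniformly in x through its `L¹` norm, so the curve's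
continuity in time transfers. Joint continuity then gives joint measurability of the spatial
derivative. -/
theorem continuous_uncurry_vel {V L : ℝ} {w : ℕ → ℝ → ℝ → ℝ} (h : m.Admissible N)
    (hb : m.DataBounds N M) (hk : k ∈ Finset.Icc 1 N) (hw : RegularCurve V L w) :
    Continuous (fun p : ℝ × ℝ => m.vel k (w k p.1) p.2) := by
  have hM := hb.nonneg
  have hL : 0 ≤ L := (integral_nonneg fun x => abs_nonneg _).trans (hw.norm k 0)
  refine continuous_iff_continuousAt.2 fun p => ?_
  have hbound : ∀ q : ℝ × ℝ, dist (m.vel k (w k q.1) q.2) (m.vel k (w k p.1) p.2)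
      ≤ M * (M * (L * |q.1 - p.1|)) + M * (1 + 2 * M) * |q.2 - p.2| := by
    intro q
    have h1 := abs_vel_sub_vel_le h hb hk (hw.dens k q.1) (hw.dens k p.1) q.2
    have h2 := abs_vel_sub_le h hb hk (hw.dens k p.1) q.2 p.2
    have h3 := hw.lip k q.1 p.1
    rw [Real.dist_eq]
    refine (abs_sub_le _ (m.vel k (w k p.1) q.2) _).trans (add_le_add (h1.trans ?_) h2)
    gcongr
  rw [ContinuousAt, tendsto_iff_dist_tendsto_zero]
  refine squeeze_zero (fun _ => dist_nonneg) hbound ?_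
  have hc : Continuous fun q : ℝ × ℝ =>
      M * (M * (L * |q.1 - p.1|)) + M * (1 + 2 * M) * |q.2 - p.2| := by fun_prop
  simpa using hc.tendsto p

theorem measurable_uncurry_netFlow {V L : ℝ} {w : ℕ → ℝ → ℝ → ℝ} (h : m.Admissible N)
    (hb : m.DataBounds N M) (hw : RegularCurve V L w) (k : ℕ) :
    Measurable (fun p : ℝ × ℝ => m.netFlow N (fun j => w j p.1) k p.2) := by
  have he : ∀ j, Measurable (fun p : ℝ × ℝ => m.exchange N (fun j => w j p.1) j p.2) := fun j =>
    measurable_S h j (hw.meas j) (hw.meas (j + 1))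
      (fun h1 h2 => (continuous_uncurry_vel h hb (Finset.mem_Icc.2 ⟨h1, h2.le⟩) hw).measurable)
      (fun h1 h2 => (continuous_uncurry_vel h hb
        (Finset.mem_Icc.2 ⟨by omega, by omega⟩) hw).measurable)
  exact (he (k - 1)).sub (he k)

theorem netFlow_congr {w w' : ℕ → ℝ → ℝ} (k : ℕ) {x : ℝ}
    (hx : ∀ j ∈ Finset.Icc 1 N, w j x = w' j x)
    (hc : ∀ j ∈ Finset.Icc 1 N, m.conv (w j) x = m.conv (w' j) x) :
    m.netFlow N w k x = m.netFlow N w' k x := by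
  have he : ∀ j, m.exchange N w j x = m.exchange N w' j x := by
    intro j
    by_cases hj : 1 ≤ j ∧ j < N
    · have h1 : j ∈ Finset.Icc 1 N := Finset.mem_Icc.2 ⟨hj.1, hj.2.le⟩
      have h2 : j + 1 ∈ Finset.Icc 1 N := Finset.mem_Icc.2 ⟨by omega, by omega⟩
      rw [exchange, exchange, hx j h1, hx _ h2, hc j h1, hc _ h2]
    · rw [exchange, exchange, S_of_not hj, S_of_not hj]
  rw [netFlow, netFlow, he, he]

end Model

/-- Regular representatives of an entropy solution form Kruzhkov curves. -/
theorem IsEntropySolution.exists_kruzhkovCurve {m : Model} {N : ℕ} {T M V L : ℝ}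
    {u₀ : ℕ → ℝ → ℝ} {u w : ℕ → ℝ → ℝ → ℝ} (hu : IsEntropySolution m N T u₀ u)
    (h : m.Admissible N) (hb : m.DataBounds N M) (hw : RegularCurve V L w)
    (hwu : ∀ k ∈ Finset.Icc 1 N, ∀ t ∈ Icc 0 T, w k t =ᵐ[volume] u k t)
    {k : ℕ} (hk : k ∈ Finset.Icc 1 N) :
    ∃ B, KruzhkovCurve (m.f k) T B (w k) (fun t => m.vel k (w k t))
      (fun t => deriv (m.vel k (w k t))) (fun t => m.netFlow N (fun j => w j t) k) := by
  have hM := hb.nonneg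
  have hL : 0 ≤ L := (integral_nonneg fun x => abs_nonneg _).trans (hw.norm k 0)
  obtain ⟨Bν, hBν⟩ := h.ν_bdd k hk
  have hBν0 : 0 ≤ Bν := (abs_nonneg _).trans (hBν 0 0 ⟨le_rfl, zero_le_one⟩)
  have hUc := Model.continuous_uncurry_vel h hb hk hw
  have hDm : Measurable (fun p : ℝ × ℝ => deriv (m.vel k (w k p.1)) p.2) :=
    measurable_deriv_with_param (f := fun t => m.vel k (w k t)) hUc
  have hRm := Model.measurable_uncurry_netFlow h hb hw k
  set B := L + Bν + M * (1 + 2 * M) + 8 * M + 8 * M * L with hB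
  have p1 : 0 ≤ M * (1 + 2 * M) := by positivity
  have p2 : 0 ≤ 8 * M * L := by positivity
  have hl : ∀ s t, ∫ x, |w k s x - w k t x| ≤ B * |s - t| := fun s t =>
    (hw.lip k s t).trans (mul_le_mul_of_nonneg_right (by linarith) (abs_nonneg _))
  have hU : ∀ t x, |m.vel k (w k t) x| ≤ B := fun t x =>
    (hBν x _ (Model.conv_mem h (hw.dens k t).meas (hw.dens k t).range x)).trans (by linarith)
  have hD : ∀ t x, |deriv (m.vel k (w k t)) x| ≤ B := fun t x =>
    (Model.abs_deriv_vel_le h hb hk (hw.dens k t) x).trans (by linarith)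
  have hR : ∀ t x, |m.netFlow N (fun j => w j t) k x| ≤ B := fun t x =>
    (Model.abs_netFlow_le h hb (fun j => hw.dens j t) k x).trans (by linarith)
  refine ⟨B, hw.meas k, hUc.measurable, hDm, hRm, fun t => (hw.dens k t).range,
    fun t => (hw.dens k t).int, fun t => (hw.norm k t).trans (by linarith), hl, hU, hD,
    fun t => Model.integrable_netFlow h hb (fun j => hw.dens j t) k,
    fun t => (Model.integral_abs_netFlow_le h hb (fun j => hw.dens j t)
      (fun j => hw.norm j t) k).trans (by linarith), ?_⟩
  intro α hα ψ hψ hψc hψ0 t₁ t₂ h1 h12 h2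
  refine integrated_of_distributional (Model.measurable_f h hk) hM (hb.f_lip k hk)
    (Model.f_zero k) hα (hw.meas k) hUc.measurable hDm hRm (fun t => (hw.dens k t).range)
    (fun t => (hw.dens k t).int) hl hU hD hR hψ hψc hψ0 (fun χ hχ hχ0 hχc hχs => ?_) h1 h12 h2
  -- The nonlocal terms of solution and representative agree at every x, not just almost everywhere,
  -- so the spatial derivatives of the velocities agree as well.
  have hae : ∀ᵐ p : ℝ × ℝ ∂(volume.restrict (Ioo 0 T ×ˢ univ)),
      (∀ j ∈ Finset.Icc 1 N, w j p.1 p.2 = u j p.1 p.2) ∧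
      (∀ j ∈ Finset.Icc 1 N, m.conv (u j p.1) = m.conv (w j p.1)) := by
    have hs : (Ioo 0 T ×ˢ univ : Set (ℝ × ℝ)) ⊆ Icc 0 T ×ˢ univ :=
      prod_mono Ioo_subset_Icc_self subset_rfl
    have e1 : ∀ᵐ p : ℝ × ℝ ∂(volume.restrict (Ioo 0 T ×ˢ univ)),
        ∀ j ∈ Finset.Icc 1 N, w j p.1 p.2 = u j p.1 p.2 :=
      (Finset.eventually_all _).2 fun j hj => ae_restrict_of_ae_restrict_of_subset hs
        (ae_strip_of_slices (hu.space.meas j hj) (hw.meas j).aestronglyMeasurable (hwu j hj))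
    filter_upwards [e1, ae_restrict_mem (measurableSet_Ioo.prod MeasurableSet.univ)] with p h1 h2
    exact ⟨h1, fun j hj => funext fun x =>
      (Model.conv_congr (hwu j hj p.1 (Ioo_subset_Icc_self h2.1)) x).symm⟩
  have key := hu.entropy k hk α _ (isTestFunction_mul hχ hχ0 hχc hχs hψ hψc hψ0)
  -- The initial term of the entropy inequality drops out. Initial data enter later, through the
  -- time slice at 0 and continuity in time.
  have hχz : χ 0 = 0 := image_eq_zero_of_notMem_tsupport fun h0 => lt_irrefl _ (hχs h0).1
  have i1 : ∫ p in Ioo 0 T ×ˢ univ, |u k p.1 p.2 - α| * deriv (fun s => χ s * ψ p.2) p.1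
      = ∫ p in Ioo 0 T ×ˢ univ, |w k p.1 p.2 - α| * (deriv χ p.1 * ψ p.2) := by
    refine integral_congr_ae ?_
    filter_upwards [hae] with p hp
    rw [hp.1 k hk, deriv_mul_const_field]
  have i2 : ∫ p in Ioo 0 T ×ˢ univ, m.G k (u k p.1 p.2) α * m.velocity u k p.1 p.2
        * deriv (fun y => χ p.1 * ψ y) p.2
      = ∫ p in Ioo 0 T ×ˢ univ, entropyFlux (m.f k) (w k p.1 p.2) α * m.vel k (w k p.1) p.2
        * (χ p.1 * deriv ψ p.2) := by
    refine integral_congr_ae ?_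
    filter_upwards [hae] with p hp
    rw [hp.1 k hk, deriv_const_mul_field, Model.velocity, hp.2 k hk]
    rfl
  have i3 : ∫ p in Ioo 0 T ×ˢ univ, Real.sign (u k p.1 p.2 - α) * m.f k α
        * deriv (fun y => m.velocity u k p.1 y) p.2 * (χ p.1 * ψ p.2)
      = ∫ p in Ioo 0 T ×ˢ univ, Real.sign (w k p.1 p.2 - α) * m.f k α
        * deriv (m.vel k (w k p.1)) p.2 * (χ p.1 * ψ p.2) := by
    refine integral_congr_ae ?_
    filter_upwards [hae] with p hp
    have : (fun y => m.velocity u k p.1 y) = m.vel k (w k p.1) := by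
      funext y
      rw [Model.velocity, hp.2 k hk]
      rfl
    rw [hp.1 k hk, this]
  have i4 : ∫ p in Ioo 0 T ×ˢ univ, Real.sign (u k p.1 p.2 - α) * m.source N u k p.1 p.2
        * (χ p.1 * ψ p.2)
      = ∫ p in Ioo 0 T ×ˢ univ, Real.sign (w k p.1 p.2 - α)
        * m.netFlow N (fun j => w j p.1) k p.2 * (χ p.1 * ψ p.2) := by
    refine integral_congr_ae ?_
    filter_upwards [hae] with p hp
    rw [hp.1 k hk, Model.source_eq_netFlow u hk, Model.netFlow_congr k
      (fun j hj => (hp.1 j hj).symm) (fun j hj => congrFun (hp.2 j hj) p.2)]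
  unfold EntropyInequality at key
  rw [i1, i2, i3, i4] at key
  simpa [hχz] using key

end Multilane

/-! ### Stability of regular curves -/

namespace Multilane

open Filter Topology

namespace Model

variable {m : Model} {N : ℕ} {M : ℝ} {k : ℕ}

/-- The static part of the doubling argument for two families of densities on the lanes. -/
theorem integral_entropyDensity_lane_le (h : m.Admissible N) (hb : m.DataBounds N M)
    (hk : k ∈ Finset.Icc 1 N) {G L : ℝ}
    (hG : ∀ k ∈ Finset.Icc 1 N, ∀ a ∈ Icc (0 : ℝ) 1, |m.g k a| ≤ G) (hG0 : 0 ≤ G)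
    {w z : ℕ → ℝ → ℝ} (hw : ∀ j, IsDensity (w j)) (hz : ∀ j, IsDensity (z j))
    (hwV : ∀ j h, ∫ x, |w j (x + h) - w j x| ≤ M * |h|)
    (hzV : ∀ j h, ∫ x, |z j (x + h) - z j x| ≤ M * |h|)
    (hzL : ∀ j, ∫ x, |z j x| ≤ L) (hzM : ∫ x, |z k x| ≤ M) {ψ : ℝ → ℝ} {δ c₁ : ℝ} (hδ : 0 ≤ δ)
    (hc₁ : 0 ≤ c₁)
    (hψ : ContDiff ℝ (⊤ : ℕ∞) ψ) (hψc : HasCompactSupport ψ) (hψ0 : ∀ z, 0 ≤ ψ z)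
    (hψ1 : ∫ z, ψ z = 1) (hψδ : ∀ z, |z| * ψ z ≤ δ * ψ z)
    (hψ' : ∫ z, |z| * |deriv ψ z| ≤ c₁)
    (hint : Integrable (fun p : ℝ × ℝ =>
      entropyDensity (m.f k) (w k p.1) (z k p.2) (m.vel k (w k) p.1) (deriv (m.vel k (w k)) p.1)
        (m.netFlow N w k p.1) (deriv ψ (p.1 - p.2)) (ψ (p.1 - p.2))
      + entropyDensity (m.f k) (z k p.2) (w k p.1) (m.vel k (z k) p.2) (deriv (m.vel k (z k)) p.2)
        (m.netFlow N z k p.2) (-deriv ψ (p.1 - p.2)) (ψ (p.1 - p.2)))) :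
    ∫ p : ℝ × ℝ, (entropyDensity (m.f k) (w k p.1) (z k p.2) (m.vel k (w k) p.1)
        (deriv (m.vel k (w k)) p.1) (m.netFlow N w k p.1) (deriv ψ (p.1 - p.2)) (ψ (p.1 - p.2))
      + entropyDensity (m.f k) (z k p.2) (w k p.1) (m.vel k (z k) p.2) (deriv (m.vel k (z k)) p.2)
        (m.netFlow N z k p.2) (-deriv ψ (p.1 - p.2)) (ψ (p.1 - p.2)))
      ≤ (c₁ * (M ^ 4 + M * (M * (1 + 2 * M))) + M * (M * (1 + 2 * M))
          + M * (M * (1 + 2 * M) * M * M + M * (2 * M)) + 8 * M)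
          * (∑ j ∈ Finset.Icc 1 N, ∫ x, |w j x - z j x|)
        + (c₁ * (M * (M * (1 + 2 * M)) * M) + M * (M * (1 + 2 * M)) * M
          + (M + 1) * (M * (1 + 2 * M) * (1 + 2 * M) * M + M * (2 * M) * M
            + (8 * G * M * L + 8 * M * M))) * δ := by
  have hM := hb.nonneg
  have hL : 0 ≤ L := (integral_nonneg fun x => abs_nonneg _).trans (hzL k)
  have hA : 0 ≤ M * (1 + 2 * M) * (1 + 2 * M) * M + M * (2 * M) * M := by positivity
  have hB : 0 ≤ 8 * G * M * L + 8 * M * M := by positivity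
  have hn0 : ∀ j ∈ Finset.Icc 1 N, 0 ≤ ∫ x, |w j x - z j x| := fun j _ =>
    integral_nonneg fun x => abs_nonneg _
  have hle := Finset.single_le_sum hn0 hk
  have hnk := hn0 k hk
  set n := ∫ x, |w k x - z k x|
  set s := ∑ j ∈ Finset.Icc 1 N, ∫ x, |w j x - z j x|
  refine (integral_entropyDensity_add_le (κ := M * (M * n)) (L := M * (1 + 2 * M))
    (Λ := (M * (1 + 2 * M) * M * M + M * (2 * M)) * n) (r := 8 * M * s) (c₁ := c₁)
    (K := M * (1 + 2 * M) * (1 + 2 * M) * M + M * (2 * M) * M + (8 * G * M * L + 8 * M * M))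
    hM (by positivity) hδ hM (by positivity) (measurable_f h hk) (hb.f_lip k hk) (f_zero k)
    (hw k).range (hw k).int (hw k).meas (hz k).range (hz k).int (hz k).meas (hzV k)
    (continuous_vel h hb hk (hw k)).measurable (continuous_vel h hb hk (hz k)).measurable
    (measurable_deriv _) (measurable_deriv _)
    (abs_vel_sub_vel_le h hb hk (hw k) (hz k)) (abs_vel_sub_le h hb hk (hz k))
    (abs_deriv_vel_le h hb hk (hw k)) (abs_deriv_vel_le h hb hk (hz k))
    (integral_abs_mul_deriv_vel_sub_le h hb hk (hw k) (hz k) hzM)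
    (fun y => (integral_abs_mul_deriv_vel_translate_le h hb hk (hw k) (hz k) hzM (hwV k) y).trans
      (mul_le_mul_of_nonneg_right (le_add_of_nonneg_right hB) (abs_nonneg _)))
    (integrable_netFlow h hb hw k) (integrable_netFlow h hb hz k)
    (netFlow_stability h hb hw hz k)
    (fun y => (integral_abs_netFlow_translate_le h hb hG hG0 hz hzL hzV k y).trans
      (mul_le_mul_of_nonneg_right (le_add_of_nonneg_left hA) (abs_nonneg _)))
    hψ hψc hψ0 hψ1 hψδ hψ' hint).trans ?_
  -- Only the source couples the lanes; the remaining terms see the distance in lane `k` alone,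
  -- which is then enlarged to the sum.
  calc _ = (c₁ * (M ^ 4 + M * (M * (1 + 2 * M))) + M * (M * (1 + 2 * M))
          + M * (M * (1 + 2 * M) * M * M + M * (2 * M))) * n + 8 * M * s
        + (c₁ * (M * (M * (1 + 2 * M)) * M) + M * (M * (1 + 2 * M)) * M
          + (M + 1) * (M * (1 + 2 * M) * (1 + 2 * M) * M + M * (2 * M) * M
            + (8 * G * M * L + 8 * M * M))) * δ := by ring
    _ ≤ (c₁ * (M ^ 4 + M * (M * (1 + 2 * M))) + M * (M * (1 + 2 * M))
          + M * (M * (1 + 2 * M) * M * M + M * (2 * M))) * s + 8 * M * s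
        + (c₁ * (M * (M * (1 + 2 * M)) * M) + M * (M * (1 + 2 * M)) * M
          + (M + 1) * (M * (1 + 2 * M) * (1 + 2 * M) * M + M * (2 * M) * M
            + (8 * G * M * L + 8 * M * M))) * δ := by
        gcongr
    _ = _ := by ring

end Model

/-! ### Continuity in time of the distance and the stability estimate -/

theorem abs_dist_sub_dist_le {V V' L L' : ℝ} {w z : ℕ → ℝ → ℝ → ℝ} (hw : RegularCurve V L w)
    (hz : RegularCurve V' L' z) (k : ℕ) (t s t' s' : ℝ) :
    |(∫ x, |w k t x - z k s x|) - (∫ x, |w k t' x - z k s' x|)| ≤ L * |t - t'| + L' * |s - s'| := by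
  have I : ∀ t s, Integrable fun x => |w k t x - z k s x| := fun t s =>
    ((hw.dens k t).int.sub (hz.dens k s).int).abs
  have i1 : Integrable fun x => |w k t x - w k t' x| :=
    ((hw.dens k t).int.sub (hw.dens k t').int).abs
  have i2 : Integrable fun x => |z k s x - z k s' x| :=
    ((hz.dens k s).int.sub (hz.dens k s').int).abs
  rw [← integral_sub (I t s) (I t' s')]
  refine abs_integral_le_integral_abs.trans ((integral_mono ((I t s).sub (I t' s')).abs
    (i1.add i2) fun x => ?_).trans ?_)
  · simp only [Pi.add_apply]
    refine (abs_abs_sub_abs_le_abs_sub _ _).trans ?_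
    rw [show w k t x - z k s x - (w k t' x - z k s' x)
      = w k t x - w k t' x - (z k s x - z k s' x) by ring]
    exact abs_sub _ _
  · rw [integral_add' i1 i2]
    exact add_le_add (hw.lip k t t') (hz.lip k s s')

theorem continuous_dist {V V' L L' : ℝ} {w z : ℕ → ℝ → ℝ → ℝ} (hw : RegularCurve V L w)
    (hz : RegularCurve V' L' z) (k : ℕ) :
    Continuous fun p : ℝ × ℝ => ∫ x, |w k p.1 x - z k p.2 x| := by
  refine continuous_iff_continuousAt.2 fun p => ?_
  rw [ContinuousAt, tendsto_iff_dist_tendsto_zero]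
  refine squeeze_zero (fun _ => dist_nonneg)
    (fun q => abs_dist_sub_dist_le hw hz k q.1 q.2 p.1 p.2) ?_
  have hc : Continuous fun q : ℝ × ℝ => L * |q.1 - p.1| + L' * |q.2 - p.2| := by fun_prop
  simpa using hc.tendsto p

/-- Stability for regular families of Kruzhkov curves, with a constant that depends only on the
number of lanes and the bounds on the data. -/
theorem exists_stability_const (N : ℕ) (M : ℝ) : ∃ C : ℝ, ∀ {m : Model} {T L L' : ℝ}
    {w z : ℕ → ℝ → ℝ → ℝ} {B : ℕ → ℝ}, m.Admissible N → m.DataBounds N M →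
    RegularCurve M L w → RegularCurve M L' z → (∀ k ∈ Finset.Icc 1 N, ∀ t, ∫ x, |z k t x| ≤ M) →
    (∀ k ∈ Finset.Icc 1 N, KruzhkovCurve (m.f k) T (B k) (w k) (fun t => m.vel k (w k t))
      (fun t => deriv (m.vel k (w k t))) (fun t => m.netFlow N (fun j => w j t) k)) →
    (∀ k ∈ Finset.Icc 1 N, KruzhkovCurve (m.f k) T (B k) (z k) (fun t => m.vel k (z k t))
      (fun t => deriv (m.vel k (z k t))) (fun t => m.netFlow N (fun j => z j t) k)) →
    ∀ t ∈ Icc 0 T, ∑ k ∈ Finset.Icc 1 N, ∫ x, |w k t x - z k t x|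
      ≤ Real.exp (C * t) * ∑ k ∈ Finset.Icc 1 N, ∫ x, |w k 0 x - z k 0 x| := by
  obtain ⟨c₁, hc₁, hmoll⟩ := exists_mollifier
  set C := c₁ * (M ^ 4 + M * (M * (1 + 2 * M))) + M * (M * (1 + 2 * M))
          + M * (M * (1 + 2 * M) * M * M + M * (2 * M)) + 8 * M with hC
  -- Each lane grows at most at rate `C` times the total distance, so summation over the lanes
  -- brings the factor `N`.
  refine ⟨N * C, fun {m T L L' w z B} h hb hw hz hzM hKw hKz => ?_⟩
  have hM := hb.nonneg
  have hC0 : 0 ≤ C := by positivity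
  obtain ⟨G, hG0, hG'⟩ := Model.exists_g_bound h
  have hG := fun k hk => (hG' k hk).2
  set S : ℝ → ℝ → ℝ := fun t s => ∑ k ∈ Finset.Icc 1 N, ∫ x, |w k t x - z k s x| with hS
  have hSc : Continuous fun p : ℝ × ℝ => S p.1 p.2 :=
    continuous_finsetSum _ fun k _ => continuous_dist hw hz k
  have hSd : Continuous fun t => S t t := hSc.comp (continuous_id.prodMk continuous_id)
  -- `G` and `L'` depend on the model and the solution, but they occur only in `K`, which is
  -- multiplied by δ.
  set K := c₁ * (M * (M * (1 + 2 * M)) * M) + M * (M * (1 + 2 * M)) * M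
          + (M + 1) * (M * (1 + 2 * M) * (1 + 2 * M) * M + M * (2 * M) * M
            + (8 * G * M * L' + 8 * M * M)) with hK
  have lane : ∀ δ > 0, ∀ k ∈ Finset.Icc 1 N, ∀ a b, 0 < a → a ≤ b → b < T →
      (∫ x, |w k b x - z k b x|) ≤ (∫ x, |w k a x - z k a x|)
        + (∫ t in a..b, (C * S t t + K * δ)) + 2 * M * δ := by
    intro δ hδ k hk a b ha hab hb'
    obtain ⟨ψ, hψ, hψc, hψ0, hψ1, hψδ, hψ'⟩ := hmoll δ hδ
    obtain ⟨C', hi⟩ := (hKw k hk).integrable_density_add (hKz k hk) hM (Model.measurable_f h hk)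
      (hb.f_lip k hk) (Model.f_zero k) hψ hψc hψ0
    refine (hKw k hk).dist_sub_le (hKz k hk) hM (Model.measurable_f h hk)
      (hb.f_lip k hk) (Model.f_zero k) hM hψ hψc hψ0 hψ1 hψδ (hz.var k)
      (E := fun t s => C * S t s + K * δ) (by fun_prop) (fun t s => ?_) ha hab hb'
    exact Model.integral_entropyDensity_lane_le h hb hk hG hG0 (w := fun j => w j t)
      (z := fun j => z j s) (fun j => hw.dens j t) (fun j => hz.dens j s) (fun j => hw.var j t)
      (fun j => hz.var j s) (fun j => hz.norm j s) (hzM k hk s) hδ.le hc₁ hψ hψc hψ0 hψ1 hψδ hψ'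
      ((hi t s).1.add (hi t s).2.1)
  have total : ∀ a b, 0 < a → a ≤ b → b < T → S b b ≤ S a a + N * C * ∫ t in a..b, S t t := by
    intro a b ha hab hb'
    -- The mollifier has gone from the statement, so δ → 0 can be taken in a plain inequality
    -- between numbers.
    have hd : ∀ δ > 0, S b b ≤ S a a + N * C * (∫ t in a..b, S t t)
        + N * (K * (b - a) + 2 * M) * δ := by
      intro δ hδ
      have hsum := Finset.sum_le_sum fun k hk => lane δ hδ k hk a b ha hab hb'
      rw [Finset.sum_add_distrib, Finset.sum_add_distrib, Finset.sum_const, Finset.sum_const,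
        Nat.card_Icc, Nat.add_sub_cancel, intervalIntegral.integral_add
          ((hSd.const_mul C).intervalIntegrable _ _) (continuous_const.intervalIntegrable _ _),
        intervalIntegral.integral_const_mul, intervalIntegral.integral_const] at hsum
      simp only [nsmul_eq_mul, smul_eq_mul] at hsum
      exact hsum.trans (le_of_eq (by ring))
    have ht : Tendsto (fun δ : ℝ => S a a + N * C * (∫ t in a..b, S t t)
        + N * (K * (b - a) + 2 * M) * δ) (𝓝[>] 0) (𝓝 (S a a + N * C * ∫ t in a..b, S t t)) := by
      have hc : Continuous fun δ : ℝ => S a a + N * C * (∫ t in a..b, S t t)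
        + N * (K * (b - a) + 2 * M) * δ := by fun_prop
      simpa using (hc.tendsto 0).mono_left nhdsWithin_le_nhds
    exact ge_of_tendsto ht (eventually_mem_nhdsWithin.mono fun δ hδ => hd δ hδ)
  have gron : ∀ a b, 0 < a → a ≤ b → b < T → S b b ≤ Real.exp (N * C * (b - a)) * S a a :=
    fun a b ha hab hb' => le_exp_mul_of_le_add_integral hSd (by positivity) hab
      fun t ht => total a t ha ht.1 (ht.2.trans_lt hb')
  intro t ht
  change S t t ≤ Real.exp (N * C * t) * S 0 0
  rcases ht.1.eq_or_lt with h0 | h0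
  · simp [← h0]
  -- The estimate is available inside (0, T) only; it is applied on [ε, t - ε] and extended to the
  -- end times by continuity.
  · have hl : Tendsto (fun ε : ℝ => S (t - ε) (t - ε)) (𝓝[>] 0) (𝓝 (S t t)) := by
      have hc : Continuous fun ε : ℝ => S (t - ε) (t - ε) :=
        hSd.comp (continuous_const.sub continuous_id)
      simpa using (hc.tendsto 0).mono_left nhdsWithin_le_nhds
    have hr : Tendsto (fun ε : ℝ => Real.exp (N * C * (t - ε - ε)) * S ε ε) (𝓝[>] 0)
        (𝓝 (Real.exp (N * C * t) * S 0 0)) := by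
      have hc : Continuous fun ε : ℝ => Real.exp (N * C * (t - ε - ε)) * S ε ε := by fun_prop
      simpa using (hc.tendsto 0).mono_left nhdsWithin_le_nhds
    refine le_of_tendsto_of_tendsto hl hr ?_
    filter_upwards [Ioo_mem_nhdsGT (half_pos h0)] with ε hε
    exact gron ε (t - ε) hε.1 (by linarith [hε.2]) (by linarith [hε.1, ht.2])

end Multilane

/-! ### Stability and uniqueness of entropy solutions -/

namespace Multilane

open Filter Topology

theorem RegularCurve.mono {V V' L : ℝ} {w : ℕ → ℝ → ℝ → ℝ} (hw : RegularCurve V L w)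
    (hV : V ≤ V') : RegularCurve V' L w where
  dens := hw.dens
  meas := hw.meas
  var k t z := (hw.var k t z).trans (mul_le_mul_of_nonneg_right hV (abs_nonneg _))
  lip := hw.lip
  norm := hw.norm

theorem InSolutionSpace.exists_essVar_le {N : ℕ} {T : ℝ} {u : ℕ → ℝ → ℝ → ℝ}
    (hu : InSolutionSpace N T u) : ∃ V : ℝ, 0 ≤ V ∧
      ∀ k ∈ Finset.Icc 1 N, ∀ t ∈ Icc 0 T, essVar (u k t) ≤ ENNReal.ofReal V := by
  choose! V hV using hu.bv
  refine ⟨∑ k ∈ Finset.Icc 1 N, (V k : ℝ), Finset.sum_nonneg fun k _ => (V k).2,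
    fun k hk t ht => (hV k hk t ht).trans ?_⟩
  rw [← ENNReal.ofReal_coe_nnreal]
  exact ENNReal.ofReal_le_ofReal
    (Finset.single_le_sum (f := fun k => (V k : ℝ)) (fun i _ => (V i).2) hk)

/-! ### Bounds on the data supplied by admissibility alone -/

namespace Model

variable {m : Model} {N : ℕ} {M : ℝ} {k : ℕ}

theorem DataBounds.mono {M' : ℝ} (hb : m.DataBounds N M) (hM : M ≤ M') : m.DataBounds N M' where
  nonneg := hb.nonneg.trans hM
  ω_sup z hz := (hb.ω_sup z hz).trans hM
  f_lip k hk a ha b hb' := (hb.f_lip k hk a ha b hb').trans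
    (mul_le_mul_of_nonneg_right hM (abs_nonneg _))
  ν_deriv k hk x w hw := by
    obtain ⟨h1, h2, h3, h4, h5, h6⟩ := hb.ν_deriv k hk x w hw
    exact ⟨h1.trans hM, h2.trans hM, h3.trans hM, h4.trans hM, h5.trans hM, h6.trans hM⟩
  S_lip k hk x a ha b hb' A hA B hB a' ha' b' hb'' A' hA' B' hB' :=
    (hb.S_lip k hk x a ha b hb' A hA B hB a' ha' b' hb'' A' hA' B' hB').trans
      (mul_le_mul_of_nonneg_right hM (by positivity))

/-- The exchange rates are Lipschitz on the unit cube, uniformly in the position. -/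
theorem abs_S_sub_S_le {G D Bν : ℝ} {j : ℕ} (hG0 : 0 ≤ G) (hD0 : 0 ≤ D) (hB0 : 0 ≤ Bν)
    (hG : ∀ k ∈ Finset.Icc 1 N, (∀ a b, |m.g k a - m.g k b| ≤ G * |a - b|) ∧
      ∀ a ∈ Icc (0 : ℝ) 1, |m.g k a| ≤ G)
    (hν : ∀ k ∈ Finset.Icc 1 N, ∀ x, ∀ u ∈ Icc (0 : ℝ) 1, |m.ν k x u| ≤ Bν)
    (hD : ∀ k ∈ Finset.Icc 1 N, ∀ x, ∀ u ∈ Icc (0 : ℝ) 1, ∀ w ∈ Icc (0 : ℝ) 1,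
      |m.ν k x u - m.ν k x w| ≤ D * |u - w|) (x : ℝ)
    {a b A B a' b' A' B' : ℝ} (ha : a ∈ Icc (0 : ℝ) 1) (hb : b ∈ Icc (0 : ℝ) 1)
    (hA : A ∈ Icc (0 : ℝ) 1) (hB : B ∈ Icc (0 : ℝ) 1) (ha' : a' ∈ Icc (0 : ℝ) 1)
    (hb' : b' ∈ Icc (0 : ℝ) 1) (hA' : A' ∈ Icc (0 : ℝ) 1) (hB' : B' ∈ Icc (0 : ℝ) 1) :
    |m.S N j x a b A B - m.S N j x a' b' A' B'|
      ≤ (4 * G * Bν + 2 * G * D) * (|a - a'| + |b - b'| + |A - A'| + |B - B'|) := by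
  by_cases hj : 1 ≤ j ∧ j < N
  · have j1 : j ∈ Finset.Icc 1 N := Finset.mem_Icc.2 ⟨hj.1, hj.2.le⟩
    have j2 : j + 1 ∈ Finset.Icc 1 N := Finset.mem_Icc.2 ⟨by omega, by omega⟩
    have prod : ∀ i ∈ Finset.Icc 1 N, ∀ p ∈ Icc (0 : ℝ) 1, ∀ q ∈ Icc (0 : ℝ) 1,
        ∀ P ∈ Icc (0 : ℝ) 1, ∀ Q ∈ Icc (0 : ℝ) 1,
        |m.g i p * m.ν i x P - m.g i q * m.ν i x Q| ≤ G * Bν * |p - q| + G * D * |P - Q| := by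
      intro i hi p hp q hq P hP Q hQ
      have e : m.g i p * m.ν i x P - m.g i q * m.ν i x Q
          = (m.g i p - m.g i q) * m.ν i x P + m.g i q * (m.ν i x P - m.ν i x Q) := by ring
      rw [e]
      refine (abs_add_le _ _).trans ?_
      rw [abs_mul, abs_mul]
      calc _ ≤ (G * |p - q|) * Bν + G * (D * |P - Q|) := by
            gcongr
            · exact (hG i hi).1 p q
            · exact hν i hi x P hP
            · exact (hG i hi).2 q hq
            · exact hD i hi x P hP Q hQ
        _ = _ := by ring
    have size : ∀ i ∈ Finset.Icc 1 N, ∀ p ∈ Icc (0 : ℝ) 1, ∀ P ∈ Icc (0 : ℝ) 1,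
        |m.g i p * m.ν i x P| ≤ G * Bν := by
      intro i hi p hp P hP
      rw [abs_mul]
      exact mul_le_mul ((hG i hi).2 p hp) (hν i hi x P hP) (abs_nonneg _) hG0
    have d1 := prod j j1 a ha a' ha' A hA A' hA'
    have d2 := prod (j + 1) j2 b hb b' hb' B hB B' hB'
    have s1 := size j j1 a' ha' A' hA'
    have s2 := size (j + 1) j2 b' hb' B' hB'
    simp only [S, if_pos hj]
    set P := m.g (j + 1) b * m.ν (j + 1) x B - m.g j a * m.ν j x A with hP
    set Q := m.g (j + 1) b' * m.ν (j + 1) x B' - m.g j a' * m.ν j x A' with hQ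
    have hPQ : |P - Q| ≤ G * Bν * (|a - a'| + |b - b'|) + G * D * (|A - A'| + |B - B'|) := by
      rw [hP, hQ, sub_sub_sub_comm]
      refine (abs_sub _ _).trans ?_
      linarith
    have hQ' : |Q| ≤ 2 * (G * Bν) := (abs_sub _ _).trans (by linarith)
    have h1 : |max P 0 - max Q 0| ≤ |P - Q| := by simpa using abs_max_sub_max_le_max P 0 Q 0
    have h2 : |min P 0 - min Q 0| ≤ |P - Q| := by simpa using abs_min_sub_min_le_max P 0 Q 0
    have h3 : |max Q 0| ≤ |Q| := by simpa using abs_max_sub_max_le_max Q 0 0 0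
    have h4 : |min Q 0| ≤ |Q| := by simpa using abs_min_sub_min_le_max Q 0 0 0
    have a1 : |a| ≤ 1 := abs_le.2 ⟨by linarith [ha.1], ha.2⟩
    have b1 : |b| ≤ 1 := abs_le.2 ⟨by linarith [hb.1], hb.2⟩
    -- The differences of the positive and negative parts, weighted with a and b, contribute 2|P -
    -- Q|; the changes of a and b are weighted with |Q| ≤ 2G·Bν. Together they give 4G·Bν + 2G·D.
    calc _ = |(max P 0 - max Q 0) * a + (min P 0 - min Q 0) * b
          + (max Q 0 * (a - a') + min Q 0 * (b - b'))| := by congr 1; ring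
      _ ≤ (|max P 0 - max Q 0| * |a| + |min P 0 - min Q 0| * |b|)
          + (|max Q 0| * |a - a'| + |min Q 0| * |b - b'|) := by
          simp only [← abs_mul]
          exact (abs_add_le _ _).trans (add_le_add (abs_add_le _ _) (abs_add_le _ _))
      _ ≤ (|P - Q| * 1 + |P - Q| * 1)
          + (2 * (G * Bν) * |a - a'| + 2 * (G * Bν) * |b - b'|) := by
          gcongr
          · exact h3.trans hQ'
          · exact h4.trans hQ'
      _ ≤ _ := by
          have q1 : 0 ≤ G * Bν * (|A - A'| + |B - B'|) := by positivity
          have q2 : 0 ≤ G * D * (|a - a'| + |b - b'|) := by positivity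
          linarith
  · rw [S_of_not hj, S_of_not hj, sub_self, abs_zero]
    positivity

/-- Admissible data satisfy the bounds that enter the stability constant. -/
theorem Admissible.exists_dataBounds (h : m.Admissible N) : ∃ M, m.DataBounds N M := by
  obtain ⟨G, hG0, hG⟩ := exists_g_bound h
  obtain ⟨Bω, hω⟩ := h.ω_W2
  choose! Bν hBν using h.ν_bdd
  choose! D hD using h.ν_deriv_bdd
  set Bs := ∑ k ∈ Finset.Icc 1 N, |Bν k|
  set Ds := ∑ k ∈ Finset.Icc 1 N, |D k|
  have hB0 : 0 ≤ Bs := Finset.sum_nonneg fun k _ => abs_nonneg _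
  have hD0 : 0 ≤ Ds := Finset.sum_nonneg fun k _ => abs_nonneg _
  have hBs : ∀ k ∈ Finset.Icc 1 N, Bν k ≤ Bs := fun k hk => (le_abs_self _).trans
    (Finset.single_le_sum (f := fun k => |Bν k|) (fun i _ => abs_nonneg _) hk)
  have hDs : ∀ k ∈ Finset.Icc 1 N, D k ≤ Ds := fun k hk => (le_abs_self _).trans
    (Finset.single_le_sum (f := fun k => |D k|) (fun i _ => abs_nonneg _) hk)
  have hl : ∀ k ∈ Finset.Icc 1 N, ∀ x, ∀ u ∈ Icc (0 : ℝ) 1, ∀ w ∈ Icc (0 : ℝ) 1,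
      |m.ν k x u - m.ν k x w| ≤ Ds * |u - w| := fun k hk x u hu w hw =>
    (convex_Icc (0 : ℝ) 1).norm_image_sub_le_of_norm_deriv_le (f := fun u => m.ν k x u)
      (fun u _ => (h.ν_C2_right k hk x).differentiable two_ne_zero u)
      (fun u hu => ((hD k hk x u hu).2.1).trans (hDs k hk)) hw hu
  set Sl := 4 * G * Bs + 2 * G * Ds
  have hS0 : 0 ≤ Sl := by positivity
  have hω0 := abs_nonneg Bω
  refine ⟨|Bω| + 2 * G + Ds + Sl, by positivity, fun z hz => ?_, fun k hk a ha b hb => ?_,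
    fun k hk x w hw => ?_, fun k _ x a ha b hb A hA B hB a' ha' b' hb' A' hA' B' hB' => ?_⟩
  · have := (hω z hz).1
    linarith [le_abs_self Bω]
  · obtain ⟨g1, g2⟩ := hG k hk
    have e : m.f k a - m.f k b = a * (m.g k a - m.g k b) + (a - b) * m.g k b := by
      simp only [f]; ring
    have a1 : |a| ≤ 1 := abs_le.2 ⟨by linarith [ha.1], ha.2⟩
    rw [e]
    refine (abs_add_le _ _).trans ?_
    rw [abs_mul, abs_mul]
    calc _ ≤ 1 * (G * |a - b|) + |a - b| * G := by
          gcongr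
          · exact g1 a b
          · exact g2 b hb
      _ = 2 * G * |a - b| := by ring
      _ ≤ _ := mul_le_mul_of_nonneg_right (by linarith) (abs_nonneg _)
  · have hle : D k ≤ |Bω| + 2 * G + Ds + Sl := (hDs k hk).trans (by linarith)
    obtain ⟨h1, h2, h3, h4, h5, h6⟩ := hD k hk x w hw
    exact ⟨h1.trans hle, h2.trans hle, h3.trans hle, h4.trans hle, h5.trans hle, h6.trans hle⟩
  · exact (abs_S_sub_S_le hG0 hD0 hB0 hG
      (fun k hk x u hu => (hBν k hk x u hu).trans (hBs k hk)) hl x ha hb hA hB ha' hb' hA'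
      hB').trans (mul_le_mul_of_nonneg_right (by linarith) (by positivity))

end Model

/-- Stability of entropy solutions in terms of regular representatives. -/
theorem exists_entropySolution_stability_const (N : ℕ) (M : ℝ) : ∃ C : ℝ, ∀ {m : Model}
    {T L L' : ℝ} {u₀ v₀ : ℕ → ℝ → ℝ} {u v w z : ℕ → ℝ → ℝ → ℝ},
    m.Admissible N → m.DataBounds N M →
    IsEntropySolution m N T u₀ u → IsEntropySolution m N T v₀ v →
    RegularCurve M L w → (∀ k ∈ Finset.Icc 1 N, ∀ t ∈ Icc 0 T, w k t =ᵐ[volume] u k t) →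
    RegularCurve M L' z → (∀ k ∈ Finset.Icc 1 N, ∀ t ∈ Icc 0 T, z k t =ᵐ[volume] v k t) →
    (∀ k ∈ Finset.Icc 1 N, ∀ t, ∫ x, |z k t x| ≤ M) →
    ∀ t ∈ Icc 0 T, ∑ k ∈ Finset.Icc 1 N, ∫ x, |u k t x - v k t x|
      ≤ Real.exp (C * t) * ∑ k ∈ Finset.Icc 1 N, ∫ x, |u₀ k x - v₀ k x| := by
  obtain ⟨C, hC⟩ := exists_stability_const N M
  refine ⟨C, fun {m T L L' u₀ v₀ u v w z} h hb hu hv hw hwu hz hzv hzM t ht => ?_⟩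
  choose! B hB using fun k (hk : k ∈ Finset.Icc 1 N) => hu.exists_kruzhkovCurve h hb hw hwu hk
  choose! B' hB' using fun k (hk : k ∈ Finset.Icc 1 N) => hv.exists_kruzhkovCurve h hb hz hzv hk
  have key := hC (B := fun k => max (B k) (B' k)) h hb hw hz hzM
    (fun k hk => (hB k hk).mono (le_max_left _ _))
    (fun k hk => (hB' k hk).mono (le_max_right _ _)) t ht
  have h0 : (0 : ℝ) ∈ Icc 0 T := ⟨le_rfl, ht.1.trans ht.2⟩
  have e1 : ∀ k ∈ Finset.Icc 1 N, ∫ x, |w k t x - z k t x| = ∫ x, |u k t x - v k t x| := by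
    intro k hk
    refine integral_congr_ae ?_
    filter_upwards [hwu k hk t ht, hzv k hk t ht] with x h1 h2
    rw [h1, h2]
  have e2 : ∀ k ∈ Finset.Icc 1 N, ∫ x, |w k 0 x - z k 0 x| = ∫ x, |u₀ k x - v₀ k x| := by
    intro k hk
    refine integral_congr_ae ?_
    filter_upwards [hwu k hk 0 h0, hzv k hk 0 h0, hu.initial k hk, hv.initial k hk]
      with x h1 h2 h3 h4
    rw [h1, h2, h3, h4]
  rwa [Finset.sum_congr rfl e1, Finset.sum_congr rfl e2] at key

theorem NormsLE.dataBounds {m : Model} {N : ℕ} {T M : ℝ} {u₀ : ℕ → ℝ → ℝ} {u v : ℕ → ℝ → ℝ → ℝ}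
    (h : NormsLE m N T M u₀ u v) : m.DataBounds N (max M 0) where
  nonneg := le_max_right _ _
  ω_sup z hz := (h.ω_sup z hz).trans (le_max_left _ _)
  f_lip k hk a ha b hb := (h.f_lip k hk a ha b hb).trans
    (mul_le_mul_of_nonneg_right (le_max_left _ _) (abs_nonneg _))
  ν_deriv k hk x w hw := by
    have hM := le_max_left M 0
    obtain ⟨h1, h2, h3, h4, h5, h6⟩ := h.ν_deriv k hk x w hw
    exact ⟨h1.trans hM, h2.trans hM, h3.trans hM, h4.trans hM, h5.trans hM, h6.trans hM⟩
  S_lip k hk x a ha b hb' A hA B hB a' ha' b' hb'' A' hA' B' hB' :=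
    (h.S_lip k hk x a ha b hb' A hA B hB a' ha' b' hb'' A' hA' B' hB').trans
      (mul_le_mul_of_nonneg_right (le_max_left _ _) (by positivity))

/-- `M` is replaced by `max M 0`, because `DataBounds` includes nonnegativity whereas `NormsLE`
allows any real `M`. The constant is fixed before the model and the solutions. -/
theorem exists_stability_const_of_normsLE (N : ℕ) (T M : ℝ) : ∃ C : ℝ,
    ∀ (m : Model) (u₀ v₀ : ℕ → ℝ → ℝ) (u v : ℕ → ℝ → ℝ → ℝ), m.Admissible N →
      IsEntropySolution m N T u₀ u → IsEntropySolution m N T v₀ v →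
      NormsLE m N T M u₀ u v → 0 ≤ T →
      ∑ k ∈ Finset.Icc 1 N, ∫ x, |u k T x - v k T x|
        ≤ C * ∑ k ∈ Finset.Icc 1 N, ∫ x, |u₀ k x - v₀ k x| := by
  obtain ⟨C, hC⟩ := exists_entropySolution_stability_const N (max M 0)
  refine ⟨Real.exp (C * T), fun m u₀ v₀ u v h hu hv hn hT => ?_⟩
  have hM : 0 ≤ max M 0 := le_max_right _ _
  obtain ⟨L, w, hw, hwu, -⟩ := hu.space.exists_regularCurve hT hM fun k hk t ht =>
    (hn.u_var k hk t ht).trans (ENNReal.ofReal_le_ofReal (le_max_left _ _))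
  obtain ⟨L', z, hz, hzv, hzc⟩ := hv.space.exists_regularCurve hT hM fun k hk t ht =>
    (hn.v_var k hk t ht).trans (ENNReal.ofReal_le_ofReal (le_max_left _ _))
  -- The norm bound is required at all real times, whereas the data give it on [0, T]; constancy of
  -- the representative under the projection `clamp` closes the gap.
  refine hC h hn.dataBounds hu hv hw hwu hz hzv (fun k hk t => ?_) T ⟨hT, le_rfl⟩
  have hc := clamp_mem hT t
  have e : ∫ x, |z k t x| = ∫ x, |v k (clamp T t) x| := by
    rw [hzc k t]
    refine integral_congr_ae ?_
    filter_upwards [hzv k hk _ hc] with x hx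
    rw [hx]
  rw [e]
  exact (Finset.single_le_sum (f := fun k => ∫ x, |v k (clamp T t) x|)
    (fun i _ => integral_nonneg fun x => abs_nonneg _) hk).trans
      ((hn.v_L1 _ hc).trans (le_max_left _ _))

/-- Uniqueness of entropy solutions, slice by slice. -/
theorem IsEntropySolution.ae_eq {m : Model} {N : ℕ} {T : ℝ} {u₀ v₀ : ℕ → ℝ → ℝ}
    {u v : ℕ → ℝ → ℝ → ℝ} (hu : IsEntropySolution m N T u₀ u)
    (hv : IsEntropySolution m N T v₀ v) (h : m.Admissible N)
    (h0 : ∀ k ∈ Finset.Icc 1 N, u₀ k =ᵐ[volume] v₀ k) {k : ℕ} (hk : k ∈ Finset.Icc 1 N)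
    {t : ℝ} (ht : t ∈ Icc 0 T) : u k t =ᵐ[volume] v k t := by
  have hT : 0 ≤ T := ht.1.trans ht.2
  obtain ⟨M₀, hb⟩ := h.exists_dataBounds
  obtain ⟨V, hV0, hV⟩ := hu.space.exists_essVar_le
  obtain ⟨V', hV0', hV'⟩ := hv.space.exists_essVar_le
  obtain ⟨L, w, hw, hwu, -⟩ := hu.space.exists_regularCurve hT hV0 hV
  obtain ⟨L', z, hz, hzv, -⟩ := hv.space.exists_regularCurve hT hV0' hV'
  have hL : 0 ≤ L' := (integral_nonneg fun x => abs_nonneg _).trans (hz.norm k t)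
  have hM := hb.nonneg
  -- The sum dominates at once the data bounds, both variations and the `L¹` norm of `z`. Its size
  -- is irrelevant, since the initial distance is zero.
  obtain ⟨C, hC⟩ := exists_entropySolution_stability_const N (M₀ + V + V' + L')
  have key := hC h (hb.mono (by linarith)) hu hv (hw.mono (by linarith)) hwu
    (hz.mono (by linarith)) hzv (fun k _ t => (hz.norm k t).trans (by linarith)) t ht
  have e0 : ∀ k ∈ Finset.Icc 1 N, ∫ x, |u₀ k x - v₀ k x| = 0 := by
    intro k hk
    refine integral_eq_zero_of_ae ?_
    filter_upwards [h0 k hk] with x hx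
    rw [hx, sub_self, abs_zero, Pi.zero_apply]
  rw [Finset.sum_eq_zero e0, mul_zero] at key
  have hn : ∀ i ∈ Finset.Icc 1 N, 0 ≤ ∫ x, |u i t x - v i t x| := fun i _ =>
    integral_nonneg fun x => abs_nonneg _
  have hz0 : ∫ x, |u k t x - v k t x| = 0 :=
    le_antisymm ((Finset.single_le_sum hn hk).trans key) (hn k hk)
  have hi : Integrable fun x => |u k t x - v k t x| :=
    ((hu.space.integrable k hk t ht).sub (hv.space.integrable k hk t ht)).abs
  filter_upwards [(integral_eq_zero_iff_of_nonneg (fun x => abs_nonneg _) hi).1 hz0] with x hx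
  exact sub_eq_zero.1 (abs_eq_zero.1 hx)

end Multilane

end

theorem theorem3p2 (N : ℕ) (T : ℝ) (hT : 0 < T) :
    (∀ M : ℝ, ∃ C : ℝ, ∀ (m : Multilane.Model) (u₀ v₀ : ℕ → ℝ → ℝ) (u v : ℕ → ℝ → ℝ → ℝ),
      m.Admissible N →
      Multilane.IsInitialDatum N u₀ → Multilane.IsInitialDatum N v₀ →
      Multilane.IsEntropySolution m N T u₀ u → Multilane.IsEntropySolution m N T v₀ v →
      Multilane.NormsLE m N T M u₀ u v →
      ∑ k ∈ Finset.Icc 1 N, ∫ x, |u k T x - v k T x|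
        ≤ C * ∑ k ∈ Finset.Icc 1 N, ∫ x, |u₀ k x - v₀ k x|) ∧
    (∀ (m : Multilane.Model) (u₀ v₀ : ℕ → ℝ → ℝ) (u v : ℕ → ℝ → ℝ → ℝ),
      m.Admissible N →
      Multilane.IsInitialDatum N u₀ → Multilane.IsInitialDatum N v₀ →
      Multilane.IsEntropySolution m N T u₀ u → Multilane.IsEntropySolution m N T v₀ v →
      (∀ k ∈ Finset.Icc 1 N, u₀ k =ᵐ[volume] v₀ k) →
      ∀ k ∈ Finset.Icc 1 N,
        ∀ᵐ p : ℝ × ℝ ∂(volume.restrict (Icc 0 T ×ˢ univ)), u k p.1 p.2 = v k p.1 p.2) := by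
  refine ⟨fun M => ?_, fun m u₀ v₀ u v h _ _ hu hv h0 k hk => ?_⟩
  · obtain ⟨C, hC⟩ := Multilane.exists_stability_const_of_normsLE N T M
    exact ⟨C, fun m u₀ v₀ u v h _ _ hu hv hn => hC m u₀ v₀ u v h hu hv hn hT.le⟩
  -- Equality on every time slice gives equality almost everywhere on the strip, by the joint
  -- measurability in the solution space.
  · exact Multilane.ae_strip_of_slices (hv.space.meas k hk) (hu.space.meas k hk)
      fun t ht => hu.ae_eq hv h h0 hk ht
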